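/- **Setting.** Let $\mathbf J'=T_1\Join\cdots\Join T_m$ be an acyclic natural join of $m$ tables (relations with pairwise distinct real-valued rows) over $d\ge 1$ columns in total, whose largest table has $n\ge 1$ rows. Acyclic means that by repeatedly removing a column that lies in only one remaining table, or a table whose remaining columns are contained in those of another remaining table, one can reach a single table without columns. Assign each column to one table containing it. Let $D_i$ be the set of distinct projections of the rows of $T_i$ to the columns assigned to $T_i$, and let $\mathbf J$ be the matrix with $d$ columns and with one row for each element of $D_1\times\cdots\times D_m$, which is the corresponding tuple if that tuple is in $\mathbf J'$, and zero otherwise. Write $F(\mathbf J')$ for $F(\mathbf J)$. **Multiplication order.** Fix a run of the algorithm Inside-Out on the join, that is, a reduction sequence as above, in which removing a column sums it out of the factor of its table, and removing a table multiplies its factor (on the left or on the right) into the factor of a table containing its columns. Let $\rho$ be the resulting binary expression tree, which has one leaf per table. **DB-Sketch.** An $(m,\rho)$-DB-Sketch consists of a set $R$ with binary operations $\oplus$ and $\odot$, a map $F$ from the real $(D_1\times\cdots\times D_m)\times d$ matrices to $R$, and maps $F_i$ from the real $D_i\times c$ matrices to $R$ (for all $i\le m$ and all $c$), such that 1. $\oplus$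 is commutative and associative, and $F(A+B)=F(A)\oplus F(B)$ for all $A,B$; 2. $F(A_1\otimes\cdots\otimes A_m)=F_1(A_1)\odot\cdots\odot F_m(A_m)$, evaluated in the order $\rho$, for every Kronecker product with $d$ columns of matrices $A_i$ with row sets $D_i$; and $F_i(A+B)=F_i(A)\oplus F_i(B)$ for all $i,A,B$; 3. $a\odot(b\oplus c)=(a\odot b)\oplus(a\odot c)$ and $(b\oplus c)\odot a=(b\odot a)\oplus(c\odot a)$ for all $a,b,c\in R$. **Machine.** Consider a unit-cost random access machine with random access to the entries of the tables, to the schema, to the assignment of the columns and to the reduction sequence. It can compare real numbers, and sketches are opaque objects. One $\oplus$ takes time $T_\oplus\ge 1$, one $\odot$ takes time $T_\odot\ge 1$, and evaluating $F_i$ on a matrix $A$ given as a list of entries takes time $T_f\cdot\mathrm{nnz}(A)$ (plus the time for reading the list), where $\mathrm{nnz}(A)$ is the number of nonzero entries of $A$. **Theorem.** There is a single algorithm that, for every acyclic join, every such reduction sequence with multiplication order $\rho$ and every $(m,\rho)$-DB-Sketch, evaluates $F(\mathbf J')$ in time $$O\big(m\,(T_\odot+T_\oplus)\,T_{\mathrm{FAQ}}+T_f\,mnd\big),$$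 where $T_{\mathrm{FAQ}}=m\,d^2\,n\,(1+\log n)$ is the running time of Inside-Out on one single-semiring functional aggregate query over an acyclic join with operators of unit cost, and the implied constant is absolute. -/

import Mathlib

/-! ### Join queries -/

/-- A natural join `T₁ ⋈ ⋯ ⋈ T_m` with `m` tables over `d` columns in total.  Table `i` has the
set of columns `cols i` and `size i` rows; it is a relation, so its rows are pairwise distinct.
Every column `c` is assigned to one table `owner c` that contains it. -/
structure JoinQuery (m d : ℕ) where
  cols : Fin m → Finset (Fin d)
  owner : Fin d → Fin m
  owner_mem : ∀ c, c ∈ cols (owner c)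
  size : Fin m → ℕ
  table : ∀ i, Fin (size i) → {c // c ∈ cols i} → ℝ
  distinct : ∀ i, Function.Injective (table i)

namespace JoinQuery

variable {m d : ℕ}

/-- The number `n` of rows of the largest table. -/
def maxSize (Q : JoinQuery m d) : ℕ := Finset.univ.sup Q.size

/-- The set of tuples of the natural join: every projection to the columns of a table is a row of
that table. -/
def joinSet (Q : JoinQuery m d) : Set (Fin d → ℝ) :=
  {x | ∀ i, ∃ r : Fin (Q.size i), ∀ c : {c // c ∈ Q.cols i}, x c.1 = Q.table i r c}

/-- The projection of row `r` of table `i` to the columns that are assigned to table `i`. -/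
def rowProj (Q : JoinQuery m d) (i : Fin m) (r : Fin (Q.size i)) : {c // Q.owner c = i} → ℝ :=
  fun c => Q.table i r ⟨c.1, by have h := Q.owner_mem c.1; rwa [c.2] at h⟩

/-- The domain `D_i`: the projection of table `i` to the columns that are assigned to it. -/
def Dom (Q : JoinQuery m d) (i : Fin m) : Type :=
  {y : {c // Q.owner c = i} → ℝ // ∃ r, Q.rowProj i r = y}

/-- The element of `D_i` given by row `r` of table `i`. -/
def domOf (Q : JoinQuery m d) (i : Fin m) (r : Fin (Q.size i)) : Q.Dom i :=
  ⟨Q.rowProj i r, r, rfl⟩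

/-- The tuple over all columns that is described by an element of `D₁ × ⋯ × D_m`. -/
def glue (Q : JoinQuery m d) (y : ∀ i, Q.Dom i) : Fin d → ℝ :=
  fun c => (y (Q.owner c)).1 ⟨c, rfl⟩

open Classical in
/-- The matrix of the join: it has a row for every element of `D₁ × ⋯ × D_m`, which holds the
corresponding tuple if that tuple is in the join, and is zero otherwise. -/
noncomputable def joinMatrix (Q : JoinQuery m d) : Matrix (∀ i, Q.Dom i) (Fin d) ℝ :=
  Matrix.of fun y c => if Q.glue y ∈ Q.joinSet then Q.glue y c else 0

end JoinQuery

/-! ### Acyclicity and multiplication orders -/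

/-- One reduction step on the schema of a join, which consists of the remaining tables and their
remaining columns: remove a column that is in only one of the tables, or remove a table whose
columns are all contained in another table. -/
inductive ReductionStep {m d : ℕ} :
    Finset (Fin m) × (Fin m → Finset (Fin d)) → Finset (Fin m) × (Fin m → Finset (Fin d)) → Prop
  | removeColumn (live : Finset (Fin m)) (cols : Fin m → Finset (Fin d)) (i : Fin m) (c : Fin d)
      (hi : i ∈ live) (hc : c ∈ cols i) (honly : ∀ j ∈ live, c ∈ cols j → j = i) :
      ReductionStep (live, cols) (live, Function.update cols i ((cols i).erase c))
  | removeTable (live : Finset (Fin m)) (cols : Fin m → Finset (Fin d)) (i j : Fin m)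
      (hi : i ∈ live) (hj : j ∈ live) (hij : i ≠ j) (hsub : cols i ⊆ cols j) :
      ReductionStep (live, cols) (live.erase i, cols)

/-- The join is acyclic: the reduction steps can remove all columns, and all tables but one (which
then has no columns left). -/
def JoinQuery.Acyclic {m d : ℕ} (Q : JoinQuery m d) : Prop :=
  ∃ (k : Fin m) (cols : Fin m → Finset (Fin d)),
    Relation.ReflTransGen ReductionStep (Finset.univ, Q.cols) ({k}, cols) ∧ cols k = ∅

/-- Binary expression trees whose leaves are tables. -/
inductive MulTree (m : ℕ) : Type
  | leaf (i : Fin m) : MulTree m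
  | node (l r : MulTree m) : MulTree m

/-- The value of an expression tree, with `mul` at the inner nodes and `g i` at leaf `i`. -/
def MulTree.eval {m : ℕ} {R : Type*} (mul : R → R → R) (g : Fin m → R) : MulTree m → R
  | .leaf i => g i
  | .node l r => mul (l.eval mul g) (r.eval mul g)

/-- The elimination steps of Inside-Out on an acyclic join.  `sumOut i c` sums column `c` out of the
factor of table `i`; `absorb i j b` multiplies the factor of table `i` into that of table `j`, on
the left if `b` is true and on the right otherwise. -/
inductive PlanStep (m d : ℕ) : Type
  | sumOut (i : Fin m) (c : Fin d) : PlanStep m d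
  | absorb (i j : Fin m) (b : Bool) : PlanStep m d

/-- `PlanRun cols plan live cols' tree`: Inside-Out can perform the elimination steps `plan` on the
schema `cols`, which leaves the factors of the tables in `live`, over the columns `cols'`, and the
current factor of table `i` is a product of input factors in the order of `tree i`. The steps are
those of `ReductionStep`. -/
inductive PlanRun {m d : ℕ} (cols : Fin m → Finset (Fin d)) :
    List (PlanStep m d) → Finset (Fin m) → (Fin m → Finset (Fin d)) → (Fin m → MulTree m) → Prop
  | start : PlanRun cols [] Finset.univ cols MulTree.leaf
  | sumOut {plan : List (PlanStep m d)} {live : Finset (Fin m)} {cols' : Fin m → Finset (Fin d)}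
      {tree : Fin m → MulTree m} (h : PlanRun cols plan live cols' tree) (i : Fin m) (c : Fin d)
      (hi : i ∈ live) (hc : c ∈ cols' i) (honly : ∀ j ∈ live, c ∈ cols' j → j = i) :
      PlanRun cols (plan ++ [PlanStep.sumOut i c]) live
        (Function.update cols' i ((cols' i).erase c)) tree
  | absorb {plan : List (PlanStep m d)} {live : Finset (Fin m)} {cols' : Fin m → Finset (Fin d)}
      {tree : Fin m → MulTree m} (h : PlanRun cols plan live cols' tree) (i j : Fin m) (b : Bool)
      (hi : i ∈ live) (hj : j ∈ live) (hij : i ≠ j) (hsub : cols' i ⊆ cols' j) :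
      PlanRun cols (plan ++ [PlanStep.absorb i j b]) (live.erase i) cols'
        (Function.update tree j
          (if b then MulTree.node (tree i) (tree j) else MulTree.node (tree j) (tree i)))

/-- `ρ` is the multiplication order of the join for the run `plan` of Inside-Out, which eliminates
all columns and leaves a single factor. -/
def JoinQuery.IsMulOrder {m d : ℕ} (Q : JoinQuery m d) (plan : List (PlanStep m d))
    (ρ : MulTree m) : Prop :=
  ∃ (k : Fin m) (cols' : Fin m → Finset (Fin d)) (tree : Fin m → MulTree m),
    PlanRun Q.cols plan {k} cols' tree ∧ cols' k = ∅ ∧ tree k = ρ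

/-- A join has a multiplication order if and only if it is acyclic. -/
theorem JoinQuery.acyclic_iff_exists_isMulOrder {m d : ℕ} (Q : JoinQuery m d) :
    Q.Acyclic ↔ ∃ plan ρ, Q.IsMulOrder plan ρ := by
  constructor
  · rintro ⟨k, cols, h, hk⟩
    have key : ∀ s, Relation.ReflTransGen ReductionStep (Finset.univ, Q.cols) s →
        ∃ plan tree, PlanRun Q.cols plan s.1 s.2 tree := by
      intro s hs
      induction hs with
      | refl => exact ⟨_, _, PlanRun.start⟩
      | tail _ hst ih =>
        obtain ⟨plan, tree, hrun⟩ := ih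
        cases hst with
        | removeColumn live cols i c hi hc honly => exact ⟨_, _, hrun.sumOut i c hi hc honly⟩
        | removeTable live cols i j hi hj hij hsub =>
          exact ⟨_, _, hrun.absorb i j false hi hj hij hsub⟩
    obtain ⟨plan, tree, hrun⟩ := key _ h
    exact ⟨plan, tree k, k, cols, tree, hrun, hk, rfl⟩
  · rintro ⟨plan, ρ, k, cols', tree, hrun, hk, -⟩
    refine ⟨k, cols', ?_, hk⟩
    clear hk
    generalize ({k} : Finset (Fin m)) = live at hrun
    induction hrun with
    | start => exact Relation.ReflTransGen.refl
    | sumOut _ i c hi hc honly ih => exact ih.tail (ReductionStep.removeColumn _ _ i c hi hc honly)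
    | absorb _ i j b hi hj hij hsub ih =>
      exact ih.tail (ReductionStep.removeTable _ _ i j hi hj hij hsub)

/-! ### DB-Sketches -/

/-- The Kronecker product of matrices `A i` with row sets `D i` and with `c i` columns, as a matrix
with `d` columns. Rows are indexed by tuples; the columns come in the usual (lexicographic) order
of a Kronecker product, which the unique order isomorphism `σ` numbers. -/
def kroneckerProduct {m d : ℕ} {D : Fin m → Type} {c : Fin m → ℕ}
    (σ : (Πₗ i, Fin (c i)) ≃o Fin d) (A : ∀ i, Matrix (D i) (Fin (c i)) ℝ) :
    Matrix (∀ i, D i) (Fin d) ℝ :=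
  Matrix.of fun x y => ∏ i, A i (x i) (ofLex (σ.symm y) i)

/-- An `(m, ρ)`-DB-Sketch for the join `Q`, with sketches in `R`: the sketch `F` of matrices of the
format of the join matrix, the sketches `part i` of the `i`-th factors of Kronecker products (for
every number of columns), and the operators `add` (written `⊕`) and `mul` (written `⊙`) on
sketches. -/
structure DBSketch {m d : ℕ} (Q : JoinQuery m d) (ρ : MulTree m) (R : Type*) where
  F : Matrix (∀ i, Q.Dom i) (Fin d) ℝ → R
  part : ∀ (i : Fin m) (c : ℕ), Matrix (Q.Dom i) (Fin c) ℝ → R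
  add : R → R → R
  mul : R → R → R
  add_comm : ∀ a b, add a b = add b a
  add_assoc : ∀ a b c, add (add a b) c = add a (add b c)
  map_add : ∀ A B, F (A + B) = add (F A) (F B)
  map_kronecker : ∀ (c : Fin m → ℕ) (σ : (Πₗ i, Fin (c i)) ≃o Fin d)
    (A : ∀ i, Matrix (Q.Dom i) (Fin (c i)) ℝ),
    F (kroneckerProduct σ A) = ρ.eval mul fun i => part i (c i) (A i)
  part_add : ∀ i c A B, part i c (A + B) = add (part i c A) (part i c B)
  mul_add : ∀ a b c, mul a (add b c) = add (mul a b) (mul a c)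
  add_mul : ∀ a b c, mul (add a b) c = add (mul a c) (mul b c)

/-! ### The machine model

A unit-cost random access machine, programmed in a structured language.  It has number registers,
arrays of numbers with two indices, registers for reals, arrays of sketches with two indices, and
a buffer that holds a sparse matrix as a list of entries.  Sketches are opaque: they are only
produced and combined by the three operations of a DB-Sketch. All loops are bounded, which is no
more than a restriction on the programs. -/

/-- Expressions for natural numbers. `sub` is truncated, `half` is division by two rounded down, and
`le`, `eq` have the value `1` (true) or `0` (false). -/
inductive NatExp : Type
  | const (k : ℕ) : NatExp
  | var (x : ℕ) : NatExp
  | get (a : ℕ) (i j : NatExp) : NatExp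
  | add (e f : NatExp) : NatExp
  | sub (e f : NatExp) : NatExp
  | half (e : NatExp) : NatExp
  | le (e f : NatExp) : NatExp
  | eq (e f : NatExp) : NatExp

/-- A cell of the array of sketches with name `name`. -/
structure SketchCell where
  name : ℕ
  row : NatExp
  col : NatExp

/-- Programs. -/
inductive Prog : Type
  | skip : Prog
  /-- number register `x` := `e` -/
  | assign (x : ℕ) (e : NatExp) : Prog
  /-- number array cell `a[i, j]` := `e` -/
  | store (a : ℕ) (i j e : NatExp) : Prog
  /-- real register `x` := the entry of table `i` in row `r` and column `c` -/
  | read (x : ℕ) (i r c : NatExp) : Prog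
  /-- real register `x` := `1` -/
  | one (x : ℕ) : Prog
  /-- number register `z` := `1` if real register `x` is at most real register `y`, else `0` -/
  | compare (z x y : ℕ) : Prog
  /-- empty the buffer -/
  | clear : Prog
  /-- append to the buffer the entry with the value of real register `x`, in column `c` and in the
  row that belongs to row `r` of the table -/
  | push (r c : NatExp) (x : ℕ) : Prog
  /-- `u` := the sketch `F_i` of the matrix with `c` columns in the buffer -/
  | sketch (u : SketchCell) (i c : NatExp) : Prog
  | copy (u v : SketchCell) : Prog
  /-- `u` := `v ⊕ w` -/
  | sketchAdd (u v w : SketchCell) : Prog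
  /-- `u` := `v ⊙ w` -/
  | sketchMul (u v w : SketchCell) : Prog
  | seq (p q : Prog) : Prog
  /-- if `e` is nonzero then `p` else `q` -/
  | ite (e : NatExp) (p q : Prog) : Prog
  /-- for `x = 0, …, e - 1` do `p`, where `e` is evaluated once, before the loop -/
  | loop (x : ℕ) (e : NatExp) (p : Prog) : Prog

/-- States of the machine. A cell that holds no sketch has the value `none`. -/
structure MachineState (R : Type*) where
  var : ℕ → ℕ
  arr : ℕ → ℕ → ℕ → ℕ
  real : ℕ → ℝ
  buf : List (ℕ × ℕ × ℝ)
  sk : ℕ → ℕ → ℕ → Option R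

/-- The number of operations of an expression. -/
def NatExp.cost : NatExp → ℕ
  | .const _ => 1
  | .var _ => 1
  | .get _ i j => 1 + i.cost + j.cost
  | .add e f => 1 + e.cost + f.cost
  | .sub e f => 1 + e.cost + f.cost
  | .half e => 1 + e.cost
  | .le e f => 1 + e.cost + f.cost
  | .eq e f => 1 + e.cost + f.cost

/-- The value of an expression. -/
def NatExp.eval {R : Type*} (s : MachineState R) : NatExp → ℕ
  | .const k => k
  | .var x => s.var x
  | .get a i j => s.arr a (i.eval s) (j.eval s)
  | .add e f => e.eval s + f.eval s
  | .sub e f => e.eval s - f.eval s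
  | .half e => e.eval s / 2
  | .le e f => if e.eval s ≤ f.eval s then 1 else 0
  | .eq e f => if e.eval s = f.eval s then 1 else 0

/-- The cost of the address of a cell. -/
def SketchCell.cost (u : SketchCell) : ℕ := u.row.cost + u.col.cost

/-- The content of a cell. -/
def SketchCell.value {R : Type*} (u : SketchCell) (s : MachineState R) : Option R :=
  s.sk u.name (u.row.eval s) (u.col.eval s)

namespace MachineState

variable {R : Type*}

/-- Write a number register. -/
def setVar (s : MachineState R) (x v : ℕ) : MachineState R :=
  { s with var := Function.update s.var x v }

/-- Write a cell of a number array. -/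
def setArr (s : MachineState R) (a i j v : ℕ) : MachineState R :=
  { s with arr := fun a' i' j' => if a' = a ∧ i' = i ∧ j' = j then v else s.arr a' i' j' }

/-- Write a real register. -/
def setReal (s : MachineState R) (x : ℕ) (v : ℝ) : MachineState R :=
  { s with real := Function.update s.real x v }

/-- Write a cell of an array of sketches. -/
def setCell (s : MachineState R) (u : SketchCell) (v : Option R) : MachineState R :=
  { s with sk := fun a i j =>
      if a = u.name ∧ i = u.row.eval s ∧ j = u.col.eval s then v else s.sk a i j }

end MachineState

namespace JoinQuery

variable {m d : ℕ}

/-- Random access to the entries of the tables (`0` outside of the tables). -/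
def entry (Q : JoinQuery m d) (i r c : ℕ) : ℝ :=
  if h : ∃ (hi : i < m) (hc : c < d), r < Q.size ⟨i, hi⟩ ∧ (⟨c, hc⟩ : Fin d) ∈ Q.cols ⟨i, hi⟩ then
    Q.table ⟨i, h.1⟩ ⟨r, h.2.2.1⟩ ⟨⟨c, h.2.1⟩, h.2.2.2⟩
  else 0

open Classical in
/-- The matrix with row set `D_i` and `c` columns that is described by a list of entries `(r, k, v)`:
the value `v` in column `k` and in the row of `D_i` given by row `r` of table `i`. Entries in the
same position are added up, entries outside of the format are ignored. -/
noncomputable def bufferMatrix (Q : JoinQuery m d) (i : Fin m) (c : ℕ) (buf : List (ℕ × ℕ × ℝ)) :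
    Matrix (Q.Dom i) (Fin c) ℝ :=
  (buf.map fun e =>
    if h : e.1 < Q.size i ∧ e.2.1 < c then
      Matrix.single (Q.domOf i ⟨e.1, h.1⟩) (⟨e.2.1, h.2⟩ : Fin c) e.2.2
    else 0).sum

/-- The encoding of one elimination step by four numbers. -/
def planCode : PlanStep m d → ℕ → ℕ
  | .sumOut _ _, 0 => 0
  | .sumOut i _, 1 => i
  | .sumOut _ c, 2 => c
  | .absorb _ _ _, 0 => 1
  | .absorb i _ _, 1 => i
  | .absorb _ j _, 2 => j
  | .absorb _ _ b, 3 => if b then 1 else 0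
  | _, _ => 0

/-- The initial state. The number registers `0`, `1`, `2` hold `m`, `d` and the number of elimination
steps; the number arrays `0`, `1`, `2`, `3` hold the sizes of the tables, the incidence matrix of
tables and columns, the assignment of the columns to tables, and the elimination steps. -/
def initState (Q : JoinQuery m d) (plan : List (PlanStep m d)) (R : Type*) : MachineState R where
  var := fun x =>
    match x with
    | 0 => m
    | 1 => d
    | 2 => plan.length
    | _ => 0
  arr := fun a i j =>
    match a with
    | 0 => if h : i < m then Q.size ⟨i, h⟩ else 0
    | 1 => if ∃ (hi : i < m) (hj : j < d), (⟨j, hj⟩ : Fin d) ∈ Q.cols ⟨i, hi⟩ then 1 else 0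
    | 2 => if h : i < d then (Q.owner ⟨i, h⟩ : ℕ) else 0
    | 3 => if h : i < plan.length then planCode plan[i] j else 0
    | _ => 0
  real := fun _ => 0
  buf := []
  sk := fun _ _ _ => none

end JoinQuery

/-- The number of nonzero entries of a matrix. -/
noncomputable def nnz {ι κ : Type*} (A : Matrix ι κ ℝ) : ℕ :=
  {p : ι × κ | A p.1 p.2 ≠ 0}.ncard

/-- The costs of the sketch operations: `add` for one `⊕`, `mul` for one `⊙`, and `sketch` for every
nonzero entry of the argument of some `F_i`. -/
structure SketchCosts where
  add : ℕ
  mul : ℕ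
  sketch : ℕ

open Classical in
/-- The execution of a program on the join `Q` with a DB-Sketch `S`: the final state and the time. -/
noncomputable def Prog.run {m d : ℕ} {Q : JoinQuery m d} {ρ : MulTree m} {R : Type*}
    (S : DBSketch Q ρ R) (K : SketchCosts) : Prog → MachineState R → MachineState R × ℕ
  | .skip => fun s => (s, 1)
  | .assign x e => fun s => (s.setVar x (e.eval s), 1 + e.cost)
  | .store a i j e => fun s =>
      (s.setArr a (i.eval s) (j.eval s) (e.eval s), 1 + i.cost + j.cost + e.cost)
  | .read x i r c => fun s =>
      (s.setReal x (Q.entry (i.eval s) (r.eval s) (c.eval s)), 1 + i.cost + r.cost + c.cost)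
  | .one x => fun s => (s.setReal x 1, 1)
  | .compare z x y => fun s => (s.setVar z (if s.real x ≤ s.real y then 1 else 0), 1)
  | .clear => fun s => ({ s with buf := [] }, 1)
  | .push r c x => fun s =>
      ({ s with buf := s.buf ++ [(r.eval s, c.eval s, s.real x)] }, 1 + r.cost + c.cost)
  | .sketch u i c => fun s =>
      if h : i.eval s < m then
        let A := Q.bufferMatrix ⟨i.eval s, h⟩ (c.eval s) s.buf
        (s.setCell u (some (S.part ⟨i.eval s, h⟩ (c.eval s) A)),
          1 + u.cost + i.cost + c.cost + s.buf.length + K.sketch * nnz A)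
      else (s, 1 + u.cost + i.cost + c.cost)
  | .copy u v => fun s => (s.setCell u (v.value s), 1 + u.cost + v.cost)
  | .sketchAdd u v w => fun s =>
      (s.setCell u (Option.map₂ S.add (v.value s) (w.value s)),
        1 + u.cost + v.cost + w.cost + K.add)
  | .sketchMul u v w => fun s =>
      (s.setCell u (Option.map₂ S.mul (v.value s) (w.value s)),
        1 + u.cost + v.cost + w.cost + K.mul)
  | .seq p q => fun s =>
      let s₁ := p.run S K s
      let s₂ := q.run S K s₁.1
      (s₂.1, s₁.2 + s₂.2)
  | .ite e p q => fun s =>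
      let s₁ := if e.eval s ≠ 0 then p.run S K s else q.run S K s
      (s₁.1, 1 + e.cost + s₁.2)
  | .loop x e p => fun s =>
      Nat.rec (s, 1 + e.cost)
        (fun k t =>
          let t' := p.run S K (t.1.setVar x k)
          (t'.1, t.2 + 1 + t'.2))
        (e.eval s)

/-- The running time `m d² n (1 + log n)` of Inside-Out for one single-semiring functional aggregate
query over an acyclic join, with operators of unit cost; it is `m d² n ^ fhtw (1 + log n)`, where
the fractional hypertree width `fhtw` of an acyclic join is `1`. -/
def JoinQuery.faqTime {m d : ℕ} (Q : JoinQuery m d) : ℕ :=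
  m * d ^ 2 * Q.maxSize * (1 + Nat.log 2 Q.maxSize)

/-!
By additivity and the rule for Kronecker products, `F(J)` is the sum, over the columns `k` and over
the consistent choices of one row of every table, of the product in the order `ρ` of the sketches of
matrices with a single entry: the factor of the table that owns `k` carries the value in column `k`,
the factors of the other tables are indicators of rows. For fixed `k` this is a sum of products over
the join, and the distributive laws allow its evaluation along the given elimination. To absorb a
table into another one, sort the rows of both by their common columns, add up the factors of the
absorbed table over the rows with equal keys, and multiply the sums into the factors of the matching
rows of the other table. With merge sort this takes `O(d n (1 + log n))` operations, and there are
fewer than `m` absorptions for each of the `d` columns.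

Since `⊕` has no neutral element, empty sums are replaced by sketches of zero matrices. This changes
the result only by products with a zero factor, that is, by copies of `F(0)`, which do no harm since
`F(J) = F(0) ⊕ F(J)`.
-/

/-! ### Sketches with a formal zero -/

namespace DBSketch

variable {m d : ℕ} {Q : JoinQuery m d} {ρ : MulTree m} {R : Type*}

/-- Sketches together with a formal zero `none`, in which empty sums of sketches have a value. -/
def Val (_S : DBSketch Q ρ R) : Type _ := Option R

instance (S : DBSketch Q ρ R) : Zero S.Val := ⟨none⟩

instance (S : DBSketch Q ρ R) : Add S.Val := ⟨Option.merge S.add⟩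

instance (S : DBSketch Q ρ R) : Mul S.Val := ⟨Option.map₂ S.mul⟩

instance (S : DBSketch Q ρ R) : NonUnitalNonAssocSemiring S.Val where
  nsmul := nsmulRec
  add_assoc := by
    rintro (_ | a) (_ | b) (_ | c) <;> first | rfl | exact congrArg some (S.add_assoc a b c)
  zero_add := by rintro (_ | a) <;> rfl
  add_zero := by rintro (_ | a) <;> rfl
  add_comm := by rintro (_ | a) (_ | b) <;> first | rfl | exact congrArg some (S.add_comm a b)
  zero_mul := by rintro (_ | a) <;> rfl
  mul_zero := by rintro (_ | a) <;> rfl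
  left_distrib := by
    rintro (_ | a) (_ | b) (_ | c) <;> first | rfl | exact congrArg some (S.mul_add a b c)
  right_distrib := by
    rintro (_ | a) (_ | b) (_ | c) <;> first | rfl | exact congrArg some (S.add_mul a b c)

/-- The sketch `a` as an element of the semiring `S.Val`. -/
def val (S : DBSketch Q ρ R) (a : R) : S.Val := some a

variable (S : DBSketch Q ρ R)

theorem val_injective : Function.Injective S.val := Option.some_injective R

theorem val_add (a b : R) : S.val (S.add a b) = S.val a + S.val b := rfl

theorem val_mul (a b : R) : S.val (S.mul a b) = S.val a * S.val b := rfl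

theorem val_eval (τ : MulTree m) (g : Fin m → R) :
    S.val (τ.eval S.mul g) = τ.eval (· * ·) fun i => S.val (g i) := by
  induction τ with
  | leaf i => rfl
  | node l r hl hr => rw [MulTree.eval, MulTree.eval, val_mul, hl, hr]

theorem val_F_add_sum {ι : Type*} (s : Finset ι) (A : ι → Matrix (∀ i, Q.Dom i) (Fin d) ℝ)
    (B : Matrix (∀ i, Q.Dom i) (Fin d) ℝ) :
    S.val (S.F B) + ∑ i ∈ s, S.val (S.F (A i)) = S.val (S.F (B + ∑ i ∈ s, A i)) := by
  classical
  induction s using Finset.induction_on generalizing B with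
  | empty => rw [Finset.sum_empty, Finset.sum_empty, add_zero, add_zero]
  | insert a s ha ih =>
    rw [Finset.sum_insert ha, Finset.sum_insert ha, ← _root_.add_assoc, ← val_add, ← S.map_add, ih,
      _root_.add_assoc]

end DBSketch

/-! ### The join matrix as a sum of Kronecker products -/

theorem nnz_zero {ι κ : Type*} : nnz (0 : Matrix ι κ ℝ) = 0 := by
  simp [nnz]

theorem nnz_add_le {ι κ : Type*} [Finite ι] [Finite κ] (A B : Matrix ι κ ℝ) :
    nnz (A + B) ≤ nnz A + nnz B := by
  refine (Set.ncard_le_ncard fun p hp => ?_).trans (Set.ncard_union_le _ _)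
  by_contra hne
  simp only [Set.mem_union, Set.mem_ofPred_eq, not_or, not_not] at hne
  exact hp (by rw [Matrix.add_apply, hne.1, hne.2, add_zero])

theorem nnz_single_le {ι κ : Type*} [DecidableEq ι] [DecidableEq κ] (i : ι) (j : κ) (x : ℝ) :
    nnz (Matrix.single i j x) ≤ 1 := by
  refine (Set.ncard_le_ncard (t := {(i, j)}) fun p hp => ?_).trans (Set.ncard_singleton _).le
  by_contra hne
  refine hp ?_
  rw [Matrix.single_apply, if_neg]
  rintro ⟨rfl, rfl⟩
  exact hne rfl

namespace JoinQuery

variable {m d : ℕ} (Q : JoinQuery m d)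

theorem bufferMatrix_nil (i : Fin m) (c : ℕ) : Q.bufferMatrix i c [] = 0 := by
  simp [bufferMatrix]

open Classical in
theorem bufferMatrix_singleton_apply (i : Fin m) (c : ℕ) {r k : ℕ} (v : ℝ) (hr : r < Q.size i)
    (hk : k < c) (y : Q.Dom i) (l : Fin c) :
    Q.bufferMatrix i c [(r, k, v)] y l = if Q.domOf i ⟨r, hr⟩ = y ∧ k = (l : ℕ) then v else 0 := by
  simp [bufferMatrix, hr, hk, Matrix.single_apply, Fin.ext_iff]

instance (i : Fin m) : Finite (Q.Dom i) :=
  (Set.finite_range _).to_subtype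

theorem nnz_bufferMatrix_le_length (i : Fin m) (c : ℕ) (buf : List (ℕ × ℕ × ℝ)) :
    nnz (Q.bufferMatrix i c buf) ≤ buf.length := by
  classical
  induction buf with
  | nil => rw [bufferMatrix_nil, nnz_zero, List.length_nil]
  | cons e buf ih =>
    rw [bufferMatrix, List.map_cons, List.sum_cons, List.length_cons, add_comm]
    refine (nnz_add_le _ _).trans (Nat.add_le_add ih ?_)
    split_ifs
    · exact nnz_single_le _ _ _
    · exact nnz_zero.le.trans zero_le_one

/-- The number of columns of the `i`-th factor of the Kronecker products whose only nonzero column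
is column `k`. -/
def colCount (k : Fin d) (i : Fin m) : ℕ := if i = Q.owner k then d else 1

theorem colCount_owner (k : Fin d) : Q.colCount k (Q.owner k) = d := if_pos rfl

theorem colCount_of_ne {k : Fin d} {i : Fin m} (h : i ≠ Q.owner k) : Q.colCount k i = 1 := if_neg h

theorem colCount_pos (k : Fin d) (i : Fin m) : 0 < Q.colCount k i := by
  unfold colCount
  split_ifs
  exacts [k.pos, one_pos]

theorem colCount_subsingleton {k : Fin d} {i : Fin m} (h : i ≠ Q.owner k) :
    Subsingleton (Fin (Q.colCount k i)) := by
  rw [Q.colCount_of_ne h]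
  infer_instance

theorem exists_colIso (k : Fin d) :
    ∃ σ : (Πₗ i, Fin (Q.colCount k i)) ≃o Fin d,
      ∀ l, ((ofLex (σ.symm l) (Q.owner k) : Fin _) : ℕ) = l := by
  let φ : (Πₗ i, Fin (Q.colCount k i)) → Fin d :=
    fun x => Fin.cast (Q.colCount_owner k) (ofLex x (Q.owner k))
  have φ_strictMono : StrictMono φ := by
    rintro x y ⟨i, -, hlt⟩
    obtain rfl | hi := eq_or_ne i (Q.owner k)
    · exact hlt
    · have := Q.colCount_subsingleton hi
      exact absurd (Subsingleton.elim _ _) hlt.ne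
  have φ_surjective : Function.Surjective φ := fun l =>
    ⟨toLex (Function.update (fun i => ⟨0, Q.colCount_pos k i⟩) (Q.owner k)
      (Fin.cast (Q.colCount_owner k).symm l)), by ext; simp [φ]⟩
  exact ⟨φ_strictMono.orderIsoOfSurjective φ φ_surjective, fun l =>
    congrArg Fin.val ((φ_strictMono.orderIsoOfSurjective φ φ_surjective).apply_symm_apply l)⟩

/-- The list with the only entry of the Kronecker factor for table `i`, row `r` and column `k`. -/
noncomputable def factorBuffer (k : Fin d) (i : Fin m) (r : ℕ) : List (ℕ × ℕ × ℝ) :=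
  if i = Q.owner k then [(r, k, Q.entry i r k)] else [(r, 0, 1)]

/-- The Kronecker factor for table `i`, row `r` and column `k`. The product of the factors of a
choice of rows is the matrix with the entry of column `k` in the position given by these rows. -/
noncomputable def factor (k : Fin d) (i : Fin m) (r : ℕ) :
    Matrix (Q.Dom i) (Fin (Q.colCount k i)) ℝ :=
  Q.bufferMatrix i (Q.colCount k i) (Q.factorBuffer k i r)

open Classical in
theorem factor_apply (k : Fin d) (i : Fin m) (r : Fin (Q.size i)) (y : Q.Dom i)
    (l : Fin (Q.colCount k i)) :
    Q.factor k i r y l =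
      if Q.domOf i r = y ∧ (i = Q.owner k → (k : ℕ) = l) then
        if i = Q.owner k then Q.entry i r k else 1
      else 0 := by
  unfold factor factorBuffer
  by_cases hi : i = Q.owner k
  · have hk : (k : ℕ) < Q.colCount k i := by rw [hi, colCount_owner]; exact k.2
    rw [if_pos hi, if_pos hi, Q.bufferMatrix_singleton_apply i _ _ r.2 hk]
    simp only [hi, forall_const]
  · have hl : 0 = (l : ℕ) := by have := Q.colCount_of_ne hi; omega
    rw [if_neg hi, if_neg hi, Q.bufferMatrix_singleton_apply i _ _ r.2 (Q.colCount_pos k i)]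
    simp only [hi, ← hl, and_true, false_imp_iff]

open Classical in
theorem kroneckerProduct_factor_apply (k : Fin d) (σ : (Πₗ i, Fin (Q.colCount k i)) ≃o Fin d)
    (hσ : ∀ l, ((ofLex (σ.symm l) (Q.owner k) : Fin _) : ℕ) = l) (f : ∀ i, Fin (Q.size i))
    (y : ∀ i, Q.Dom i) (l : Fin d) :
    kroneckerProduct σ (fun i => Q.factor k i (f i)) y l =
      if (∀ i, Q.domOf i (f i) = y i) ∧ k = l then
        Q.entry (Q.owner k) (f (Q.owner k)) k else 0 := by
  simp only [kroneckerProduct, Matrix.of_apply, factor_apply, Finset.prod_ite_zero,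
    Finset.prod_ite_eq', Finset.mem_univ, if_true, true_imp_iff, forall_and, forall_eq, hσ,
    Fin.val_inj]

theorem entry_eq_table (i : Fin m) (r : Fin (Q.size i)) (c : {c // c ∈ Q.cols i}) :
    Q.entry i r c.1 = Q.table i r c :=
  dif_pos ⟨i.2, c.1.2, r.2, c.2⟩

/-- Rows `f i` of the tables `i ∈ s` are consistent if they agree on common columns. -/
def Consistent (s : Finset (Fin m)) (f : Fin m → ℕ) : Prop :=
  ∀ a ∈ s, ∀ b ∈ s, ∀ c, c ∈ Q.cols a → c ∈ Q.cols b → Q.entry a (f a) c = Q.entry b (f b) c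

theorem entry_owner_eq_glue {y : ∀ i, Q.Dom i} {f : ∀ i, Fin (Q.size i)}
    (hfy : ∀ i, Q.domOf i (f i) = y i) (c : Fin d) :
    Q.entry (Q.owner c) (f (Q.owner c)) c = Q.glue y c := by
  rw [Q.entry_eq_table _ _ ⟨c, Q.owner_mem c⟩, glue, ← hfy]
  rfl

theorem Consistent.table_eq_glue {Q : JoinQuery m d} {y : ∀ i, Q.Dom i} {f : ∀ i, Fin (Q.size i)}
    (hf : Q.Consistent Finset.univ fun i => f i) (hfy : ∀ i, Q.domOf i (f i) = y i) (i : Fin m)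
    (c : {c // c ∈ Q.cols i}) : Q.table i (f i) c = Q.glue y c := by
  rw [← Q.entry_owner_eq_glue hfy, ← Q.entry_eq_table]
  exact hf _ (Finset.mem_univ _) _ (Finset.mem_univ _) _ c.2 (Q.owner_mem _)

theorem consistent_of_table_eq {x : Fin d → ℝ} {f : ∀ i, Fin (Q.size i)}
    (hf : ∀ i, ∀ c : {c // c ∈ Q.cols i}, x c = Q.table i (f i) c) (s : Finset (Fin m)) :
    Q.Consistent s fun i => f i := fun a _ b _ c hca hcb => by
  rw [Q.entry_eq_table a (f a) ⟨c, hca⟩, Q.entry_eq_table b (f b) ⟨c, hcb⟩, ← hf, ← hf]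

theorem domOf_eq_of_table_eq {y : ∀ i, Q.Dom i} {f : ∀ i, Fin (Q.size i)}
    (hf : ∀ i, ∀ c : {c // c ∈ Q.cols i}, Q.glue y c = Q.table i (f i) c) (i : Fin m) :
    Q.domOf i (f i) = y i := by
  apply Subtype.ext
  funext ⟨c, hc⟩
  subst hc
  exact (hf _ ⟨c, Q.owner_mem c⟩).symm

open Classical in
theorem sum_consistent (y : ∀ i, Q.Dom i) (l : Fin d) :
    (∑ f : ∀ i, Fin (Q.size i) with Q.Consistent Finset.univ fun i => f i,
      if ∀ i, Q.domOf i (f i) = y i then Q.entry (Q.owner l) (f (Q.owner l)) l else 0) =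
      Q.joinMatrix y l := by
  rw [joinMatrix, Matrix.of_apply]
  split_ifs with h
  · choose f hf using h
    have unique : ∀ f' : ∀ i, Fin (Q.size i), (Q.Consistent Finset.univ fun i => f' i) →
        (∀ i, Q.domOf i (f' i) = y i) → f' = f := fun f' hc hy => funext fun i =>
      Q.distinct i (funext fun c => (hc.table_eq_glue hy i c).trans (hf i c))
    rw [Finset.sum_eq_single f]
    · have hfy := Q.domOf_eq_of_table_eq hf
      rw [if_pos hfy, Q.entry_owner_eq_glue hfy]
    · exact fun f' hf' hne => if_neg fun hy => hne (unique f' (Finset.mem_filter.1 hf').2 hy)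
    · exact fun hnot => absurd (Finset.mem_filter.2
        ⟨Finset.mem_univ f, Q.consistent_of_table_eq hf _⟩) hnot
  · refine Finset.sum_eq_zero fun f hf => if_neg fun hy => h fun i => ⟨f i, fun c => ?_⟩
    exact ((Finset.mem_filter.1 hf).2.table_eq_glue hy i c).symm

theorem kroneckerProduct_eq_zero (k : Fin d) (σ : (Πₗ i, Fin (Q.colCount k i)) ≃o Fin d)
    (A : ∀ i, Matrix (Q.Dom i) (Fin (Q.colCount k i)) ℝ) {i : Fin m} (hi : A i = 0) :
    kroneckerProduct σ A = 0 := by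
  ext x y
  exact Finset.prod_eq_zero (Finset.mem_univ i) (by rw [hi]; rfl)

open Classical in
/-- Only row choices `f` with row `y` and the column `l = k` contribute to entry `(y, l)`. -/
theorem sum_kroneckerProduct_factor
    (σ : ∀ k, (Πₗ i, Fin (Q.colCount k i)) ≃o Fin d)
    (hσ : ∀ k l, ((ofLex ((σ k).symm l) (Q.owner k) : Fin _) : ℕ) = l) :
    ∑ k, ∑ f : ∀ i, Fin (Q.size i) with Q.Consistent Finset.univ fun i => f i,
      kroneckerProduct (σ k) (fun i => Q.factor k i (f i)) = Q.joinMatrix := by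
  ext y l
  simp only [Matrix.sum_apply, Q.kroneckerProduct_factor_apply _ _ (hσ _)]
  rw [Finset.sum_eq_single l, ← Q.sum_consistent]
  · simp only [and_true]
  · exact fun k _ hk => Finset.sum_eq_zero fun f _ => if_neg fun h => hk h.2
  · exact fun h => absurd (Finset.mem_univ l) h

end JoinQuery

namespace DBSketch

variable {m d : ℕ} {Q : JoinQuery m d} {ρ : MulTree m} {R : Type*} (S : DBSketch Q ρ R)

theorem eval_part_eq_F_zero {k : Fin d} {A : ∀ i, Matrix (Q.Dom i) (Fin (Q.colCount k i)) ℝ}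
    {i : Fin m} (hi : A i = 0) :
    ρ.eval S.mul (fun i => S.part i (Q.colCount k i) (A i)) = S.F 0 := by
  obtain ⟨σ, -⟩ := Q.exists_colIso k
  rw [← S.map_kronecker _ σ, Q.kroneckerProduct_eq_zero k σ A hi]

/-- The sketch of the Kronecker factor for table `i`, row `r` and column `k`. -/
noncomputable def factorVal (k : Fin d) (i : Fin m) (r : ℕ) : S.Val :=
  S.val (S.part i (Q.colCount k i) (Q.factor k i r))

open Classical in
/-- The part of the sketch of the join matrix that comes from column `k`. -/
noncomputable def columnSum (k : Fin d) : S.Val :=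
  ∑ f : ∀ i, Fin (Q.size i) with Q.Consistent Finset.univ fun i => f i,
    ρ.eval (· * ·) fun i => S.factorVal k i (f i)

theorem F_joinMatrix_eq_sum :
    S.val (S.F 0) + ∑ k, S.columnSum k = S.val (S.F Q.joinMatrix) := by
  classical
  choose σ hσ using Q.exists_colIso
  simp_rw [columnSum, factorVal, ← val_eval, ← S.map_kronecker _ (σ _)]
  rw [← Q.sum_kroneckerProduct_factor σ hσ, Finset.sum_sigma', S.val_F_add_sum, zero_add,
    Finset.sum_sigma']

end DBSketch

/-! ### Products over consistent choices of rows -/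

namespace MulTree

variable {m : ℕ}

/-- The tables in an expression tree. -/
def leaves : MulTree m → Finset (Fin m)
  | .leaf i => {i}
  | .node l r => l.leaves ∪ r.leaves

/-- The product of two trees, where `b` says whether the first one is the left factor. -/
def join (b : Bool) (σ τ : MulTree m) : MulTree m := if b then .node σ τ else .node τ σ

theorem leaves_join (b : Bool) (σ τ : MulTree m) : (join b σ τ).leaves = σ.leaves ∪ τ.leaves := by
  cases b
  exacts [Finset.union_comm _ _, rfl]

theorem mem_leaves_update_join {tree : Fin m → MulTree m} {i j : Fin m} {b : Bool} {x a : Fin m} :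
    a ∈ (Function.update tree j (join b (tree i) (tree j)) x).leaves ↔
      a ∈ (tree x).leaves ∨ x = j ∧ a ∈ (tree i).leaves := by
  obtain rfl | hx := eq_or_ne x j
  · rw [Function.update_self, leaves_join, Finset.mem_union]
    tauto
  · rw [Function.update_of_ne hx]
    tauto

theorem eval_congr {R : Type*} (mul : R → R → R) {g h : Fin m → R} (τ : MulTree m)
    (hgh : ∀ i ∈ τ.leaves, g i = h i) : τ.eval mul g = τ.eval mul h := by
  induction τ with
  | leaf i => exact hgh i (Finset.mem_singleton_self i)
  | node l r hl hr =>
    rw [eval, eval, hl fun i hi => hgh i (Finset.mem_union_left _ hi),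
      hr fun i hi => hgh i (Finset.mem_union_right _ hi)]

end MulTree

/-- The product of two elements, where `b` says whether the first one is the left factor. -/
def mulDir {A : Type*} [Mul A] (b : Bool) (x y : A) : A := if b then x * y else y * x

theorem mulDir_sum_sum {A ι κ : Type*} [NonUnitalNonAssocSemiring A] (b : Bool) (s : Finset ι)
    (t : Finset κ) (f : ι → A) (g : κ → A) :
    mulDir b (∑ i ∈ s, f i) (∑ j ∈ t, g j) = ∑ p ∈ s ×ˢ t, mulDir b (f p.1) (g p.2) := by
  cases b <;> simp only [mulDir, Bool.false_eq_true, if_true, if_false, Finset.sum_mul_sum]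
  · rw [Finset.sum_product_right]
  · rw [Finset.sum_product]

theorem mulDir_add {A : Type*} [NonUnitalNonAssocSemiring A] (b : Bool) (x y z : A) :
    mulDir b x (y + z) = mulDir b x y + mulDir b x z := by
  cases b
  exacts [add_mul y z x, mul_add x y z]

theorem add_mulDir {A : Type*} [NonUnitalNonAssocSemiring A] (b : Bool) (x y z : A) :
    mulDir b (x + y) z = mulDir b x z + mulDir b y z := by
  cases b
  exacts [mul_add z x y, add_mul x y z]

theorem MulTree.eval_join {m : ℕ} {A : Type*} [Mul A] (b : Bool) (σ τ : MulTree m)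
    (g h : Fin m → A) (hστ : Disjoint σ.leaves τ.leaves) :
    (MulTree.join b σ τ).eval (· * ·) (σ.leaves.piecewise g h) =
      mulDir b (σ.eval (· * ·) g) (τ.eval (· * ·) h) := by
  rw [σ.eval_congr _ (h := σ.leaves.piecewise g h) fun i hi => by simp [hi],
    τ.eval_congr _ (h := σ.leaves.piecewise g h) fun i hi => by
      simp [Finset.disjoint_right.1 hστ hi]]
  cases b <;> rfl

namespace JoinQuery

variable {m d : ℕ} (Q : JoinQuery m d)

/-- Row `r` of table `a` and row `r'` of table `b` agree on the common columns of the tables. -/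
def Agree (a b : Fin m) (r r' : ℕ) : Prop :=
  ∀ c, c ∈ Q.cols a → c ∈ Q.cols b → Q.entry a r c = Q.entry b r' c

variable {Q} in
theorem Consistent.congr {s : Finset (Fin m)} {f g : Fin m → ℕ} (h : ∀ a ∈ s, f a = g a)
    (hf : Q.Consistent s f) : Q.Consistent s g := fun a ha b hb => by
  rw [← h a ha, ← h b hb]
  exact hf a ha b hb

variable {Q} in
theorem Consistent.mono {s t : Finset (Fin m)} {f : Fin m → ℕ} (hst : s ⊆ t)
    (hf : Q.Consistent t f) : Q.Consistent s f :=
  fun a ha b hb => hf a (hst ha) b (hst hb)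

open Classical in
/-- The consistent choices of one row of every table in `s`, with the value `0` outside of `s`. -/
noncomputable def tuples (s : Finset (Fin m)) : Finset (Fin m → ℕ) :=
  {f ∈ Fintype.piFinset fun i => if i ∈ s then Finset.range (Q.size i) else {0} | Q.Consistent s f}

variable {Q} in
theorem mem_tuples {s : Finset (Fin m)} {f : Fin m → ℕ} :
    f ∈ Q.tuples s ↔ (∀ i ∈ s, f i < Q.size i) ∧ (∀ i ∉ s, f i = 0) ∧ Q.Consistent s f := by
  classical
  rw [tuples, Finset.mem_filter, Fintype.mem_piFinset, ← and_assoc, ← forall_and]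
  refine and_congr_left fun _ => forall_congr' fun i => ?_
  by_cases hi : i ∈ s <;> simp [hi]

variable {Q} in
theorem piecewise_zero_mem_tuples {s t : Finset (Fin m)} {f : Fin m → ℕ} (hst : s ⊆ t)
    (hf : f ∈ Q.tuples t) : s.piecewise f 0 ∈ Q.tuples s := by
  obtain ⟨hlt, -, hcons⟩ := mem_tuples.1 hf
  refine mem_tuples.2 ⟨fun i hi => ?_, fun i hi => ?_, (hcons.mono hst).congr fun i hi => ?_⟩
  · rw [s.piecewise_eq_of_mem _ _ hi]
    exact hlt i (hst hi)
  · rw [s.piecewise_eq_of_notMem _ _ hi, Pi.zero_apply]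
  · rw [s.piecewise_eq_of_mem _ _ hi]

variable {A : Type*} [NonUnitalNonAssocSemiring A] (g : Fin m → ℕ → A)

/-- The sum over the consistent choices of rows of the tables in `τ`, with row `r` of table `j`, of
the products of the values of the rows in the order of `τ`. -/
noncomputable def tupleSum (τ : MulTree m) (j : Fin m) (r : ℕ) : A :=
  ∑ f ∈ Q.tuples τ.leaves with f j = r, τ.eval (· * ·) fun i => g i (f i)

theorem tupleSum_leaf (j : Fin m) {r : ℕ} (hr : r < Q.size j) :
    Q.tupleSum g (.leaf j) j r = g j r := by
  have only : {f ∈ Q.tuples {j} | f j = r} = {Pi.single j r} := by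
    ext f
    rw [Finset.mem_filter, mem_tuples, Finset.mem_singleton]
    constructor
    · rintro ⟨⟨-, hzero, -⟩, rfl⟩
      funext i
      obtain rfl | hi := eq_or_ne i j
      · rw [Pi.single_eq_same]
      · rw [Pi.single_eq_of_ne hi, hzero i (by simpa using hi)]
    · rintro rfl
      simp_all [Consistent]
  rw [tupleSum, MulTree.leaves, only, Finset.sum_singleton, MulTree.eval, Pi.single_eq_same]

theorem sum_tupleSum {τ : MulTree m} {j : Fin m} (hj : j ∈ τ.leaves) (p : ℕ → Prop)
    [DecidablePred p] :
    ∑ r ∈ Finset.range (Q.size j) with p r, Q.tupleSum g τ j r =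
      ∑ f ∈ Q.tuples τ.leaves with p (f j), τ.eval (· * ·) fun i => g i (f i) := by
  rw [← Finset.sum_fiberwise_of_maps_to (g := fun f : Fin m → ℕ => f j)
    (t := {r ∈ Finset.range (Q.size j) | p r})]
  · refine Finset.sum_congr rfl fun r hr => ?_
    rw [Finset.filter_filter, tupleSum]
    refine Finset.sum_congr (Finset.filter_congr fun f _ => ?_) fun _ _ => rfl
    exact ⟨fun h => ⟨h ▸ (Finset.mem_filter.1 hr).2, h⟩, fun h => h.2⟩
  · intro f hf
    rw [Finset.mem_filter] at hf ⊢
    exact ⟨Finset.mem_range.2 ((mem_tuples.1 hf.1).1 j hj), hf.2⟩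

/-- Consistency of a choice of rows for `s ∪ t` splits into consistency on `s`, consistency on `t`
and agreement of the rows of one table `i ∈ s` and one table `j ∈ t`. -/
structure Separates (s t : Finset (Fin m)) (i j : Fin m) : Prop where
  disjoint : Disjoint s t
  mem_left : i ∈ s
  mem_right : j ∈ t
  consistent_union : ∀ f, Q.Consistent s f → Q.Consistent t f → Q.Agree i j (f i) (f j) →
    Q.Consistent (s ∪ t) f

variable {Q} in
theorem Separates.piecewise_mem_tuples {s t : Finset (Fin m)} {i j : Fin m}
    (h : Q.Separates s t i j) {f f' : Fin m → ℕ} (hf : f ∈ Q.tuples s) (hf' : f' ∈ Q.tuples t)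
    (hagree : Q.Agree i j (f i) (f' j)) : s.piecewise f f' ∈ Q.tuples (s ∪ t) := by
  obtain ⟨hlt, -, hcons⟩ := mem_tuples.1 hf
  obtain ⟨hlt', hzero', hcons'⟩ := mem_tuples.1 hf'
  have on_left : ∀ a ∈ s, f a = s.piecewise f f' a := fun a ha => by simp [ha]
  have on_right : ∀ a ∈ t, f' a = s.piecewise f f' a := fun a ha => by
    simp [Finset.disjoint_right.1 h.disjoint ha]
  refine mem_tuples.2 ⟨fun a ha => ?_, fun a ha => ?_,
    h.consistent_union _ (hcons.congr on_left) (hcons'.congr on_right) ?_⟩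
  · obtain ha | ha := Finset.mem_union.1 ha
    · exact on_left a ha ▸ hlt a ha
    · exact on_right a ha ▸ hlt' a ha
  · rw [Finset.mem_union, not_or] at ha
    rw [s.piecewise_eq_of_notMem _ _ ha.1, hzero' a ha.2]
  · rwa [← on_left i h.mem_left, ← on_right j h.mem_right]

/-- Distributivity applies since, given row `r` of table `j`, only the row of table `i` links the
choices of rows for `σ` to those for `τ`. -/
theorem tupleSum_join (b : Bool) {σ τ : MulTree m} {i j : Fin m}
    (h : Q.Separates σ.leaves τ.leaves i j) (r : ℕ) (p : ℕ → Prop) [DecidablePred p]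
    (hp : ∀ r' < Q.size i, p r' ↔ Q.Agree i j r' r) :
    Q.tupleSum g (MulTree.join b σ τ) j r =
      mulDir b (∑ r' ∈ Finset.range (Q.size i) with p r', Q.tupleSum g σ i r')
        (Q.tupleSum g τ j r) := by
  have hdisj : ∀ a ∈ τ.leaves, a ∉ σ.leaves := fun _ ha => Finset.disjoint_right.1 h.disjoint ha
  rw [Q.sum_tupleSum g h.mem_left, tupleSum, tupleSum, mulDir_sum_sum, MulTree.leaves_join]
  refine Finset.sum_nbij' (fun f => (σ.leaves.piecewise f 0, τ.leaves.piecewise f 0))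
    (fun q => σ.leaves.piecewise q.1 q.2) ?_ ?_ ?_ ?_ ?_ <;>
    simp only [Finset.mem_filter, Finset.mem_product, and_imp]
  · intro f hf hfj
    obtain ⟨hlt, -, hcons⟩ := mem_tuples.1 hf
    have hfit : p (f i) := (hp _ (hlt i (Finset.mem_union_left _ h.mem_left))).2 <| hfj ▸
      hcons i (Finset.mem_union_left _ h.mem_left) j (Finset.mem_union_right _ h.mem_right)
    refine ⟨⟨piecewise_zero_mem_tuples Finset.subset_union_left hf, ?_⟩,
      piecewise_zero_mem_tuples Finset.subset_union_right hf, ?_⟩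
    · rwa [Finset.piecewise_eq_of_mem _ _ _ h.mem_left]
    · rwa [Finset.piecewise_eq_of_mem _ _ _ h.mem_right]
  · rintro ⟨f, f'⟩ hf hfi hf' rfl
    refine ⟨h.piecewise_mem_tuples hf hf' ((hp _ ((mem_tuples.1 hf).1 i h.mem_left)).1 hfi), ?_⟩
    exact Finset.piecewise_eq_of_notMem _ _ _ (hdisj j h.mem_right)
  · intro f hf _
    have hzero := (mem_tuples.1 hf).2.1
    funext a
    by_cases ha : a ∈ σ.leaves <;> by_cases ha' : a ∈ τ.leaves <;> simp_all
  · rintro ⟨f, f'⟩ hf _ hf' _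
    have hzero := (mem_tuples.1 hf).2.1
    have hzero' := (mem_tuples.1 hf').2.1
    refine Prod.ext (funext fun a => ?_) (funext fun a => ?_)
    · by_cases ha : a ∈ σ.leaves <;> simp_all
    · by_cases ha : a ∈ τ.leaves <;> simp_all
  · intro f _ _
    rw [← MulTree.eval_join b σ τ _ _ h.disjoint]
    refine MulTree.eval_congr _ _ fun a ha => ?_
    rw [MulTree.leaves_join, Finset.mem_union] at ha
    by_cases ha' : a ∈ σ.leaves <;> simp_all

open Classical in
theorem sum_tuples_univ (F : (Fin m → ℕ) → A) :
    ∑ f ∈ Q.tuples Finset.univ, F f =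
      ∑ f : ∀ i, Fin (Q.size i) with Q.Consistent Finset.univ fun i => f i, F fun i => f i := by
  refine (Finset.sum_bij (fun f _ i => (f i : ℕ)) (fun f hf => ?_) (fun f _ f' _ hff' => ?_)
    (fun f hf => ?_) fun _ _ => rfl).symm
  · exact mem_tuples.2 ⟨fun i _ => (f i).2, fun i hi => absurd (Finset.mem_univ i) hi,
      (Finset.mem_filter.1 hf).2⟩
  · exact funext fun i => Fin.ext (congrFun hff' i)
  · obtain ⟨hlt, -, hcons⟩ := mem_tuples.1 hf
    exact ⟨fun i => ⟨f i, hlt i (Finset.mem_univ i)⟩,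
      Finset.mem_filter.2 ⟨Finset.mem_univ _, hcons⟩, rfl⟩

end JoinQuery

/-! ### The schema during a run of Inside-Out -/

namespace PlanRun

variable {m d : ℕ} {cols : Fin m → Finset (Fin d)} {plan : List (PlanStep m d)}
  {live : Finset (Fin m)} {cols' : Fin m → Finset (Fin d)} {tree : Fin m → MulTree m}

theorem cols_subset (h : PlanRun cols plan live cols' tree) (i : Fin m) : cols' i ⊆ cols i := by
  induction h with
  | start => rfl
  | sumOut _ j c _ _ _ ih =>
    obtain rfl | hi := eq_or_ne i j
    · rw [Function.update_self]
      exact (Finset.erase_subset _ _).trans ih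
    · rwa [Function.update_of_ne hi]
  | absorb _ _ _ _ _ _ _ _ ih => exact ih

theorem mem_leaves_self (h : PlanRun cols plan live cols' tree) (i : Fin m) :
    i ∈ (tree i).leaves := by
  induction h with
  | start => exact Finset.mem_singleton_self i
  | sumOut _ _ _ _ _ _ ih => exact ih
  | absorb _ _ _ _ _ _ _ _ ih => exact MulTree.mem_leaves_update_join.2 (Or.inl ih)

theorem disjoint_leaves (h : PlanRun cols plan live cols' tree) :
    ∀ x ∈ live, ∀ y ∈ live, x ≠ y → Disjoint (tree x).leaves (tree y).leaves := by
  induction h with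
  | start => exact fun x _ y _ hxy => Finset.disjoint_singleton.2 hxy
  | sumOut _ _ _ _ _ _ ih => exact ih
  | @absorb _ live _ tree _ i j b hi hj hij _ ih =>
    intro x hx y hy hxy
    simp only [Finset.disjoint_left, Finset.mem_erase] at ih hx hy ⊢
    intro a hax hay
    replace hax := MulTree.mem_leaves_update_join.1 hax
    replace hay := MulTree.mem_leaves_update_join.1 hay
    obtain hax | ⟨rfl, hai⟩ := hax <;> obtain hay | ⟨rfl, hai'⟩ := hay
    · exact ih x hx.2 y hy.2 hxy hax hay
    · exact ih x hx.2 i hi hx.1 hax hai'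
    · exact ih i hi y hy.2 hy.1.symm hai hay
    · exact hxy rfl

theorem exists_mem_leaves (h : PlanRun cols plan live cols' tree) (a : Fin m) :
    ∃ x ∈ live, a ∈ (tree x).leaves := by
  induction h with
  | start => exact ⟨a, Finset.mem_univ a, Finset.mem_singleton_self a⟩
  | sumOut _ _ _ _ _ _ ih => exact ih
  | absorb _ i j b _ hj hij _ ih =>
    obtain ⟨x, hx, hax⟩ := ih
    obtain rfl | hxi := eq_or_ne x i
    · exact ⟨j, Finset.mem_erase.2 ⟨hij.symm, hj⟩,
        MulTree.mem_leaves_update_join.2 (Or.inr ⟨rfl, hax⟩)⟩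
    · exact ⟨x, Finset.mem_erase.2 ⟨hxi, hx⟩, MulTree.mem_leaves_update_join.2 (Or.inl hax)⟩

/-- A column is summed out only when no other factor contains it. -/
theorem mem_cols_of_shared (h : PlanRun cols plan live cols' tree) :
    ∀ x ∈ live, ∀ y ∈ live, x ≠ y → ∀ a ∈ (tree x).leaves, ∀ b ∈ (tree y).leaves, ∀ c ∈ cols a,
      c ∈ cols b → c ∈ cols' x := by
  induction h with
  | start =>
    intro x _ y _ _ a ha b _ c hca _
    exact Finset.mem_singleton.1 ha ▸ hca
  | @sumOut _ live cols' tree _ i c₀ _ _ honly ih =>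
    intro x hx y hy hxy a ha b hb c hca hcb
    have hcx := ih x hx y hy hxy a ha b hb c hca hcb
    have hcy := ih y hy x hx hxy.symm b hb a ha c hcb hca
    obtain rfl | hxi := eq_or_ne x i
    · rw [Function.update_self]
      refine Finset.mem_erase.2 ⟨?_, hcx⟩
      rintro rfl
      exact hxy (honly y hy hcy).symm
    · rwa [Function.update_of_ne hxi]
  | @absorb _ live cols' tree _ i j _ hi hj _ hsub ih =>
    intro x hx y hy hxy a hax b hby c hca hcb
    rw [Finset.mem_erase] at hx hy
    replace hax := MulTree.mem_leaves_update_join.1 hax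
    replace hby := MulTree.mem_leaves_update_join.1 hby
    obtain hax | ⟨rfl, hai⟩ := hax <;> obtain hby | ⟨rfl, hbi⟩ := hby
    · exact ih x hx.2 y hy.2 hxy a hax b hby c hca hcb
    · exact ih x hx.2 i hi hx.1 a hax b hbi c hca hcb
    · exact hsub (ih i hi y hy.2 hy.1.symm a hai b hby c hca hcb)
    · exact absurd rfl hxy

theorem separates {Q : JoinQuery m d} (h : PlanRun Q.cols plan live cols' tree) {i j : Fin m}
    (hi : i ∈ live) (hj : j ∈ live) (hij : i ≠ j) (hsub : cols' i ⊆ cols' j) :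
    Q.Separates (tree i).leaves (tree j).leaves i j where
  disjoint := h.disjoint_leaves i hi j hj hij
  mem_left := h.mem_leaves_self i
  mem_right := h.mem_leaves_self j
  consistent_union f hfi hfj hagree := by
    have cross : ∀ a ∈ (tree i).leaves, ∀ b ∈ (tree j).leaves, ∀ c ∈ Q.cols a, c ∈ Q.cols b →
        Q.entry a (f a) c = Q.entry b (f b) c := by
      intro a ha b hb c hca hcb
      have hc := h.mem_cols_of_shared i hi j hj hij a ha b hb c hca hcb
      have hci := h.cols_subset i hc
      have hcj := h.cols_subset j (hsub hc)
      rw [hfi a ha i (h.mem_leaves_self i) c hca hci, hagree c hci hcj,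
        hfj j (h.mem_leaves_self j) b hb c hcj hcb]
    intro a ha b hb c hca hcb
    obtain ha | ha := Finset.mem_union.1 ha <;> obtain hb | hb := Finset.mem_union.1 hb
    · exact hfi a ha b hb c hca hcb
    · exact cross a ha b hb c hca hcb
    · exact (cross b hb a ha c hcb hca).symm
    · exact hfj a ha b hb c hca hcb

end PlanRun

/-- Whether an elimination step multiplies factors. -/
def PlanStep.isAbsorb {m d : ℕ} : PlanStep m d → Bool
  | .sumOut _ _ => false
  | .absorb _ _ _ => true

namespace PlanRun

variable {m d : ℕ} {cols : Fin m → Finset (Fin d)} {plan : List (PlanStep m d)}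
  {live : Finset (Fin m)} {cols' : Fin m → Finset (Fin d)} {tree : Fin m → MulTree m}

theorem countP_isAbsorb_add_card_live (h : PlanRun cols plan live cols' tree) :
    plan.countP PlanStep.isAbsorb + live.card = m := by
  induction h with
  | start => simp
  | sumOut _ _ _ _ _ _ ih => simpa [PlanStep.isAbsorb] using ih
  | absorb _ i _ _ hi _ _ _ ih =>
    have := Finset.card_erase_add_one hi
    simp only [List.countP_append, List.countP_singleton, PlanStep.isAbsorb, if_true]
    omega

theorem length_add_sum_card_le (h : PlanRun cols plan live cols' tree) :
    plan.length + ∑ i, (cols' i).card ≤ plan.countP PlanStep.isAbsorb + m * d := by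
  induction h with
  | start =>
    have hcols := Finset.sum_le_card_nsmul Finset.univ (fun i => (cols i).card) d fun i _ =>
      card_finset_fin_le (cols i)
    simpa using hcols
  | @sumOut plan _ cols' _ _ i c _ hc _ ih =>
    have hcard := Finset.card_erase_add_one hc
    have hsum : ∑ x, (Function.update cols' i ((cols' i).erase c) x).card + 1 =
        ∑ x, (cols' x).card := by
      rw [← Finset.add_sum_erase _ (fun x => (cols' x).card) (Finset.mem_univ i), ← hcard,
        ← Finset.add_sum_erase _ _ (Finset.mem_univ i), Function.update_self, add_right_comm]
      congr 1
      refine Finset.sum_congr rfl fun x hx => ?_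
      rw [Function.update_of_ne (Finset.ne_of_mem_erase hx)]
    simp only [List.countP_append, List.countP_singleton, PlanStep.isAbsorb, List.length_append,
      List.length_singleton]
    omega
  | absorb _ _ _ _ _ _ _ _ ih =>
    simp only [List.countP_append, List.countP_singleton, PlanStep.isAbsorb, if_true,
      List.length_append, List.length_singleton]
    omega

end PlanRun

/-! ### Sketches up to sketches of zero matrices -/

namespace DBSketch

variable {m d : ℕ} {Q : JoinQuery m d} {ρ : MulTree m} {R : Type*} (S : DBSketch Q ρ R)
  {c : Fin m → ℕ}

/-- The sums of products, in the order of `τ`, of sketches of matrices from a family in `𝒜`. -/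
def productSpan (τ : MulTree m) (𝒜 : Set (∀ i, Matrix (Q.Dom i) (Fin (c i)) ℝ)) :
    AddSubmonoid S.Val :=
  AddSubmonoid.closure ((fun A => τ.eval (· * ·) fun i => S.val (S.part i (c i) (A i))) '' 𝒜)

variable (Q c) in
/-- The families of matrices with a zero matrix at some leaf of `τ`. -/
def zeroFamilies (τ : MulTree m) : Set (∀ i, Matrix (Q.Dom i) (Fin (c i)) ℝ) :=
  {A | ∃ i ∈ τ.leaves, A i = 0}

variable {S}

theorem mulDir_mem_productSpan {b : Bool} {σ τ : MulTree m} (hστ : Disjoint σ.leaves τ.leaves)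
    {𝒜 ℬ 𝒞 : Set (∀ i, Matrix (Q.Dom i) (Fin (c i)) ℝ)}
    (h𝒞 : ∀ A ∈ 𝒜, ∀ B ∈ ℬ, σ.leaves.piecewise A B ∈ 𝒞) {x y : S.Val}
    (hx : x ∈ S.productSpan σ 𝒜) (hy : y ∈ S.productSpan τ ℬ) :
    mulDir b x y ∈ S.productSpan (.join b σ τ) 𝒞 := by
  have generators : ∀ A ∈ 𝒜, ∀ B ∈ ℬ,
      mulDir b (σ.eval (· * ·) fun i => S.val (S.part i (c i) (A i)))
        (τ.eval (· * ·) fun i => S.val (S.part i (c i) (B i))) ∈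
      S.productSpan (.join b σ τ) 𝒞 := fun A hA B hB => by
    rw [← MulTree.eval_join b σ τ _ _ hστ]
    refine AddSubmonoid.subset_closure ⟨_, h𝒞 A hA B hB, MulTree.eval_congr _ _ fun i _ => ?_⟩
    by_cases hi : i ∈ σ.leaves <;> simp [hi]
  cases b
  · have hmul := AddSubmonoid.mul_mem_mul hy hx
    rw [productSpan, productSpan, AddSubmonoid.closure_mul_closure] at hmul
    refine AddSubmonoid.closure_le.2 ?_ hmul
    rintro _ ⟨_, ⟨B, hB, rfl⟩, _, ⟨A, hA, rfl⟩, rfl⟩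
    exact generators A hA B hB
  · have hmul := AddSubmonoid.mul_mem_mul hx hy
    rw [productSpan, productSpan, AddSubmonoid.closure_mul_closure] at hmul
    refine AddSubmonoid.closure_le.2 ?_ hmul
    rintro _ ⟨_, ⟨A, hA, rfl⟩, _, ⟨B, hB, rfl⟩, rfl⟩
    exact generators A hA B hB

variable (S c) in
/-- The content `v` of a cell stands for the sum of products `x`: it is a sketch that differs from
`x` by sketches of zero matrices only. The sketch of a zero matrix need not be neutral for `⊕`, so
the algorithm cannot evaluate empty sums exactly. -/
def Represents (τ : MulTree m) (v : Option R) (x : S.Val) : Prop :=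
  ∃ a, v = some a ∧ x ∈ S.productSpan (c := c) τ Set.univ ∧
    ∃ z ∈ S.productSpan τ (zeroFamilies Q c τ), S.val a = x + z

theorem represents_part (i : Fin m) (A : Matrix (Q.Dom i) (Fin (c i)) ℝ) :
    S.Represents c (.leaf i) (some (S.part i (c i) A)) (S.val (S.part i (c i) A)) := by
  refine ⟨_, rfl, AddSubmonoid.subset_closure ⟨Function.update 0 i A, trivial, ?_⟩, 0, zero_mem _,
    (add_zero _).symm⟩
  simp only [MulTree.eval, Function.update_self]

theorem represents_part_zero (i : Fin m) :
    S.Represents c (.leaf i) (some (S.part i (c i) 0)) 0 :=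
  ⟨_, rfl, zero_mem _, S.val (S.part i (c i) 0),
    AddSubmonoid.subset_closure ⟨0, ⟨i, Finset.mem_singleton_self i, rfl⟩, rfl⟩, (zero_add _).symm⟩

theorem Represents.add {τ : MulTree m} {v w : Option R} {x y : S.Val}
    (hv : S.Represents c τ v x) (hw : S.Represents c τ w y) :
    S.Represents c τ (Option.map₂ S.add v w) (x + y) := by
  obtain ⟨a, rfl, hx, z, hz, ha⟩ := hv
  obtain ⟨b, rfl, hy, z', hz', hb⟩ := hw
  exact ⟨S.add a b, rfl, add_mem hx hy, z + z', add_mem hz hz', by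
    rw [val_add, ha, hb, add_add_add_comm]⟩

theorem Represents.join {σ τ : MulTree m} (hστ : Disjoint σ.leaves τ.leaves) (b : Bool)
    {v w : Option R} {x y : S.Val} (hv : S.Represents c σ v x) (hw : S.Represents c τ w y) :
    S.Represents c (.join b σ τ) (if b then Option.map₂ S.mul v w else Option.map₂ S.mul w v)
      (mulDir b x y) := by
  obtain ⟨a, rfl, hx, z, hz, ha⟩ := hv
  obtain ⟨a', rfl, hy, z', hz', ha'⟩ := hw
  have hyz' : S.val a' ∈ S.productSpan (c := c) τ Set.univ :=
    ha' ▸ add_mem hy (AddSubmonoid.closure_mono (Set.image_mono (Set.subset_univ _)) hz')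
  have left_zero : mulDir b z (S.val a') ∈
      S.productSpan (.join b σ τ) (zeroFamilies Q c (.join b σ τ)) := by
    refine mulDir_mem_productSpan hστ ?_ hz hyz'
    rintro A ⟨i, hi, hA⟩ B -
    exact ⟨i, by simp [MulTree.leaves_join, hi], by simp [hi, hA]⟩
  have right_zero : mulDir b x z' ∈
      S.productSpan (.join b σ τ) (zeroFamilies Q c (.join b σ τ)) := by
    refine mulDir_mem_productSpan hστ ?_ hx hz'
    rintro A - B ⟨i, hi, hB⟩
    exact ⟨i, by simp [MulTree.leaves_join, hi], by simp [Finset.disjoint_right.1 hστ hi, hB]⟩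
  have expand : mulDir b (S.val a) (S.val a') =
      mulDir b x y + (mulDir b x z' + mulDir b z (S.val a')) := by
    rw [ha, add_mulDir, ← _root_.add_assoc, ← mulDir_add, ← ha']
  refine ⟨if b then S.mul a a' else S.mul a' a, by cases b <;> rfl,
    mulDir_mem_productSpan hστ (fun _ _ _ _ => Set.mem_univ _) hx hy, _,
    add_mem right_zero left_zero, ?_⟩
  rw [← expand]
  cases b <;> rfl

theorem eq_zero_or_eq_F_zero {k : Fin d} {z : S.Val}
    (hz : z ∈ S.productSpan ρ (zeroFamilies Q (Q.colCount k) ρ)) : z = 0 ∨ z = S.val (S.F 0) := by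
  have idempotent : S.val (S.F 0) + S.val (S.F 0) = S.val (S.F 0) := by
    rw [← val_add, ← S.map_add, add_zero]
  induction hz using AddSubmonoid.closure_induction with
  | mem z hz =>
    obtain ⟨A, ⟨i, -, hi⟩, rfl⟩ := hz
    exact Or.inr ((S.val_eval ρ _).symm.trans (congrArg S.val (S.eval_part_eq_F_zero hi)))
  | zero => exact Or.inl rfl
  | add z z' _ _ hz hz' =>
    obtain rfl | rfl := hz <;> obtain rfl | rfl := hz' <;> simp [idempotent]

theorem Represents.eq_F_zero {k : Fin d} {v : Option R}
    (hv : S.Represents (Q.colCount k) ρ v 0) : v = some (S.F 0) := by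
  obtain ⟨a, rfl, -, z, hz, ha⟩ := hv
  rw [zero_add] at ha
  obtain rfl | rfl := eq_zero_or_eq_F_zero hz
  · cases ha
  · exact ha

theorem Represents.F_zero_add {k : Fin d} {v : Option R} {x : S.Val}
    (hv : S.Represents (Q.colCount k) ρ v x) : ∃ a, v = some a ∧
      S.val (S.F 0) + S.val a = S.val (S.F 0) + x := by
  obtain ⟨a, rfl, -, z, hz, ha⟩ := hv
  refine ⟨a, rfl, ?_⟩
  obtain rfl | rfl := eq_zero_or_eq_F_zero hz
  · rw [ha, add_zero]
  · rw [ha, add_left_comm, ← val_add, ← S.map_add, add_zero, _root_.add_comm]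

end DBSketch

/-! ### Program logic -/

namespace MachineState

variable {R : Type*} (s : MachineState R)

@[simp] theorem var_setVar (x v y : ℕ) : (s.setVar x v).var y = if y = x then v else s.var y :=
  Function.update_apply ..

@[simp] theorem arr_setVar (x v : ℕ) : (s.setVar x v).arr = s.arr := rfl

@[simp] theorem real_setVar (x v : ℕ) : (s.setVar x v).real = s.real := rfl

@[simp] theorem var_setArr (a i j v : ℕ) : (s.setArr a i j v).var = s.var := rfl

@[simp] theorem arr_setArr (a i j v a' i' j' : ℕ) : (s.setArr a i j v).arr a' i' j' =
    if a' = a ∧ i' = i ∧ j' = j then v else s.arr a' i' j' := rfl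

@[simp] theorem var_setReal (x : ℕ) (v : ℝ) : (s.setReal x v).var = s.var := rfl

@[simp] theorem arr_setReal (x : ℕ) (v : ℝ) : (s.setReal x v).arr = s.arr := rfl

@[simp] theorem real_setReal (x y : ℕ) (v : ℝ) :
    (s.setReal x v).real y = if y = x then v else s.real y :=
  Function.update_apply ..

@[simp] theorem buf_setReal (x : ℕ) (v : ℝ) : (s.setReal x v).buf = s.buf := rfl

@[simp] theorem sk_setReal (x : ℕ) (v : ℝ) : (s.setReal x v).sk = s.sk := rfl

@[simp] theorem sk_setCell (u : SketchCell) (v : Option R) (a i j : ℕ) : (s.setCell u v).sk a i j =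
    if a = u.name ∧ i = u.row.eval s ∧ j = u.col.eval s then v else s.sk a i j := rfl

end MachineState

namespace Prog

variable {m d : ℕ} {Q : JoinQuery m d} {ρ : MulTree m} {R : Type*} (S : DBSketch Q ρ R)
  (K : SketchCosts)

/-- Sequential composition. -/
def block : List Prog → Prog
  | [] => skip
  | p :: ps => seq p (block ps)

/-- The final state of a program. -/
noncomputable def exec (p : Prog) (s : MachineState R) : MachineState R := (p.run S K s).1

/-- The running time of a program. -/
noncomputable def time (p : Prog) (s : MachineState R) : ℕ := (p.run S K s).2

@[simp] theorem exec_skip (s : MachineState R) : skip.exec S K s = s := rfl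

@[simp] theorem exec_assign (x : ℕ) (e : NatExp) (s : MachineState R) :
    (assign x e).exec S K s = s.setVar x (e.eval s) := rfl

@[simp] theorem exec_store (a : ℕ) (i j e : NatExp) (s : MachineState R) :
    (store a i j e).exec S K s = s.setArr a (i.eval s) (j.eval s) (e.eval s) := rfl

@[simp] theorem exec_read (x : ℕ) (i r c : NatExp) (s : MachineState R) :
    (read x i r c).exec S K s = s.setReal x (Q.entry (i.eval s) (r.eval s) (c.eval s)) := rfl

@[simp] theorem exec_one (x : ℕ) (s : MachineState R) : (one x).exec S K s = s.setReal x 1 := rfl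

open Classical in
@[simp] theorem exec_compare (z x y : ℕ) (s : MachineState R) :
    (compare z x y).exec S K s = s.setVar z (if s.real x ≤ s.real y then 1 else 0) := rfl

@[simp] theorem exec_push (r c : NatExp) (x : ℕ) (s : MachineState R) :
    (push r c x).exec S K s = { s with buf := s.buf ++ [(r.eval s, c.eval s, s.real x)] } := rfl

theorem exec_sketch (u : SketchCell) (i c : NatExp) (s : MachineState R) {a : Fin m} {n : ℕ}
    (hi : i.eval s = a) (hc : c.eval s = n) : (sketch u i c).exec S K s =
      s.setCell u (some (S.part a n (Q.bufferMatrix a n s.buf))) := by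
  obtain ⟨a, ha⟩ := a
  subst hi hc
  simp only [exec, run, dif_pos ha]

@[simp] theorem exec_copy (u v : SketchCell) (s : MachineState R) :
    (copy u v).exec S K s = s.setCell u (v.value s) := rfl

@[simp] theorem exec_sketchAdd (u v w : SketchCell) (s : MachineState R) :
    (sketchAdd u v w).exec S K s =
      s.setCell u (Option.map₂ S.add (v.value s) (w.value s)) := rfl

@[simp] theorem exec_sketchMul (u v w : SketchCell) (s : MachineState R) :
    (sketchMul u v w).exec S K s =
      s.setCell u (Option.map₂ S.mul (v.value s) (w.value s)) := rfl

@[simp] theorem exec_block_nil (s : MachineState R) : (block []).exec S K s = s := rfl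

@[simp] theorem exec_block_cons (p : Prog) (ps : List Prog) (s : MachineState R) :
    (block (p :: ps)).exec S K s = (block ps).exec S K (p.exec S K s) := rfl

@[simp] theorem exec_ite (e : NatExp) (p q : Prog) (s : MachineState R) :
    (ite e p q).exec S K s = if e.eval s ≠ 0 then p.exec S K s else q.exec S K s := by
  simp only [exec, run]
  split_ifs <;> rfl

@[simp] theorem time_block_nil (s : MachineState R) : (block []).time S K s = 1 := rfl

@[simp] theorem time_block_cons (p : Prog) (ps : List Prog) (s : MachineState R) :
    (block (p :: ps)).time S K s = p.time S K s + (block ps).time S K (p.exec S K s) := rfl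

theorem time_ite (e : NatExp) (p q : Prog) (s : MachineState R) : (ite e p q).time S K s =
    1 + e.cost + if e.eval s ≠ 0 then p.time S K s else q.time S K s := by
  simp only [time, run]
  split_ifs <;> rfl

theorem time_sketch_le (u : SketchCell) (i c : NatExp) (s : MachineState R) :
    (sketch u i c).time S K s ≤
      1 + u.cost + i.cost + c.cost + s.buf.length * (1 + K.sketch) := by
  simp only [time, run]
  split_ifs with h
  · have := Nat.mul_le_mul_left K.sketch
      (Q.nnz_bufferMatrix_le_length ⟨i.eval s, h⟩ (c.eval s) s.buf)
    linarith
  · exact Nat.le_add_right _ _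

/-- Whether a program can write number register `x`. -/
def writesVar (x : ℕ) : Prog → Bool
  | assign y _ => x == y
  | compare z _ _ => x == z
  | seq p q => p.writesVar x || q.writesVar x
  | ite _ p q => p.writesVar x || q.writesVar x
  | loop y _ p => x == y || p.writesVar x
  | _ => false

/-- Whether a program can write number array `a`. -/
def writesArr (a : ℕ) : Prog → Bool
  | store b _ _ _ => a == b
  | seq p q => p.writesArr a || q.writesArr a
  | ite _ p q => p.writesArr a || q.writesArr a
  | loop _ _ p => p.writesArr a
  | _ => false

/-- Whether a program can write the array `a` of sketches. -/
def writesSketch (a : ℕ) : Prog → Bool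
  | sketch u _ _ => a == u.name
  | copy u _ => a == u.name
  | sketchAdd u _ _ => a == u.name
  | sketchMul u _ _ => a == u.name
  | seq p q => p.writesSketch a || q.writesSketch a
  | ite _ p q => p.writesSketch a || q.writesSketch a
  | loop _ _ p => p.writesSketch a
  | _ => false

/-- The states `s` and `s'` agree on the registers and arrays that the program `p` cannot write,
except for the real registers and the buffer. -/
structure Frame (p : Prog) (s s' : MachineState R) : Prop where
  var : ∀ x, p.writesVar x = false → s'.var x = s.var x
  arr : ∀ a, p.writesArr a = false → s'.arr a = s.arr a
  sk : ∀ a, p.writesSketch a = false → s'.sk a = s.sk a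

theorem Frame.refl (p : Prog) (s : MachineState R) : Frame p s s :=
  ⟨fun _ _ => rfl, fun _ _ => rfl, fun _ _ => rfl⟩

theorem Frame.trans {p : Prog} {s s' s'' : MachineState R} (h : Frame p s s')
    (h' : Frame p s' s'') : Frame p s s'' where
  var x hx := (h'.var x hx).trans (h.var x hx)
  arr a ha := (h'.arr a ha).trans (h.arr a ha)
  sk a ha := (h'.sk a ha).trans (h.sk a ha)

theorem Frame.seq_left {p q : Prog} {s s' : MachineState R} (h : Frame p s s') :
    Frame (seq p q) s s' where
  var x hx := h.var x (Bool.or_eq_false_iff.1 hx).1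
  arr a ha := h.arr a (Bool.or_eq_false_iff.1 ha).1
  sk a ha := h.sk a (Bool.or_eq_false_iff.1 ha).1

theorem Frame.seq_right {p q : Prog} {s s' : MachineState R} (h : Frame q s s') :
    Frame (seq p q) s s' where
  var x hx := h.var x (Bool.or_eq_false_iff.1 hx).2
  arr a ha := h.arr a (Bool.or_eq_false_iff.1 ha).2
  sk a ha := h.sk a (Bool.or_eq_false_iff.1 ha).2

theorem Frame.ite_left {e : NatExp} {p q : Prog} {s s' : MachineState R} (h : Frame p s s') :
    Frame (ite e p q) s s' where
  var x hx := h.var x (Bool.or_eq_false_iff.1 hx).1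
  arr a ha := h.arr a (Bool.or_eq_false_iff.1 ha).1
  sk a ha := h.sk a (Bool.or_eq_false_iff.1 ha).1

theorem Frame.ite_right {e : NatExp} {p q : Prog} {s s' : MachineState R} (h : Frame q s s') :
    Frame (ite e p q) s s' where
  var x hx := h.var x (Bool.or_eq_false_iff.1 hx).2
  arr a ha := h.arr a (Bool.or_eq_false_iff.1 ha).2
  sk a ha := h.sk a (Bool.or_eq_false_iff.1 ha).2

theorem Frame.loop_body {x : ℕ} {e : NatExp} {p : Prog} {s s' : MachineState R}
    (h : Frame p s s') : Frame (loop x e p) s s' where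
  var y hy := h.var y (Bool.or_eq_false_iff.1 hy).2
  arr a ha := h.arr a ha
  sk a ha := h.sk a ha

theorem frame_loop_setVar (x : ℕ) (e : NatExp) (p : Prog) (s : MachineState R) (k : ℕ) :
    Frame (loop x e p) s (s.setVar x k) where
  var y hy := by
    rw [MachineState.var_setVar, if_neg]
    rintro rfl
    simp [writesVar] at hy
  arr _ _ := rfl
  sk _ _ := rfl

theorem run_loop_induction {x : ℕ} {e : NatExp} {p : Prog} {s : MachineState R}
    (motive : ℕ → MachineState R × ℕ → Prop) (zero : motive 0 (s, 1 + e.cost))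
    (succ : ∀ k < e.eval s, ∀ t : MachineState R × ℕ, motive k t →
      motive (k + 1) (p.exec S K (t.1.setVar x k), t.2 + 1 + p.time S K (t.1.setVar x k))) :
    motive (e.eval s) ((loop x e p).run S K s) := by
  have prefixes : ∀ k ≤ e.eval s, motive k (Nat.rec (s, 1 + e.cost) (fun k t =>
      (p.exec S K (t.1.setVar x k), t.2 + 1 + p.time S K (t.1.setVar x k))) k) := by
    intro k hk
    induction k with
    | zero => exact zero
    | succ k ih => exact succ k hk _ (ih (Nat.le_of_succ_le hk))
  exact prefixes _ le_rfl

theorem exec_frame (p : Prog) (s : MachineState R) : Frame p s (p.exec S K s) := by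
  induction p generalizing s with
  | assign x e => exact ⟨fun y hy => by simp_all [writesVar], fun _ _ => rfl, fun _ _ => rfl⟩
  | store a i j e =>
    refine ⟨fun _ _ => rfl, fun b hb => ?_, fun _ _ => rfl⟩
    funext i' j'
    simp_all [writesArr]
  | compare z x y => exact ⟨fun y hy => by simp_all [writesVar], fun _ _ => rfl, fun _ _ => rfl⟩
  | sketch u i c =>
    by_cases h : i.eval s < m
    · rw [exec_sketch S K u i c s (a := ⟨i.eval s, h⟩) rfl rfl]
      refine ⟨fun _ _ => rfl, fun _ _ => rfl, fun b hb => ?_⟩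
      funext i' j'
      simp_all [writesSketch]
    · simp only [exec, run, dif_neg h]
      exact Frame.refl _ _
  | copy u | sketchAdd u | sketchMul u =>
    refine ⟨fun _ _ => rfl, fun _ _ => rfl, fun b hb => ?_⟩
    funext i' j'
    simp_all [writesSketch]
  | seq p q hp hq => exact (hp s).seq_left.trans (hq _).seq_right
  | ite e p q hp hq =>
    rw [exec_ite]
    split_ifs
    exacts [(hp s).ite_left, (hq s).ite_right]
  | loop x e p hp =>
    exact run_loop_induction S K (fun _ t => Frame (loop x e p) s t.1) (Frame.refl _ _)
      fun k _ t ht => (ht.trans (frame_loop_setVar x e p _ k)).trans (hp _).loop_body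
  | _ => exact ⟨fun _ _ => rfl, fun _ _ => rfl, fun _ _ => rfl⟩

variable {S K}

theorem exec_loop_invariant {x : ℕ} {e : NatExp} {p : Prog} {s : MachineState R} {n : ℕ}
    (hn : e.eval s = n) (I : ℕ → MachineState R → Prop) (zero : I 0 s)
    (succ : ∀ k < n, ∀ s', Frame (loop x e p) s s' → I k s' →
      I (k + 1) (p.exec S K (s'.setVar x k))) : I n ((loop x e p).exec S K s) := by
  subst hn
  exact (run_loop_induction S K (fun k t => Frame (loop x e p) s t.1 ∧ I k t.1)
    ⟨Frame.refl _ _, zero⟩ fun k hk _ ht => ⟨(ht.1.trans (frame_loop_setVar x e p _ k)).trans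
      (exec_frame S K p _).loop_body, succ k hk _ ht.1 ht.2⟩).2

theorem time_loop_le {x : ℕ} {e : NatExp} {p : Prog} {s : MachineState R} (T : ℕ → ℕ)
    (hT : ∀ k < e.eval s, ∀ s', Frame (loop x e p) s s' → s'.var x = k → p.time S K s' ≤ T k) :
    (loop x e p).time S K s ≤ 1 + e.cost + ∑ k ∈ Finset.range (e.eval s), (1 + T k) := by
  refine (run_loop_induction S K (fun k t => Frame (loop x e p) s t.1 ∧
    t.2 ≤ 1 + e.cost + ∑ k ∈ Finset.range k, (1 + T k)) ⟨Frame.refl _ _, le_rfl⟩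
    fun k hk t ht => ?_).2
  have frame := ht.1.trans (frame_loop_setVar x e p _ k)
  have htime := hT k hk _ frame (by simp)
  refine ⟨frame.trans (exec_frame S K p _).loop_body, ?_⟩
  rw [Finset.sum_range_succ]
  have := ht.2
  omega

/-- The numbers of iterations of the loops of a program. -/
def loopCounts : Prog → List NatExp
  | seq p q => p.loopCounts ++ q.loopCounts
  | ite _ p q => p.loopCounts ++ q.loopCounts
  | loop _ e p => e :: p.loopCounts
  | _ => []

/-- Whether a program does not evaluate any sketch `F_i`. -/
def sketchFree : Prog → Bool
  | sketch _ _ _ => false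
  | seq p q => p.sketchFree && q.sketchFree
  | ite _ p q => p.sketchFree && q.sketchFree
  | loop _ _ p => p.sketchFree
  | _ => true

/-- The running time of a program that does not evaluate any sketch `F_i` if all branches are as
long as the longer one and if the loops with `e` iterations have `b e` iterations. -/
def timeBound (K : SketchCosts) (b : NatExp → ℕ) : Prog → ℕ
  | assign _ e => 1 + e.cost
  | store _ i j e => 1 + i.cost + j.cost + e.cost
  | read _ i r c => 1 + i.cost + r.cost + c.cost
  | push r c _ => 1 + r.cost + c.cost
  | copy u v => 1 + u.cost + v.cost
  | sketchAdd u v w => 1 + u.cost + v.cost + w.cost + K.add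
  | sketchMul u v w => 1 + u.cost + v.cost + w.cost + K.mul
  | seq p q => p.timeBound K b + q.timeBound K b
  | ite e p q => 1 + e.cost + max (p.timeBound K b) (q.timeBound K b)
  | loop _ e p => 1 + e.cost + b e * (1 + p.timeBound K b)
  | _ => 1

theorem time_le_timeBound (b : NatExp → ℕ) {p : Prog} (hp : p.sketchFree) {s : MachineState R}
    (hb : ∀ e ∈ p.loopCounts, ∀ s', Frame p s s' → e.eval s' ≤ b e) :
    p.time S K s ≤ p.timeBound K b := by
  induction p generalizing s with
  | seq p q ihp ihq =>
    rw [sketchFree, Bool.and_eq_true] at hp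
    exact add_le_add
      (ihp hp.1 fun e he s' hs' => hb e (List.mem_append_left _ he) s' hs'.seq_left)
      (ihq hp.2 fun e he s' hs' => hb e (List.mem_append_right _ he) s'
        ((exec_frame S K p s).seq_left.trans hs'.seq_right))
  | ite e p q ihp ihq =>
    rw [sketchFree, Bool.and_eq_true] at hp
    simp only [time, run, timeBound]
    split_ifs
    · exact Nat.add_le_add_left (le_max_of_le_left (ihp hp.1 fun e he s' hs' =>
        hb e (List.mem_append_left _ he) s' hs'.ite_left)) _
    · exact Nat.add_le_add_left (le_max_of_le_right (ihq hp.2 fun e he s' hs' =>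
        hb e (List.mem_append_right _ he) s' hs'.ite_right)) _
  | loop x e p ihp =>
    have hbody : ∀ k < e.eval s, ∀ s', Frame (loop x e p) s s' → s'.var x = k →
        p.time S K s' ≤ p.timeBound K b := fun k _ s' hs' _ => ihp hp fun e' he' s'' hs'' =>
      hb e' (List.mem_cons_of_mem _ he') _ (hs'.trans hs''.loop_body)
    refine (time_loop_le (fun _ => p.timeBound K b) hbody).trans ?_
    rw [Finset.sum_const, Finset.card_range, smul_eq_mul, timeBound]
    gcongr
    exact hb e (List.mem_cons_self ..) s (Frame.refl _ _)
  | sketch => cases hp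
  | _ => exact le_rfl

/-- Whether a program leaves the value of an expression alone. -/
def keeps (p : Prog) : NatExp → Bool
  | .const _ => true
  | .var x => !p.writesVar x
  | .get a i j => !p.writesArr a && p.keeps i && p.keeps j
  | .add e f => p.keeps e && p.keeps f
  | .sub e f => p.keeps e && p.keeps f
  | .half e => p.keeps e
  | .le e f => p.keeps e && p.keeps f
  | .eq e f => p.keeps e && p.keeps f

theorem Frame.eval {p : Prog} {s s' : MachineState R} (h : Frame p s s') {e : NatExp}
    (he : p.keeps e) : e.eval s' = e.eval s := by
  induction e with
  | const => rfl
  | var x => exact h.var x (by simpa only [keeps, Bool.not_eq_true'] using he)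
  | get a i j hi hj =>
    simp only [keeps, Bool.and_eq_true, Bool.not_eq_true'] at he
    rw [NatExp.eval, NatExp.eval, hi he.1.2, hj he.2, h.arr a he.1.1]
  | half e ih => rw [NatExp.eval, NatExp.eval, ih he]
  | add e f ihe ihf | sub e f ihe ihf | le e f ihe ihf | eq e f ihe ihf =>
    rw [keeps, Bool.and_eq_true] at he
    rw [NatExp.eval, NatExp.eval, ihe he.1, ihf he.2]

theorem time_le_timeBound_eval {p : Prog} (hp : p.sketchFree) (hkeeps : p.loopCounts.all p.keeps)
    (s : MachineState R) : p.time S K s ≤ p.timeBound K fun e => e.eval s :=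
  time_le_timeBound _ hp fun e he _ frame => (frame.eval (List.all_eq_true.1 hkeeps e he)).le

end Prog

/-! ### Comparison of rows on common columns -/

theorem list_cons_le_cons_iff {α : Type*} [LinearOrder α] {a b : α} {l l' : List α} :
    a :: l ≤ b :: l' ↔ a < b ∨ a = b ∧ l ≤ l' := by
  rw [← not_lt, List.cons_lt_cons_iff]
  grind

namespace JoinQuery

variable {m d : ℕ} (Q : JoinQuery m d)

/-- The entry in column `c` of the row with code `x`: the rows of table `i` have the codes
`0, …, size i - 1`, and the codes of the rows of table `j` follow. -/
noncomputable def codeEntry (i j : Fin m) (x c : ℕ) : ℝ :=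
  if x < Q.size i then Q.entry i x c else Q.entry j (x - Q.size i) c

/-- The entries of the row with code `x` in those of the first `k` columns that are common columns
of the tables `i` and `j`, the last one first. -/
noncomputable def keyPrefix (i j : Fin m) (x : ℕ) : ℕ → List ℝ
  | 0 => []
  | k + 1 =>
    if ∃ h : k < d, (⟨k, h⟩ : Fin d) ∈ Q.cols i ∩ Q.cols j then
      Q.codeEntry i j x k :: keyPrefix i j x k
    else keyPrefix i j x k

/-- The entries of the row with code `x` in the common columns of the tables `i` and `j`. -/
noncomputable def joinKey (i j : Fin m) (x : ℕ) : List ℝ := Q.keyPrefix i j x d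

variable {Q}

theorem keyPrefix_eq_iff {i j : Fin m} {x y k : ℕ} : Q.keyPrefix i j x k = Q.keyPrefix i j y k ↔
    ∀ c ∈ Q.cols i ∩ Q.cols j, c.1 < k → Q.codeEntry i j x c = Q.codeEntry i j y c := by
  induction k with
  | zero => simp [keyPrefix]
  | succ k ih =>
    rw [keyPrefix, keyPrefix]
    split_ifs with h
    · obtain ⟨hk, hmem⟩ := h
      rw [List.cons.injEq, ih]
      refine ⟨fun ⟨hlast, hprefix⟩ c hc hck => ?_, fun hall =>
        ⟨hall ⟨k, hk⟩ hmem k.lt_succ_self, fun c hc hck => hall c hc (hck.trans k.lt_succ_self)⟩⟩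
      obtain hck | rfl := Nat.lt_succ_iff_lt_or_eq.1 hck
      exacts [hprefix c hc hck, hlast]
    · rw [ih]
      refine forall₂_congr fun c hc => ?_
      have hck : c.1 ≠ k := by
        rintro rfl
        exact h ⟨c.2, hc⟩
      rw [Nat.lt_succ_iff, hck.le_iff_lt]

theorem joinKey_eq_iff_agree {i j : Fin m} {r r' : ℕ} (hr : r < Q.size i) :
    Q.joinKey i j r = Q.joinKey i j (Q.size i + r') ↔ Q.Agree i j r r' := by
  simp only [joinKey, keyPrefix_eq_iff, Agree, Finset.mem_inter, Fin.is_lt, forall_const, and_imp,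
    codeEntry, if_pos hr, add_lt_iff_neg_left, Nat.not_lt_zero, if_false, Nat.add_sub_cancel_left]

end JoinQuery

/-! ### The number registers and the arrays of the algorithm -/

namespace Reg

abbrev tableCount : ℕ := 0
abbrev columnCount : ℕ := 1
abbrev stepCount : ℕ := 2
abbrev column : ℕ := 3
abbrev step : ℕ := 4
abbrev source : ℕ := 5
abbrev target : ℕ := 6
abbrev split : ℕ := 7
abbrev total : ℕ := 8
abbrev passes : ℕ := 9
abbrev pass : ℕ := 10
abbrev width : ℕ := 11
abbrev pos : ℕ := 12
abbrev left : ℕ := 13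
abbrev leftEnd : ℕ := 14
abbrev right : ℕ := 15
abbrev rightEnd : ℕ := 16
abbrev codeA : ℕ := 17
abbrev codeB : ℕ := 18
abbrev tableA : ℕ := 19
abbrev rowA : ℕ := 20
abbrev tableB : ℕ := 21
abbrev rowB : ℕ := 22
abbrev cmpColumn : ℕ := 23
abbrev flag : ℕ := 24
abbrev leAB : ℕ := 25
abbrev leBA : ℕ := 26
abbrev row : ℕ := 27
abbrev table : ℕ := 28
abbrev factorColumns : ℕ := 29

end Reg

namespace Arr

abbrev sizes : ℕ := 0
abbrev incidence : ℕ := 1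
abbrev owner : ℕ := 2
abbrev plan : ℕ := 3
abbrev order : ℕ := 4
abbrev merged : ℕ := 5
abbrev key : ℕ := 6

end Arr

namespace Prog

/-- Finds the table and the row with the code in register `code`. -/
def decode (code table row : ℕ) : Prog :=
  ite (.le (.add (.var code) (.const 1)) (.var Reg.split))
    (block [assign table (.var Reg.source), assign row (.var code)])
    (block [assign table (.var Reg.target), assign row (.sub (.var code) (.var Reg.split))])

/-- Replaces the result of the comparison on the earlier columns by the one on the current column,
unless there is a tie. -/
def compareEntries : Prog := block [
  read 0 (.var Reg.tableA) (.var Reg.rowA) (.var Reg.cmpColumn),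
  read 1 (.var Reg.tableB) (.var Reg.rowB) (.var Reg.cmpColumn),
  compare Reg.leAB 0 1,
  compare Reg.leBA 1 0,
  ite (.eq (.var Reg.leAB) (.var Reg.leBA)) skip (assign Reg.flag (.var Reg.leAB))]

/-- Compares the keys of the rows in registers `rowA` and `rowB` column by column. -/
def compareColumns : Prog :=
  loop Reg.cmpColumn (.var Reg.columnCount)
    (ite (.le (.const 2) (.add (.get Arr.incidence (.var Reg.source) (.var Reg.cmpColumn))
        (.get Arr.incidence (.var Reg.target) (.var Reg.cmpColumn))))
      compareEntries skip)

/-- Sets the flag if the key of the row with code `codeA` is at most that of code `codeB`. -/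
def compareKeys : Prog := block [
  decode Reg.codeA Reg.tableA Reg.rowA,
  decode Reg.codeB Reg.tableB Reg.rowB,
  assign Reg.flag (.const 1),
  compareColumns]

end Prog

section

variable {m d : ℕ} {Q : JoinQuery m d} {ρ : MulTree m} {R : Type*} {S : DBSketch Q ρ R}
  {K : SketchCosts} {i j : Fin m} {s s' : MachineState R} {p : Prog}

variable (Q i j) in
/-- The registers that describe the absorption of table `i` into table `j` are set. -/
structure MachineState.IsAbsorbing (s : MachineState R) : Prop where
  columnCount : s.var Reg.columnCount = d
  source : s.var Reg.source = i
  target : s.var Reg.target = j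
  split : s.var Reg.split = Q.size i
  total : s.var Reg.total = Q.size i + Q.size j
  incidence : ∀ (a : Fin m) (c : Fin d),
    s.arr Arr.incidence a c = if c ∈ Q.cols a then 1 else 0

/-- Whether a program leaves the registers alone that describe the current absorption. -/
def Prog.keepsAbsorbing (p : Prog) : Bool :=
  !(p.writesVar Reg.columnCount || p.writesVar Reg.source || p.writesVar Reg.target ||
    p.writesVar Reg.split || p.writesVar Reg.total || p.writesArr Arr.incidence)

namespace MachineState

theorem IsAbsorbing.of_frame (h : s.IsAbsorbing Q i j) (hf : Prog.Frame p s s')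
    (hp : p.keepsAbsorbing) : s'.IsAbsorbing Q i j := by
  simp only [Prog.keepsAbsorbing, Bool.not_eq_true', Bool.or_eq_false_iff] at hp
  obtain ⟨⟨⟨⟨⟨hcolumnCount, hsource⟩, htarget⟩, hsplit⟩, htotal⟩, hincidence⟩ := hp
  constructor
  · rw [hf.var _ hcolumnCount, h.columnCount]
  · rw [hf.var _ hsource, h.source]
  · rw [hf.var _ htarget, h.target]
  · rw [hf.var _ hsplit, h.split]
  · rw [hf.var _ htotal, h.total]
  · rw [hf.arr _ hincidence]
    exact h.incidence

theorem IsAbsorbing.le_incidence_iff (h : s.IsAbsorbing Q i j) (c : Fin d) :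
    2 ≤ s.arr Arr.incidence i c + s.arr Arr.incidence j c ↔ c ∈ Q.cols i ∩ Q.cols j := by
  rw [h.incidence, h.incidence, Finset.mem_inter]
  split_ifs with hi hj hj <;> simp [hi, hj]

end MachineState

namespace Prog

open MachineState

theorem entry_decode (h : s.IsAbsorbing Q i j) {code table row : ℕ} (hcode : table ≠ code)
    (hrow : table ≠ row) (hsplit : table ≠ Reg.split) (c : ℕ) :
    Q.entry (((decode code table row).exec S K s).var table)
      (((decode code table row).exec S K s).var row) c = Q.codeEntry i j (s.var code) c := by
  by_cases hlt : s.var code < Q.size i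
  · simp [decode, NatExp.eval, JoinQuery.codeEntry, h.split, h.source, hlt,
      hcode.symm, hrow]
  · simp [decode, NatExp.eval, JoinQuery.codeEntry, h.split, h.target, hlt,
      hcode.symm, hrow, hsplit.symm]

open Classical in
theorem exec_compareEntries_flag {a b : ℝ} {l l' : List ℝ}
    (ha : Q.entry (s.var Reg.tableA) (s.var Reg.rowA) (s.var Reg.cmpColumn) = a)
    (hb : Q.entry (s.var Reg.tableB) (s.var Reg.rowB) (s.var Reg.cmpColumn) = b)
    (hflag : s.var Reg.flag = if l ≤ l' then 1 else 0) :
    (compareEntries.exec S K s).var Reg.flag = if a :: l ≤ b :: l' then 1 else 0 := by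
  rcases lt_trichotomy a b with hab | rfl | hab
  · simp [compareEntries, NatExp.eval, ha, hb, list_cons_le_cons_iff, hab, hab.le]
  · simp [compareEntries, NatExp.eval, ha, hb, hflag, list_cons_le_cons_iff]
  · simp [compareEntries, NatExp.eval, ha, hb, list_cons_le_cons_iff, hab, hab.le, hab.not_gt,
      hab.ne']

open Classical in
theorem exec_compareColumns_flag (h : s.IsAbsorbing Q i j) {x y : ℕ}
    (hA : ∀ c, Q.entry (s.var Reg.tableA) (s.var Reg.rowA) c = Q.codeEntry i j x c)
    (hB : ∀ c, Q.entry (s.var Reg.tableB) (s.var Reg.rowB) c = Q.codeEntry i j y c)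
    (hflag : s.var Reg.flag = 1) : (compareColumns.exec S K s).var Reg.flag =
      if Q.joinKey i j x ≤ Q.joinKey i j y then 1 else 0 := by
  refine exec_loop_invariant (e := .var _) h.columnCount (fun k s' => s'.var Reg.flag =
    if Q.keyPrefix i j x k ≤ Q.keyPrefix i j y k then 1 else 0) ?_ fun k hk s' frame hflag' => ?_
  · simp [JoinQuery.keyPrefix, hflag]
  have h' := h.of_frame frame rfl
  have hcommon := h'.le_incidence_iff ⟨k, hk⟩
  simp only [exec_ite, JoinQuery.keyPrefix, hk, exists_true_left]
  rw [← if_congr hcommon rfl rfl, ← if_congr hcommon rfl rfl]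
  by_cases hc : 2 ≤ s'.arr Arr.incidence i k + s'.arr Arr.incidence j k
  · rw [if_pos (by simp [NatExp.eval, h'.source, h'.target, hc]), if_pos hc, if_pos hc]
    exact exec_compareEntries_flag (by simp [frame.var Reg.tableA rfl, frame.var Reg.rowA rfl, hA])
      (by simp [frame.var Reg.tableB rfl, frame.var Reg.rowB rfl, hB]) hflag'
  · rw [if_neg (by simp [NatExp.eval, h'.source, h'.target, hc]), if_neg hc, if_neg hc]
    exact hflag'

open Classical in
theorem exec_compareKeys_flag (h : s.IsAbsorbing Q i j) :
    (compareKeys.exec S K s).var Reg.flag =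
      if Q.joinKey i j (s.var Reg.codeA) ≤ Q.joinKey i j (s.var Reg.codeB) then 1 else 0 := by
  have frameA := exec_frame S K (decode Reg.codeA Reg.tableA Reg.rowA) s
  have hA := h.of_frame frameA rfl
  have frameB := exec_frame S K (decode Reg.codeB Reg.tableB Reg.rowB)
    ((decode Reg.codeA Reg.tableA Reg.rowA).exec S K s)
  rw [compareKeys, exec_block_cons, exec_block_cons, exec_block_cons, exec_block_cons,
    exec_block_nil, exec_assign]
  refine exec_compareColumns_flag ?_ (fun c => ?_) (fun c => ?_) (by simp [NatExp.eval])
  · exact (hA.of_frame frameB rfl).of_frame (exec_frame S K (assign Reg.flag (.const 1)) _) rfl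
  · simp only [MachineState.var_setVar, if_neg (show Reg.tableA ≠ Reg.flag by decide),
      if_neg (show Reg.rowA ≠ Reg.flag by decide), frameB.var Reg.tableA rfl,
      frameB.var Reg.rowA rfl]
    exact entry_decode h (by decide) (by decide) (by decide) c
  · simp only [MachineState.var_setVar, if_neg (show Reg.tableB ≠ Reg.flag by decide),
      if_neg (show Reg.rowB ≠ Reg.flag by decide), ← frameA.var Reg.codeB rfl]
    exact entry_decode hA (by decide) (by decide) (by decide) c

end Prog

end

/-! ### Merge sort -/

/-- The array `a` is sorted by `f` on each of the blocks of length `w` of `0, …, L - 1`. -/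
def IsBlockSorted {α : Type*} [LE α] (f : ℕ → α) (w L : ℕ) (a : ℕ → ℕ) : Prop :=
  ∀ x y, x ≤ y → y < L → x / w = y / w → f (a x) ≤ f (a y)

/-- The first `t` cells of `b` are the output of a merge pass that makes blocks of length `W` of
the array `a`: the cells `rem` of `a` are waiting to be merged, and the merge of those from `next`
on has not yet begun. -/
structure IsMergeOutput {α : Type*} [LE α] (f : ℕ → α) (W L : ℕ) (a b : ℕ → ℕ) (t : ℕ)
    (rem : Set ℕ) (next : ℕ) : Prop where
  sorted : IsBlockSorted f W t b
  le_rem : ∀ x < t, x / W = t / W → ∀ y ∈ rem, f (b x) ≤ f (a y)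
  cover : ∀ y < L, (∃ x < t, b x = a y) ∨ y ∈ rem ∨ next ≤ y

/-- The invariant of a merge pass: after `t` steps, the cells `l, …, l' - 1` of the left block and
the cells `r, …, r' - 1` of the right block are waiting to be merged. -/
structure IsMerging {α : Type*} [Preorder α] (f : ℕ → α) (w L : ℕ) (a b : ℕ → ℕ)
    (t l l' r r' : ℕ) : Prop where
  output : IsMergeOutput f (2 * w) L a b t (Set.Ico l l' ∪ Set.Ico r r') r'
  left_le : l ≤ l'
  right_le : r ≤ r'
  end_le : r' ≤ L
  progress : t + l' = l + r
  aligned : 2 * w ∣ r' ∨ r' = L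
  left_sorted : MonotoneOn (f ∘ a) (Set.Ico l l')
  right_sorted : MonotoneOn (f ∘ a) (Set.Ico r r')

section Merge

variable {α : Type*} [Preorder α] {f : ℕ → α} {w W L : ℕ} {a b : ℕ → ℕ} {t l l' r r' next : ℕ}
  {rem rem' : Set ℕ}

theorem IsBlockSorted.monotoneOn (h : IsBlockSorted f w L a) {k e : ℕ} (hw : w ∣ k) (he : e ≤ L)
    (hek : e ≤ k + w) : MonotoneOn (f ∘ a) (Set.Ico k e) := by
  obtain ⟨q, rfl⟩ := hw
  have hdiv (x : ℕ) (hx : x ∈ Set.Ico (w * q) e) : x / w = q :=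
    Nat.div_eq_of_lt_le (by rw [mul_comm]; exact hx.1)
      (by rw [add_mul, one_mul, mul_comm]; exact hx.2.trans_le hek)
  exact fun x hx y hy hxy => h x y hxy (hy.2.trans_le he) (by rw [hdiv x hx, hdiv y hy])

theorem IsMergeOutput.snoc (h : IsMergeOutput f W L a b t rem next) {z : ℕ} (hz : z ∈ rem)
    (hmin : ∀ y ∈ rem, f (a z) ≤ f (a y)) (hsub : rem' ⊆ rem) (hrem : rem ⊆ insert z rem') :
    IsMergeOutput f W L a (Function.update b t (a z)) (t + 1) rem' next where
  sorted x y hxy hy hdiv := by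
    obtain hyt | rfl := Nat.lt_succ_iff_lt_or_eq.1 hy
    · rw [Function.update_of_ne (hxy.trans_lt hyt).ne, Function.update_of_ne hyt.ne]
      exact h.sorted x y hxy hyt hdiv
    · obtain hxt | rfl := hxy.lt_or_eq
      · rw [Function.update_of_ne hxt.ne, Function.update_self]
        exact h.le_rem x hxt hdiv z hz
      · exact le_rfl
  le_rem x hx hdiv y hy := by
    obtain hxt | rfl := Nat.lt_succ_iff_lt_or_eq.1 hx
    · rw [Function.update_of_ne hxt.ne]
      refine h.le_rem x hxt (le_antisymm (Nat.div_le_div_right hxt.le) ?_) y (hsub hy)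
      rw [hdiv]
      exact Nat.div_le_div_right t.le_succ
    · rw [Function.update_self]
      exact hmin y (hsub hy)
  cover y hy := by
    obtain ⟨x, hxt, hx⟩ | hy | hy := h.cover y hy
    · exact .inl ⟨x, hxt.trans t.lt_succ_self, by rw [Function.update_of_ne hxt.ne, hx]⟩
    · obtain rfl | hy := hrem hy
      · exact .inl ⟨t, t.lt_succ_self, Function.update_self ..⟩
      · exact .inr (.inl hy)
    · exact .inr (.inr hy)

theorem IsMergeOutput.newBlocks (h : IsMergeOutput f W L a b t ∅ t) (hW : W ∣ t) (e : ℕ) :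
    IsMergeOutput f W L a b t (Set.Ico t e) e where
  sorted := h.sorted
  le_rem x hx hdiv := by
    refine absurd ?_ hx.not_ge
    rw [← Nat.div_mul_cancel hW, ← hdiv]
    exact Nat.div_mul_le_self x W
  cover y hy := by
    obtain hx | hy | hy := h.cover y hy
    · exact .inl hx
    · exact hy.elim
    · exact .inr ((lt_or_ge y e).imp_left fun hlt => ⟨hy, hlt⟩)

namespace IsMerging

theorem zero : IsMerging f w L a b 0 0 0 0 0 where
  output := ⟨fun _ _ _ hy => absurd hy (Nat.not_lt_zero _),
    fun _ hx => absurd hx (Nat.not_lt_zero _), fun _ _ => .inr (.inr (Nat.zero_le _))⟩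
  left_le := le_rfl
  right_le := le_rfl
  end_le := Nat.zero_le L
  progress := rfl
  aligned := .inl (dvd_zero _)
  left_sorted := by simp [MonotoneOn]
  right_sorted := by simp [MonotoneOn]

theorem newBlocks (h : IsMerging f w L a b t l l' r t) (ht : t < L)
    (ha : IsBlockSorted f w L a) : IsMerging f w L a b t t (min (t + w) L) (min (t + w) L)
      (min (min (t + w) L + w) L) := by
  have hdvd : 2 * w ∣ t := h.aligned.resolve_right ht.ne
  have hleft : l = l' := by have := h.progress; have := h.left_le; have := h.right_le; omega
  have hright : r = t := by have := h.progress; have := h.left_le; have := h.right_le; omega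
  have output : IsMergeOutput f (2 * w) L a b t ∅ t := by
    simpa only [hleft, hright, Set.Ico_self, Set.union_self] using h.output
  constructor
  · rw [Set.Ico_union_Ico_eq_Ico (by omega) (by omega)]
    exact output.newBlocks hdvd _
  · omega
  · omega
  · omega
  · rfl
  · obtain hL | hL := le_total L (t + 2 * w)
    · right; omega
    · left
      rw [show min (min (t + w) L + w) L = t + 2 * w by omega]
      exact hdvd.add (dvd_refl _)
  · exact ha.monotoneOn ((dvd_mul_left w 2).trans hdvd) (by omega) (by omega)
  · obtain hL | hL := le_total L (t + w)
    · rw [Set.Ico_eq_empty (by omega)]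
      exact Set.subsingleton_empty.monotoneOn _
    · rw [min_eq_left hL]
      exact ha.monotoneOn (((dvd_mul_left w 2).trans hdvd).add (dvd_refl w)) (by omega) (by omega)

theorem takeLeft (h : IsMerging f w L a b t l l' r r') (hl : l < l')
    (hle : r < r' → f (a l) ≤ f (a r)) :
    IsMerging f w L a (Function.update b t (a l)) (t + 1) (l + 1) l' r r' where
  output := by
    refine h.output.snoc (z := l) (.inl ⟨le_rfl, hl⟩) ?_ (by grind) (by grind)
    rintro y (hy | hy)
    · exact h.left_sorted ⟨le_rfl, hl⟩ hy hy.1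
    · have hr : r < r' := hy.1.trans_lt hy.2
      exact (hle hr).trans (h.right_sorted ⟨le_rfl, hr⟩ hy hy.1)
  left_le := hl
  right_le := h.right_le
  end_le := h.end_le
  progress := by have := h.progress; omega
  aligned := h.aligned
  left_sorted := h.left_sorted.mono (Set.Ico_subset_Ico_left l.le_succ)
  right_sorted := h.right_sorted

theorem takeRight (h : IsMerging f w L a b t l l' r r') (hr : r < r')
    (hle : l < l' → f (a r) ≤ f (a l)) :
    IsMerging f w L a (Function.update b t (a r)) (t + 1) l l' (r + 1) r' where
  output := by
    refine h.output.snoc (z := r) (.inr ⟨le_rfl, hr⟩) ?_ (by grind) (by grind)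
    rintro y (hy | hy)
    · have hl : l < l' := hy.1.trans_lt hy.2
      exact (hle hl).trans (h.left_sorted ⟨le_rfl, hl⟩ hy hy.1)
    · exact h.right_sorted ⟨le_rfl, hr⟩ hy hy.1
  left_le := h.left_le
  right_le := hr
  end_le := h.end_le
  progress := by have := h.progress; omega
  aligned := h.aligned
  left_sorted := h.left_sorted
  right_sorted := h.right_sorted.mono (Set.Ico_subset_Ico_left r.le_succ)

theorem exists_eq (h : IsMerging f w L a b L l l' r r') {y : ℕ} (hy : y < L) :
    ∃ x < L, b x = a y := by
  have := h.progress; have := h.left_le; have := h.right_le; have := h.end_le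
  obtain hx | (⟨_, _⟩ | ⟨_, _⟩) | _ := h.output.cover y hy
  · exact hx
  all_goals omega

end IsMerging

end Merge

/-- The minimum of two numbers. -/
protected def NatExp.min (e f : NatExp) : NatExp := .sub e (.sub e f)

@[simp] theorem NatExp.eval_min {R : Type*} (s : MachineState R) (e f : NatExp) :
    (e.min f).eval s = min (e.eval s) (f.eval s) := by
  simp only [NatExp.min, NatExp.eval]
  omega

namespace Prog

/-- Moves on to the next two blocks of the array `order` if the current ones are exhausted. -/
def startBlocks : Prog :=
  ite (.eq (.var Reg.pos) (.var Reg.rightEnd))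
    (block [
      assign Reg.left (.var Reg.rightEnd),
      assign Reg.leftEnd (.min (.add (.var Reg.left) (.var Reg.width)) (.var Reg.total)),
      assign Reg.right (.var Reg.leftEnd),
      assign Reg.rightEnd (.min (.add (.var Reg.right) (.var Reg.width)) (.var Reg.total))])
    skip

/-- Compares the rows whose codes are in the cells `left` and `right` of the array `order`. -/
def compareCells : Prog := block [
  assign Reg.codeA (.get Arr.order (.var Reg.left) (.const 0)),
  assign Reg.codeB (.get Arr.order (.var Reg.right) (.const 0)),
  compareKeys]

/-- Corrects the flag if the left or the right block is exhausted. -/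
def checkBlockEnds : Prog :=
  ite (.le (.add (.var Reg.left) (.const 1)) (.var Reg.leftEnd))
    (ite (.le (.add (.var Reg.right) (.const 1)) (.var Reg.rightEnd)) skip
      (assign Reg.flag (.const 1)))
    (assign Reg.flag (.const 0))

/-- Sets the flag if the next code comes from the left block. -/
def chooseBlock : Prog := block [compareCells, checkBlockEnds]

/-- Takes the next code from the left or from the right block. -/
def takeCode : Prog :=
  ite (.var Reg.flag)
    (block [store Arr.merged (.var Reg.pos) (.const 0) (.var Reg.codeA),
      assign Reg.left (.add (.var Reg.left) (.const 1))])
    (block [store Arr.merged (.var Reg.pos) (.const 0) (.var Reg.codeB),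
      assign Reg.right (.add (.var Reg.right) (.const 1))])

/-- One step of a merge pass. -/
def mergeStep : Prog := block [startBlocks, chooseBlock, takeCode]

/-- Moves to the front of the array `order`. -/
def resetBlocks : Prog := block [
  assign Reg.left (.const 0),
  assign Reg.leftEnd (.const 0),
  assign Reg.right (.const 0),
  assign Reg.rightEnd (.const 0)]

/-- Copies the array `merged` to the array `order`. -/
def copyMerged : Prog :=
  loop Reg.pos (.var Reg.total) (store Arr.order (.var Reg.pos) (.const 0)
    (.get Arr.merged (.var Reg.pos) (.const 0)))

/-- Doubles the length of the sorted blocks of the array `order`. -/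
def mergePass : Prog := block [
  resetBlocks,
  loop Reg.pos (.var Reg.total) mergeStep,
  copyMerged,
  assign Reg.width (.add (.var Reg.width) (.var Reg.width))]

/-- Fills the array `order` with the codes of the rows of the two tables. -/
def listCodes : Prog :=
  loop Reg.pos (.var Reg.total) (store Arr.order (.var Reg.pos) (.const 0) (.var Reg.pos))

/-- Sorts the codes of the rows of the two tables by their keys into the array `order`. -/
def sortCodes : Prog := block [
  listCodes,
  assign Reg.width (.const 1),
  loop Reg.pass (.var Reg.passes) mergePass]

end Prog

section

variable {m d : ℕ} {Q : JoinQuery m d} {ρ : MulTree m} {R : Type*} {S : DBSketch Q ρ R}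
  {K : SketchCosts} {i j : Fin m} {s s' : MachineState R} {t : ℕ}

/-- The codes in the array `order`. -/
def MachineState.order (s : MachineState R) (x : ℕ) : ℕ := s.arr Arr.order x 0

/-- The codes in the array `merged`. -/
def MachineState.merged (s : MachineState R) (x : ℕ) : ℕ := s.arr Arr.merged x 0

@[simp] theorem MachineState.order_setVar (s : MachineState R) (x v : ℕ) :
    (s.setVar x v).order = s.order := rfl

@[simp] theorem MachineState.merged_setVar (s : MachineState R) (x v : ℕ) :
    (s.setVar x v).merged = s.merged := rfl

theorem MachineState.order_setArr_merged (s : MachineState R) (t v : ℕ) :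
    (s.setArr Arr.merged t 0 v).order = s.order := by
  ext x
  simp [order]

theorem MachineState.merged_setArr_merged (s : MachineState R) (t v : ℕ) :
    (s.setArr Arr.merged t 0 v).merged = Function.update s.merged t v := by
  ext x
  simp [merged, Function.update_apply]

variable (Q i j) in
/-- The machine is `t` steps into a merge pass. -/
def MachineState.IsMergingKeys (t : ℕ) (s : MachineState R) : Prop :=
  IsMerging (Q.joinKey i j) (s.var Reg.width) (s.var Reg.total) s.order s.merged t
    (s.var Reg.left) (s.var Reg.leftEnd) (s.var Reg.right) (s.var Reg.rightEnd)

variable (Q i j) in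
/-- The codes in the registers `codeA` and `codeB` are the next ones of the left and of the right
block, and the flag says which one goes first. -/
structure MachineState.HasChosen (s : MachineState R) : Prop where
  codeA : s.var Reg.codeA = s.order (s.var Reg.left)
  codeB : s.var Reg.codeB = s.order (s.var Reg.right)
  left_lt : s.var Reg.flag ≠ 0 → s.var Reg.left < s.var Reg.leftEnd
  left_le : s.var Reg.flag ≠ 0 → s.var Reg.right < s.var Reg.rightEnd →
    Q.joinKey i j (s.order (s.var Reg.left)) ≤ Q.joinKey i j (s.order (s.var Reg.right))
  right_lt : s.var Reg.flag = 0 → s.var Reg.right < s.var Reg.rightEnd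
  right_le : s.var Reg.flag = 0 → s.var Reg.left < s.var Reg.leftEnd →
    Q.joinKey i j (s.order (s.var Reg.right)) ≤ Q.joinKey i j (s.order (s.var Reg.left))

variable (Q i j) in
/-- The codes in the array `order` are those of all rows of the tables `i` and `j`, sorted by their
keys. -/
structure MachineState.IsSorted (s : MachineState R) : Prop where
  le : ∀ x y, x ≤ y → y < Q.size i + Q.size j →
    Q.joinKey i j (s.order x) ≤ Q.joinKey i j (s.order y)
  exists_eq : ∀ y < Q.size i + Q.size j, ∃ x < Q.size i + Q.size j, s.order x = y

namespace Prog

open MachineState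

theorem exec_startBlocks_isMergingKeys (h : s.IsMergingKeys Q i j t) (hpos : s.var Reg.pos = t)
    (ht : t < s.var Reg.total)
    (hs : IsBlockSorted (Q.joinKey i j) (s.var Reg.width) (s.var Reg.total) s.order) :
    (startBlocks.exec S K s).IsMergingKeys Q i j t := by
  by_cases hend : t = s.var Reg.rightEnd
  · subst hend
    simpa [startBlocks, NatExp.eval, IsMergingKeys, hpos] using h.newBlocks ht hs
  · simpa [startBlocks, NatExp.eval, IsMergingKeys, hpos, hend] using h

theorem exec_startBlocks_lt (h : s.IsMergingKeys Q i j t) (hpos : s.var Reg.pos = t)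
    (ht : t < s.var Reg.total) (hwidth : 0 < s.var Reg.width) (s' : MachineState R)
    (hs' : startBlocks.exec S K s = s') :
    s'.var Reg.left < s'.var Reg.leftEnd ∨ s'.var Reg.right < s'.var Reg.rightEnd := by
  subst hs'
  by_cases hend : t = s.var Reg.rightEnd
  · left
    simp [startBlocks, NatExp.eval, hpos, ← hend, hwidth, ht]
  · have := h.progress; have := h.left_le; have := h.right_le
    simp only [startBlocks, NatExp.eval, exec_ite, hpos, hend, if_false, ne_eq, not_true,
      exec_skip]
    omega

open Classical in
theorem exec_compareCells (h : s.IsAbsorbing Q i j) (s' : MachineState R)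
    (hs' : compareCells.exec S K s = s') :
    s'.var Reg.codeA = s.order (s.var Reg.left) ∧ s'.var Reg.codeB = s.order (s.var Reg.right) ∧
      s'.var Reg.flag = if Q.joinKey i j (s.order (s.var Reg.left)) ≤
        Q.joinKey i j (s.order (s.var Reg.right)) then 1 else 0 := by
  set s₁ := (assign Reg.codeA (.get Arr.order (.var Reg.left) (.const 0))).exec S K s with hs₁
  set s₂ := (assign Reg.codeB (.get Arr.order (.var Reg.right) (.const 0))).exec S K s₁ with hs₂
  have h₁ : s₁.IsAbsorbing Q i j := h.of_frame (exec_frame S K _ _) rfl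
  have h₂ : s₂.IsAbsorbing Q i j := h₁.of_frame (exec_frame S K _ _) rfl
  have hA : s₂.var Reg.codeA = s.order (s.var Reg.left) := by
    simp [hs₂, hs₁, NatExp.eval, MachineState.order]
  have hB : s₂.var Reg.codeB = s.order (s.var Reg.right) := by
    simp [hs₂, hs₁, NatExp.eval, MachineState.order]
  rw [compareCells, exec_block_cons, exec_block_cons, exec_block_cons, exec_block_nil] at hs'
  subst hs'
  have frame := exec_frame S K compareKeys s₂
  rw [← hA, ← hB]
  exact ⟨frame.var Reg.codeA rfl, frame.var Reg.codeB rfl, exec_compareKeys_flag h₂⟩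

theorem exec_checkBlockEnds_flag (s : MachineState R) :
    (checkBlockEnds.exec S K s).var Reg.flag = if s.var Reg.left < s.var Reg.leftEnd then
      if s.var Reg.right < s.var Reg.rightEnd then s.var Reg.flag else 1 else 0 := by
  by_cases hleft : s.var Reg.left < s.var Reg.leftEnd <;>
    by_cases hright : s.var Reg.right < s.var Reg.rightEnd <;>
    simp [checkBlockEnds, NatExp.eval, hleft, hright]

theorem exec_chooseBlock_hasChosen (h : s.IsAbsorbing Q i j)
    (hlt : s.var Reg.left < s.var Reg.leftEnd ∨ s.var Reg.right < s.var Reg.rightEnd) :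
    (chooseBlock.exec S K s).HasChosen Q i j := by
  classical
  obtain ⟨s₁, hs₁⟩ : ∃ s₁, compareCells.exec S K s = s₁ := ⟨_, rfl⟩
  obtain ⟨s₂, hs₂⟩ : ∃ s₂, checkBlockEnds.exec S K s₁ = s₂ := ⟨_, rfl⟩
  have frame₁ : Frame compareCells s s₁ := hs₁ ▸ exec_frame S K _ s
  have frame₂ : Frame checkBlockEnds s₁ s₂ := hs₂ ▸ exec_frame S K _ s₁
  have frame : Frame chooseBlock s s₂ := frame₁.seq_left.trans frame₂.seq_left.seq_right
  have hs : chooseBlock.exec S K s = s₂ := by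
    rw [chooseBlock, exec_block_cons, exec_block_cons, exec_block_nil, hs₁, hs₂]
  obtain ⟨hA, hB, hcompare⟩ := exec_compareCells h s₁ hs₁
  have hflag := hs₂ ▸ exec_checkBlockEnds_flag (S := S) (K := K) s₁
  have horder : s₂.order = s.order := congrArg (fun a x => a x 0) (frame.arr Arr.order rfl)
  rw [hcompare, frame₁.var Reg.left rfl, frame₁.var Reg.leftEnd rfl, frame₁.var Reg.right rfl,
    frame₁.var Reg.rightEnd rfl] at hflag
  rw [← frame₂.var Reg.codeA rfl] at hA
  rw [← frame₂.var Reg.codeB rfl] at hB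
  have hleft := frame.var Reg.left rfl
  have hleftEnd := frame.var Reg.leftEnd rfl
  have hright := frame.var Reg.right rfl
  have hrightEnd := frame.var Reg.rightEnd rfl
  have := le_total (Q.joinKey i j (s.order (s.var Reg.left)))
    (Q.joinKey i j (s.order (s.var Reg.right)))
  rw [hs]
  constructor <;> simp only [horder, hA, hB, hleft, hleftEnd, hright, hrightEnd] <;> grind

theorem exec_takeCode_isMergingKeys (h : s.IsMergingKeys Q i j t) (hpos : s.var Reg.pos = t)
    (hs : s.HasChosen Q i j) : (takeCode.exec S K s).IsMergingKeys Q i j (t + 1) := by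
  by_cases hflag : s.var Reg.flag = 0
  · simpa [takeCode, NatExp.eval, IsMergingKeys, hflag, hpos, hs.codeB, order_setArr_merged,
      merged_setArr_merged] using h.takeRight (hs.right_lt hflag) (hs.right_le hflag)
  · simpa [takeCode, NatExp.eval, IsMergingKeys, hflag, hpos, hs.codeA, order_setArr_merged,
      merged_setArr_merged] using h.takeLeft (hs.left_lt hflag) (hs.left_le hflag)

theorem exec_mergeStep_isMergingKeys (h : s.IsAbsorbing Q i j) (hs : s.IsMergingKeys Q i j t)
    (hpos : s.var Reg.pos = t) (ht : t < s.var Reg.total) (hwidth : 0 < s.var Reg.width)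
    (hsorted : IsBlockSorted (Q.joinKey i j) (s.var Reg.width) (s.var Reg.total) s.order) :
    (mergeStep.exec S K s).IsMergingKeys Q i j (t + 1) := by
  rw [mergeStep, exec_block_cons, exec_block_cons, exec_block_cons, exec_block_nil]
  obtain ⟨s₁, hs₁⟩ : ∃ s₁, startBlocks.exec S K s = s₁ := ⟨_, rfl⟩
  obtain ⟨s₂, hs₂⟩ : ∃ s₂, chooseBlock.exec S K s₁ = s₂ := ⟨_, rfl⟩
  have frame₁ : Frame startBlocks s s₁ := hs₁ ▸ exec_frame S K _ s
  have frame₂ : Frame chooseBlock s₁ s₂ := hs₂ ▸ exec_frame S K _ s₁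
  have merging₁ : s₁.IsMergingKeys Q i j t :=
    hs₁ ▸ exec_startBlocks_isMergingKeys hs hpos ht hsorted
  have chosen : s₂.HasChosen Q i j := hs₂ ▸ exec_chooseBlock_hasChosen (h.of_frame frame₁ rfl)
    (exec_startBlocks_lt hs hpos ht hwidth s₁ hs₁)
  have merging₂ : s₂.IsMergingKeys Q i j t := by
    have horder : s₂.order = s₁.order := congrArg (fun a x => a x 0) (frame₂.arr Arr.order rfl)
    have hmerged : s₂.merged = s₁.merged :=
      congrArg (fun a x => a x 0) (frame₂.arr Arr.merged rfl)
    rwa [IsMergingKeys, horder, hmerged, frame₂.var Reg.width rfl, frame₂.var Reg.total rfl,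
      frame₂.var Reg.left rfl, frame₂.var Reg.leftEnd rfl, frame₂.var Reg.right rfl,
      frame₂.var Reg.rightEnd rfl]
  rw [hs₁, hs₂]
  exact exec_takeCode_isMergingKeys merging₂
    ((frame₂.var Reg.pos rfl).trans ((frame₁.var Reg.pos rfl).trans hpos)) chosen

theorem exec_loop_mergeStep_isMergingKeys (h : s.IsAbsorbing Q i j) (hs : s.IsMergingKeys Q i j 0)
    (hwidth : 0 < s.var Reg.width)
    (hsorted : IsBlockSorted (Q.joinKey i j) (s.var Reg.width) (s.var Reg.total) s.order) :
    ((loop Reg.pos (.var Reg.total) mergeStep).exec S K s).IsMergingKeys Q i j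
      (s.var Reg.total) := by
  refine exec_loop_invariant rfl (fun t s' => s'.IsMergingKeys Q i j t) hs
    fun t ht s' frame hs' => ?_
  have frame' := frame.trans (frame_loop_setVar _ _ _ _ t)
  have horder : (s'.setVar Reg.pos t).order = s.order :=
    congrArg (fun a x => a x 0) (frame'.arr Arr.order rfl)
  refine exec_mergeStep_isMergingKeys (h.of_frame frame' rfl) (by simpa [IsMergingKeys] using hs')
    (by simp) ?_ ?_ ?_
  · rwa [frame'.var Reg.total rfl]
  · rwa [frame'.var Reg.width rfl]
  · rwa [frame'.var Reg.width rfl, frame'.var Reg.total rfl, horder]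

theorem order_exec_copyMerged {x : ℕ} (hx : x < s.var Reg.total) :
    (copyMerged.exec S K s).order x = s.merged x := by
  refine exec_loop_invariant (e := .var _) rfl (fun t s' => ∀ y < t, s'.order y = s.merged y)
    (by simp) (fun t _ s' frame hs' y hy => ?_) x hx
  have hmerged : s'.arr Arr.merged = s.arr Arr.merged := frame.arr Arr.merged rfl
  obtain hyt | rfl := Nat.lt_succ_iff_lt_or_eq.1 hy
  · simpa [NatExp.eval, MachineState.order, hyt.ne] using hs' y hyt
  · simp [NatExp.eval, MachineState.order, merged, hmerged]

theorem order_exec_listCodes {x : ℕ} (hx : x < s.var Reg.total) :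
    (listCodes.exec S K s).order x = x := by
  refine exec_loop_invariant (e := .var _) rfl (fun t s' => ∀ y < t, s'.order y = y)
    (by simp) (fun t _ s' _ hs' y hy => ?_) x hx
  obtain hyt | rfl := Nat.lt_succ_iff_lt_or_eq.1 hy
  · simpa [NatExp.eval, MachineState.order, hyt.ne] using hs' y hyt
  · simp [NatExp.eval, MachineState.order]

theorem exec_mergePass (h : s.IsAbsorbing Q i j) (hwidth : 0 < s.var Reg.width)
    (hsorted : IsBlockSorted (Q.joinKey i j) (s.var Reg.width) (s.var Reg.total) s.order)
    (s' : MachineState R) (hs' : mergePass.exec S K s = s') :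
    s'.var Reg.width = 2 * s.var Reg.width ∧
      IsBlockSorted (Q.joinKey i j) (2 * s.var Reg.width) (s.var Reg.total) s'.order ∧
      ∀ y < s.var Reg.total, ∃ x < s.var Reg.total, s'.order x = s.order y := by
  obtain ⟨s₁, hs₁⟩ : ∃ s₁, resetBlocks.exec S K s = s₁ := ⟨_, rfl⟩
  obtain ⟨s₂, hs₂⟩ : ∃ s₂, (loop Reg.pos (.var Reg.total) mergeStep).exec S K s₁ = s₂ := ⟨_, rfl⟩
  obtain ⟨s₃, hs₃⟩ : ∃ s₃, copyMerged.exec S K s₂ = s₃ := ⟨_, rfl⟩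
  have frame₁ : Frame resetBlocks s s₁ := hs₁ ▸ exec_frame S K _ s
  have frame₂ : Frame (loop Reg.pos (.var Reg.total) mergeStep) s₁ s₂ := hs₂ ▸ exec_frame S K _ s₁
  have frame₃ : Frame copyMerged s₂ s₃ := hs₃ ▸ exec_frame S K _ s₂
  have htotal₁ := frame₁.var Reg.total rfl
  have htotal₂ := (frame₂.var Reg.total rfl).trans htotal₁
  have hwidth₁ := frame₁.var Reg.width rfl
  have hwidth₂ := (frame₂.var Reg.width rfl).trans hwidth₁
  have horder₁ : s₁.order = s.order := congrArg (fun a x => a x 0) (frame₁.arr Arr.order rfl)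
  have horder₂ : s₂.order = s.order :=
    (congrArg (fun a x => a x 0) (frame₂.arr Arr.order rfl)).trans horder₁
  have merging₁ : s₁.IsMergingKeys Q i j 0 := by
    simpa [← hs₁, resetBlocks, NatExp.eval, IsMergingKeys] using IsMerging.zero
  have merging₂ : s₂.IsMergingKeys Q i j (s.var Reg.total) := by
    rw [← hs₂, ← htotal₁]
    exact exec_loop_mergeStep_isMergingKeys (h.of_frame frame₁ rfl) merging₁ (by rwa [hwidth₁])
      (by rwa [hwidth₁, htotal₁, horder₁])
  rw [IsMergingKeys, hwidth₂, htotal₂, horder₂] at merging₂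
  rw [mergePass, exec_block_cons, exec_block_cons, exec_block_cons, exec_block_cons,
    exec_block_nil, hs₁, hs₂, hs₃] at hs'
  have horder (x : ℕ) (hx : x < s.var Reg.total) : s'.order x = s₂.merged x := by
    rw [← hs', exec_assign, order_setVar, ← hs₃, order_exec_copyMerged (by rwa [htotal₂])]
  refine ⟨?_, fun x y hxy hy hdiv => ?_, fun y hy => ?_⟩
  · rw [← hs', exec_assign]
    simp [NatExp.eval, frame₃.var Reg.width rfl, hwidth₂, two_mul]
  · rw [horder x (hxy.trans_lt hy), horder y hy]
    exact merging₂.output.sorted x y hxy hy hdiv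
  · obtain ⟨x, hx, hxy⟩ := merging₂.exists_eq hy
    exact ⟨x, hx, (horder x hx).trans hxy⟩

theorem exec_loop_mergePass (h : s.IsAbsorbing Q i j) (hwidth : s.var Reg.width = 1)
    (horder : ∀ x < Q.size i + Q.size j, s.order x = x) (s' : MachineState R)
    (hs' : (loop Reg.pass (.var Reg.passes) mergePass).exec S K s = s') :
    IsBlockSorted (Q.joinKey i j) (2 ^ s.var Reg.passes) (Q.size i + Q.size j) s'.order ∧
      ∀ y < Q.size i + Q.size j, ∃ x < Q.size i + Q.size j, s'.order x = y := by
  suffices hloop : s'.var Reg.width = 2 ^ s.var Reg.passes ∧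
      IsBlockSorted (Q.joinKey i j) (2 ^ s.var Reg.passes) (Q.size i + Q.size j) s'.order ∧
      ∀ y < Q.size i + Q.size j, ∃ x < Q.size i + Q.size j, s'.order x = y from hloop.2
  subst hs'
  refine exec_loop_invariant (e := .var _) rfl (fun k s' => s'.var Reg.width = 2 ^ k ∧
      IsBlockSorted (Q.joinKey i j) (2 ^ k) (Q.size i + Q.size j) s'.order ∧
      ∀ y < Q.size i + Q.size j, ∃ x < Q.size i + Q.size j, s'.order x = y)
    ⟨hwidth, fun x y _ _ hdiv => ?_, fun y hy => ⟨y, hy, horder y hy⟩⟩ ?_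
  · rw [pow_zero, Nat.div_one, Nat.div_one] at hdiv
    rw [hdiv]
  rintro k - s' frame ⟨hwidth', hsorted', hcover'⟩
  have h' := h.of_frame (frame.trans (frame_loop_setVar _ _ _ _ k)) rfl
  have hwidthk : (s'.setVar Reg.pass k).var Reg.width = 2 ^ k := by simp [hwidth']
  obtain ⟨hwidth'', hsorted'', hcover''⟩ := exec_mergePass (S := S) (K := K) h'
    (by rw [hwidthk]; positivity) (by rwa [hwidthk, h'.total]) _ rfl
  rw [hwidthk] at hwidth'' hsorted''
  rw [h'.total] at hsorted'' hcover''
  refine ⟨by rw [hwidth'', pow_succ'], by rwa [pow_succ'], fun y hy => ?_⟩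
  obtain ⟨x, hx, rfl⟩ := hcover' y hy
  obtain ⟨z, hz, hzx⟩ := hcover'' x hx
  exact ⟨z, hz, hzx⟩

theorem exec_sortCodes_isSorted (h : s.IsAbsorbing Q i j)
    (hpasses : Q.size i + Q.size j ≤ 2 ^ s.var Reg.passes) :
    (sortCodes.exec S K s).IsSorted Q i j := by
  rw [sortCodes, exec_block_cons, exec_block_cons, exec_block_cons, exec_block_nil]
  have frame := exec_frame S K listCodes s
  obtain ⟨s₁, hs₁⟩ : ∃ s₁, (assign Reg.width (.const 1)).exec S K (listCodes.exec S K s) = s₁ :=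
    ⟨_, rfl⟩
  have h₁ : s₁.IsAbsorbing Q i j :=
    hs₁ ▸ (h.of_frame frame rfl).of_frame (exec_frame S K _ _) rfl
  have hpasses₁ : s₁.var Reg.passes = s.var Reg.passes := by
    simp [← hs₁, frame.var Reg.passes rfl]
  have horder₁ (x : ℕ) (hx : x < Q.size i + Q.size j) : s₁.order x = x := by
    rw [← hs₁, exec_assign, order_setVar, order_exec_listCodes (h.total ▸ hx)]
  obtain ⟨hsorted, hcover⟩ := exec_loop_mergePass (S := S) (K := K) h₁
    (by simp [← hs₁, NatExp.eval]) horder₁ _ rfl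
  rw [hpasses₁] at hsorted
  rw [hs₁]
  refine ⟨fun x y hxy hy => hsorted x y hxy hy ?_, hcover⟩
  rw [Nat.div_eq_of_lt ((hxy.trans_lt hy).trans_le hpasses), Nat.div_eq_of_lt (hy.trans_le hpasses)]

end Prog

end

/-! ### Numbering of the keys -/

/-- The first position in the sequence `a` of an element with the key `f x`. -/
noncomputable def keyNumber {α : Type*} (f : ℕ → α) (a : ℕ → ℕ) (x : ℕ) : ℕ :=
  sInf {v | f (a v) = f x}

section keyNumber

variable {α : Type*} {f : ℕ → α} {a : ℕ → ℕ} {t x y : ℕ}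

theorem keyNumber_congr (h : f x = f y) : keyNumber f a x = keyNumber f a y := by
  rw [keyNumber, keyNumber, h]

theorem keyNumber_eq_iff (hx : ∃ v, a v = x) (hy : ∃ v, a v = y) :
    keyNumber f a x = keyNumber f a y ↔ f x = f y := by
  refine ⟨fun h => ?_, keyNumber_congr⟩
  have hmem (z : ℕ) (hz : ∃ v, a v = z) : f (a (keyNumber f a z)) = f z :=
    Nat.sInf_mem (s := {v | f (a v) = f z}) (hz.imp fun v hv => congrArg f hv)
  rw [← hmem x hx, h, hmem y hy]

theorem keyNumber_eq_self (h : ∀ v < t, f (a v) ≠ f (a t)) : keyNumber f a (a t) = t :=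
  (Nat.sInf_le (s := {v | f (a v) = f (a t)}) rfl).antisymm
    (not_lt.1 fun hlt => h _ hlt (Nat.sInf_mem (s := {v | f (a v) = f (a t)}) ⟨t, rfl⟩))

end keyNumber

namespace Prog

/-- Sets register `passes` to the number of doublings that take `1` to at least `total`. -/
def countPasses : Prog := block [
  assign Reg.passes (.const 0),
  assign Reg.width (.const 1),
  loop Reg.pos (.var Reg.total)
    (ite (.le (.add (.var Reg.width) (.const 1)) (.var Reg.total))
      (block [
        assign Reg.width (.add (.var Reg.width) (.var Reg.width)),
        assign Reg.passes (.add (.var Reg.passes) (.const 1))])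
      skip)]

/-- Writes the number of the key of code `order[pos]` to the array `key`, given those of the earlier
codes. -/
def numberKey : Prog := block [
  assign Reg.left (.var Reg.pos),
  assign Reg.right (.sub (.var Reg.pos) (.const 1)),
  compareCells,
  ite (.var Reg.pos)
    (ite (.var Reg.flag)
      (store Arr.key (.var Reg.codeA) (.const 0) (.get Arr.key (.var Reg.codeB) (.const 0)))
      (store Arr.key (.var Reg.codeA) (.const 0) (.var Reg.pos)))
    (store Arr.key (.var Reg.codeA) (.const 0) (.var Reg.pos))]

/-- Writes to `key[x]` the position of the first code in the array `order` with the key of `x`. -/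
def numberKeys : Prog := loop Reg.pos (.var Reg.total) numberKey

end Prog

section

variable {m d : ℕ} {Q : JoinQuery m d} {ρ : MulTree m} {R : Type*} {S : DBSketch Q ρ R}
  {K : SketchCosts} {i j : Fin m} {s s' : MachineState R} {t : ℕ}

/-- The numbers of the keys in the array `key`. -/
def MachineState.key (s : MachineState R) (x : ℕ) : ℕ := s.arr Arr.key x 0

@[simp] theorem MachineState.key_setVar (s : MachineState R) (x v : ℕ) :
    (s.setVar x v).key = s.key := rfl

namespace Prog

open MachineState

theorem exec_countPasses (s' : MachineState R) (hs' : countPasses.exec S K s = s') :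
    s.var Reg.total ≤ 2 ^ s'.var Reg.passes ∧ 2 ^ s'.var Reg.passes ≤ 2 * s.var Reg.total + 1 := by
  suffices hwidth : s'.var Reg.width = 2 ^ s'.var Reg.passes ∧
      s'.var Reg.width ≤ 2 * s.var Reg.total + 1 ∧
      (s.var Reg.total < s'.var Reg.width ∨ s.var Reg.total ≤ s'.var Reg.width) by
    rw [← hwidth.1]
    exact ⟨by omega, hwidth.2.1⟩
  rw [countPasses, exec_block_cons, exec_block_cons, exec_block_cons, exec_block_nil] at hs'
  subst hs'
  refine exec_loop_invariant (e := .var _) (n := s.var Reg.total) (by simp [NatExp.eval])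
    (fun k s' => s'.var Reg.width = 2 ^ s'.var Reg.passes ∧
      s'.var Reg.width ≤ 2 * s.var Reg.total + 1 ∧
      (k < s'.var Reg.width ∨ s.var Reg.total ≤ s'.var Reg.width)) (by simp [NatExp.eval]) ?_
  rintro k - s' frame ⟨hwidth, hbound, hlt⟩
  have htotal : s'.var Reg.total = s.var Reg.total := by
    simp [frame.var Reg.total rfl]
  by_cases hmore : s'.var Reg.width + 1 ≤ s.var Reg.total
  · suffices s'.var Reg.width + s'.var Reg.width ≤ 2 * s.var Reg.total + 1 ∧
        (k + 1 < s'.var Reg.width + s'.var Reg.width ∨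
          s.var Reg.total ≤ s'.var Reg.width + s'.var Reg.width) by
      simpa [NatExp.eval, htotal, hmore, pow_succ', two_mul, ← hwidth] using this
    omega
  · suffices s'.var Reg.width ≤ 2 * s.var Reg.total + 1 ∧
        (k + 1 < s'.var Reg.width ∨ s.var Reg.total ≤ s'.var Reg.width) by
      simpa [NatExp.eval, htotal, hmore, ← hwidth] using this
    omega

open Classical in
theorem key_exec_numberKey (h : s.IsAbsorbing Q i j) :
    (numberKey.exec S K s).key = Function.update s.key (s.order (s.var Reg.pos))
      (if s.var Reg.pos ≠ 0 ∧ Q.joinKey i j (s.order (s.var Reg.pos)) ≤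
        Q.joinKey i j (s.order (s.var Reg.pos - 1)) then
        s.key (s.order (s.var Reg.pos - 1)) else s.var Reg.pos) := by
  rw [numberKey, exec_block_cons, exec_block_cons, exec_block_cons, exec_block_cons,
    exec_block_nil]
  obtain ⟨s₁, hs₁⟩ : ∃ s₁, (assign Reg.right (.sub (.var Reg.pos) (.const 1))).exec S K
    ((assign Reg.left (.var Reg.pos)).exec S K s) = s₁ := ⟨_, rfl⟩
  obtain ⟨s₂, hs₂⟩ : ∃ s₂, compareCells.exec S K s₁ = s₂ := ⟨_, rfl⟩
  have h₁ : s₁.IsAbsorbing Q i j :=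
    hs₁ ▸ (h.of_frame (exec_frame S K _ _) rfl).of_frame (exec_frame S K _ _) rfl
  have frame₂ : Frame compareCells s₁ s₂ := hs₂ ▸ exec_frame S K _ s₁
  obtain ⟨hA, hB, hflag⟩ := exec_compareCells h₁ s₂ hs₂
  have hpos : s₂.var Reg.pos = s.var Reg.pos := by simp [frame₂.var Reg.pos rfl, ← hs₁]
  have hkey : s₂.arr Arr.key = s.arr Arr.key := by simp [frame₂.arr Arr.key rfl, ← hs₁]
  have hleft : s₁.order (s₁.var Reg.left) = s.order (s.var Reg.pos) := by
    simp [← hs₁, NatExp.eval]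
  have hright : s₁.order (s₁.var Reg.right) = s.order (s.var Reg.pos - 1) := by
    simp [← hs₁, NatExp.eval]
  rw [hleft, hright] at hflag
  rw [hleft] at hA
  rw [hright] at hB
  rw [hs₁, hs₂]
  ext x
  by_cases hzero : s.var Reg.pos = 0
  · simp [NatExp.eval, key, hpos, hzero, hA, hkey, Function.update_apply]
  by_cases hle : Q.joinKey i j (s.order (s.var Reg.pos)) ≤
    Q.joinKey i j (s.order (s.var Reg.pos - 1)) <;>
  simp [NatExp.eval, key, hpos, hzero, hflag, hle, hA, hB, hkey, Function.update_apply]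

theorem key_exec_numberKeys (h : s.IsAbsorbing Q i j) (hs : s.IsSorted Q i j) {x : ℕ}
    (hx : x < Q.size i + Q.size j) :
    (numberKeys.exec S K s).key x = keyNumber (Q.joinKey i j) s.order x := by
  obtain ⟨u, hu, rfl⟩ := hs.exists_eq x hx
  refine exec_loop_invariant (e := .var _) h.total (fun t s' => ∀ u < t, s'.key (s.order u) =
    keyNumber (Q.joinKey i j) s.order (s.order u)) (by simp) (fun t ht s' frame hs' u hu => ?_) u hu
  have frame' := frame.trans (frame_loop_setVar _ _ _ _ t)
  have horder : (s'.setVar Reg.pos t).order = s.order :=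
    congrArg (fun a x => a x 0) (frame'.arr Arr.order rfl)
  have hpos : (s'.setVar Reg.pos t).var Reg.pos = t := by simp
  rw [key_exec_numberKey (h.of_frame frame' rfl), horder, hpos, Function.update_apply]
  split_ifs with hcode hle
  · have hkey := (hs.le (t - 1) t (t.sub_le 1) ht).antisymm hle.2
    rw [key_setVar, hs' (t - 1) (by omega), hcode, keyNumber_congr hkey]
  · rw [hcode, keyNumber_eq_self fun v hv heq => hle ⟨by omega, ?_⟩]
    exact heq.symm.le.trans (hs.le v (t - 1) (by omega) (by omega))
  · obtain hut | rfl := Nat.lt_succ_iff_lt_or_eq.1 hu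
    exacts [hs' u hut, absurd rfl hcode]

theorem key_exec_numberKeys_eq_iff (h : s.IsAbsorbing Q i j) (hs : s.IsSorted Q i j) {x y : ℕ}
    (hx : x < Q.size i + Q.size j) (hy : y < Q.size i + Q.size j) :
    (numberKeys.exec S K s).key x = (numberKeys.exec S K s).key y ↔
      Q.joinKey i j x = Q.joinKey i j y := by
  rw [key_exec_numberKeys h hs hx, key_exec_numberKeys h hs hy]
  exact keyNumber_eq_iff ((hs.exists_eq x hx).imp fun _ => And.right)
    ((hs.exists_eq y hy).imp fun _ => And.right)

end Prog

end

/-! ### Absorption of a table -/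

namespace Sk

abbrev out : ℕ := 0
abbrev vals : ℕ := 1
abbrev zeros : ℕ := 2
abbrev keySums : ℕ := 3

end Sk

/-- The cell for the factor of a table at one of its rows. -/
def SketchCell.val (table row : NatExp) : SketchCell := ⟨Sk.vals, table, row⟩

/-- The cell for the factor of a table at a tuple that is not a row of the table. -/
def SketchCell.zero (table : NatExp) : SketchCell := ⟨Sk.zeros, table, .const 0⟩

/-- The cell for the sum over the source rows that have the same key as the row with a given
code. -/
def SketchCell.keySum (code : NatExp) : SketchCell :=
  ⟨Sk.keySums, .get Arr.key code (.const 0), .const 0⟩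

namespace Prog

/-- Fills the cells for the keys of the rows of the two tables with empty sums. -/
def clearKeySums : Prog :=
  loop Reg.pos (.var Reg.total) (copy (.keySum (.var Reg.pos)) (.zero (.var Reg.source)))

/-- Adds the factor of the source at every row to the cell for the key of the row. -/
def addKeySums : Prog :=
  loop Reg.row (.var Reg.split) (sketchAdd (.keySum (.var Reg.row)) (.keySum (.var Reg.row))
    (.val (.var Reg.source) (.var Reg.row)))

/-- Sums the factor of the source over the rows with the same key. -/
def sumByKey : Prog := block [clearKeySums, addKeySums]

/-- Multiplies cell `v` into cell `u`, on the side that the current step asks for. -/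
def multiplyInto (u v : SketchCell) : Prog :=
  ite (.get Arr.plan (.var Reg.step) (.const 3)) (sketchMul u v u) (sketchMul u u v)

/-- Multiplies the sums over the rows of the source into the factor of the target. -/
def multiplyRows : Prog :=
  loop Reg.row (.sub (.var Reg.total) (.var Reg.split))
    (multiplyInto (.val (.var Reg.target) (.var Reg.row))
      (.keySum (.add (.var Reg.split) (.var Reg.row))))

/-- Multiplies the factor of the source, summed over the rows with the same key, into the factor of
the target. -/
def combine : Prog := block [
  sumByKey,
  multiplyRows,
  multiplyInto (.zero (.var Reg.target)) (.zero (.var Reg.source))]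

end Prog

section

variable {m d : ℕ} {Q : JoinQuery m d} {ρ : MulTree m} {R : Type*} {S : DBSketch Q ρ R}
  {K : SketchCosts} {i j : Fin m} {s s' : MachineState R} {c : Fin m → ℕ} {σ τ : MulTree m}
  {g : Fin m → ℕ → S.Val}

namespace MachineState

/-- The factor of table `i` at row `r`. -/
def val (s : MachineState R) (i r : ℕ) : Option R := s.sk Sk.vals i r

/-- The factor of table `i` at a tuple that is not a row. -/
def zero (s : MachineState R) (i : ℕ) : Option R := s.sk Sk.zeros i 0

/-- The sum over the rows of the source with key number `κ`. -/
def keySum (s : MachineState R) (κ : ℕ) : Option R := s.sk Sk.keySums κ 0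

@[simp] theorem value_val (t r : NatExp) :
    (SketchCell.val t r).value s = s.val (t.eval s) (r.eval s) := rfl

@[simp] theorem value_zero (t : NatExp) : (SketchCell.zero t).value s = s.zero (t.eval s) := rfl

@[simp] theorem value_keySum (e : NatExp) :
    (SketchCell.keySum e).value s = s.keySum (s.key (e.eval s)) := rfl

@[simp] theorem val_setVar (x v i r : ℕ) : (s.setVar x v).val i r = s.val i r := rfl

@[simp] theorem zero_setVar (x v i : ℕ) : (s.setVar x v).zero i = s.zero i := rfl

@[simp] theorem keySum_setVar (x v κ : ℕ) : (s.setVar x v).keySum κ = s.keySum κ := rfl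

@[simp] theorem val_setCell_val (t r : NatExp) (v : Option R) (i k : ℕ) :
    (s.setCell (.val t r) v).val i k =
      if i = t.eval s ∧ k = r.eval s then v else s.val i k := by
  simp [val, SketchCell.val]

@[simp] theorem zero_setCell_zero (t : NatExp) (v : Option R) (i : ℕ) :
    (s.setCell (.zero t) v).zero i = if i = t.eval s then v else s.zero i := by
  simp [zero, SketchCell.zero, NatExp.eval]

@[simp] theorem keySum_setCell_keySum (e : NatExp) (v : Option R) (κ : ℕ) :
    (s.setCell (.keySum e) v).keySum κ = if κ = s.key (e.eval s) then v else s.keySum κ :=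
  if_congr (by simp [SketchCell.keySum, NatExp.eval, key]) rfl rfl

/-- The sketches of table `i` stand for the sums, over the tuples of the tables in `τ` that are
consistent with a row of table `i`, of the products of the values `g`. -/
structure HoldsFactor (S : DBSketch Q ρ R) (c : Fin m → ℕ) (τ : MulTree m) (g : Fin m → ℕ → S.Val)
    (i : Fin m) (s : MachineState R) : Prop where
  zero : S.Represents c τ (s.zero i) 0
  val : ∀ r < Q.size i, S.Represents c τ (s.val i r) (Q.tupleSum g τ i r)

end MachineState

namespace Prog

open MachineState

theorem keySum_exec_clearKeySums (h : s.IsAbsorbing Q i j) {x : ℕ} (hx : x < Q.size i + Q.size j) :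
    (clearKeySums.exec S K s).keySum (s.key x) = s.zero i := by
  refine exec_loop_invariant (e := .var _) h.total
    (fun t s' => ∀ x < t, s'.keySum (s.key x) = s.zero i) (by simp)
    (fun t ht s' frame hs' x hx => ?_) x hx
  have hkey : s'.key = s.key := congrArg (fun a x => a x 0) (frame.arr Arr.key rfl)
  have hzero : s'.zero = s.zero := congrArg (fun a i => a i 0) (frame.sk Sk.zeros rfl)
  have hsource : s'.var Reg.source = i := (h.of_frame frame rfl).source
  rw [exec_copy, keySum_setCell_keySum]
  split_ifs with hxt
  · simp [NatExp.eval, hsource, hzero]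
  · have hne : x ≠ t := by
      rintro rfl
      simp [NatExp.eval, hkey] at hxt
    exact hs' x (by omega)

theorem represents_keySum_exec_addKeySums (h : s.IsAbsorbing Q i j)
    (hi : s.HoldsFactor S c σ g i) {κ : ℕ} (hκ : S.Represents c σ (s.keySum κ) 0) :
    S.Represents c σ ((addKeySums.exec S K s).keySum κ)
      (∑ r ∈ Finset.range (Q.size i) with s.key r = κ, Q.tupleSum g σ i r) := by
  refine exec_loop_invariant (e := .var _) h.split (fun t s' => S.Represents c σ (s'.keySum κ)
    (∑ r ∈ Finset.range t with s.key r = κ, Q.tupleSum g σ i r)) (by simpa using hκ)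
    fun t ht s' frame hs' => ?_
  have hkey : s'.key = s.key := congrArg (fun a x => a x 0) (frame.arr Arr.key rfl)
  have hval : s'.val = s.val := frame.sk Sk.vals rfl
  have hsource : s'.var Reg.source = i := (h.of_frame frame rfl).source
  rw [exec_sketchAdd, keySum_setCell_keySum, Finset.range_add_one, Finset.filter_insert]
  simp only [NatExp.eval, value_keySum, value_val, keySum_setVar, val_setVar, key_setVar,
    var_setVar, hkey, hval, hsource, if_true, if_neg (show Reg.source ≠ Reg.row by decide)]
  obtain htκ | htκ := eq_or_ne (s.key t) κ
  · rw [if_pos htκ, if_pos htκ.symm, Finset.sum_insert (by simp), add_comm, htκ]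
    exact hs'.add (hi.val t ht)
  · rw [if_neg htκ, if_neg htκ.symm]
    exact hs'

theorem represents_keySum_exec_sumByKey (h : s.IsAbsorbing Q i j) (hi : s.HoldsFactor S c σ g i)
    {x : ℕ} (hx : x < Q.size i + Q.size j) :
    S.Represents c σ ((sumByKey.exec S K s).keySum (s.key x))
      (∑ r ∈ Finset.range (Q.size i) with s.key r = s.key x, Q.tupleSum g σ i r) := by
  rw [sumByKey, exec_block_cons, exec_block_cons, exec_block_nil]
  have hcleared : (clearKeySums.exec S K s).keySum (s.key x) = s.zero i :=
    keySum_exec_clearKeySums h hx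
  have frame := exec_frame S K clearKeySums s
  obtain ⟨s₁, hs₁⟩ : ∃ s₁, clearKeySums.exec S K s = s₁ := ⟨_, rfl⟩
  rw [hs₁] at frame hcleared ⊢
  have hkey : s₁.key = s.key := congrArg (fun a x => a x 0) (frame.arr Arr.key rfl)
  have hzero : s₁.zero = s.zero := congrArg (fun a i => a i 0) (frame.sk Sk.zeros rfl)
  have hval : s₁.val = s.val := frame.sk Sk.vals rfl
  rw [← hkey]
  exact represents_keySum_exec_addKeySums (h.of_frame frame rfl)
    ⟨hzero ▸ hi.zero, hval ▸ hi.val⟩ (hkey ▸ hcleared ▸ hi.zero)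

theorem exec_multiplyInto {b : Bool} (hb : s.arr Arr.plan (s.var Reg.step) 3 = if b then 1 else 0)
    (u v : SketchCell) : (multiplyInto u v).exec S K s =
      s.setCell u (if b then Option.map₂ S.mul (v.value s) (u.value s)
        else Option.map₂ S.mul (u.value s) (v.value s)) := by
  cases b <;> simp [multiplyInto, NatExp.eval, hb]

theorem val_exec_multiplyRows (h : s.IsAbsorbing Q i j) {b : Bool}
    (hb : s.arr Arr.plan (s.var Reg.step) 3 = if b then 1 else 0) (x r : ℕ) :
    (multiplyRows.exec S K s).val x r = if x = j ∧ r < Q.size j then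
        if b then Option.map₂ S.mul (s.keySum (s.key (Q.size i + r))) (s.val x r)
        else Option.map₂ S.mul (s.val x r) (s.keySum (s.key (Q.size i + r)))
      else s.val x r := by
  refine exec_loop_invariant (e := .sub (.var _) (.var _)) (n := Q.size j)
    (by simp [NatExp.eval, h.total, h.split]) (fun t s' => ∀ r, s'.val x r = if x = j ∧ r < t then
        if b then Option.map₂ S.mul (s.keySum (s.key (Q.size i + r))) (s.val x r)
        else Option.map₂ S.mul (s.val x r) (s.keySum (s.key (Q.size i + r)))
      else s.val x r) (by simp) (fun t ht s' frame hs' r => ?_) r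
  have frame' := frame.trans (frame_loop_setVar _ _ _ _ t)
  have h' := h.of_frame frame' rfl
  have hkey : s'.key = s.key := congrArg (fun a x => a x 0) (frame.arr Arr.key rfl)
  have hkeySum : s'.keySum = s.keySum := congrArg (fun a i => a i 0) (frame.sk Sk.keySums rfl)
  rw [exec_multiplyInto (b := b)
    (by rw [frame'.arr Arr.plan rfl, frame'.var Reg.step rfl, hb]), val_setCell_val]
  simp only [NatExp.eval, value_val, value_keySum, h'.target, h'.split, hkey, hkeySum, var_setVar,
    key_setVar, keySum_setVar, val_setVar, if_true, hs']
  by_cases hx : x = j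
  · subst hx
    obtain hlt | rfl | hlt := lt_trichotomy r t
    · simp [hlt, hlt.ne, hlt.trans (Nat.lt_succ_self t)]
    · simp [hs']
    · simp [hlt.ne', hlt.not_gt, hlt.not_ge]
  · simp [hx]

theorem zero_exec_combine (h : s.IsAbsorbing Q i j) {b : Bool}
    (hb : s.arr Arr.plan (s.var Reg.step) 3 = if b then 1 else 0) (x : ℕ) :
    (combine.exec S K s).zero x = if x = j then
        if b then Option.map₂ S.mul (s.zero i) (s.zero j)
        else Option.map₂ S.mul (s.zero j) (s.zero i)
      else s.zero x := by
  have frame : Frame (block [sumByKey, multiplyRows]) s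
      (multiplyRows.exec S K (sumByKey.exec S K s)) :=
    exec_frame S K (block [sumByKey, multiplyRows]) s
  rw [combine, exec_block_cons, exec_block_cons, exec_block_cons, exec_block_nil]
  generalize multiplyRows.exec S K (sumByKey.exec S K s) = s' at frame
  have h' := h.of_frame frame rfl
  have hzero : s'.zero = s.zero := congrArg (fun a i => a i 0) (frame.sk Sk.zeros rfl)
  rw [exec_multiplyInto (b := b) (by rw [frame.arr Arr.plan rfl, frame.var Reg.step rfl, hb]),
    zero_setCell_zero]
  simp only [NatExp.eval, value_zero, h'.source, h'.target, hzero]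

theorem val_exec_combine (h : s.IsAbsorbing Q i j) {b : Bool}
    (hb : s.arr Arr.plan (s.var Reg.step) 3 = if b then 1 else 0) (x r : ℕ) :
    (combine.exec S K s).val x r = if x = j ∧ r < Q.size j then
        if b then
          Option.map₂ S.mul ((sumByKey.exec S K s).keySum (s.key (Q.size i + r))) (s.val x r)
        else Option.map₂ S.mul (s.val x r) ((sumByKey.exec S K s).keySum (s.key (Q.size i + r)))
      else s.val x r := by
  have frame := exec_frame S K sumByKey s
  rw [combine, exec_block_cons, exec_block_cons, exec_block_cons, exec_block_nil]
  generalize sumByKey.exec S K s = s' at frame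
  have hkey : s'.key = s.key := congrArg (fun a x => a x 0) (frame.arr Arr.key rfl)
  have hval : s'.val = s.val := frame.sk Sk.vals rfl
  have htail := (exec_frame S K (multiplyInto (.zero (.var Reg.target)) (.zero (.var Reg.source)))
    (multiplyRows.exec S K s')).sk Sk.vals rfl
  rw [← hkey, ← hval, ← val_exec_multiplyRows (h.of_frame frame rfl)
    (by rw [frame.arr Arr.plan rfl, frame.var Reg.step rfl, hb])]
  exact congrArg (fun a => a x r) htail

theorem holdsFactor_exec_combine (h : s.IsAbsorbing Q i j)
    (hsep : Q.Separates σ.leaves τ.leaves i j) {b : Bool}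
    (hb : s.arr Arr.plan (s.var Reg.step) 3 = if b then 1 else 0)
    (hkey : ∀ x < Q.size i + Q.size j, ∀ y < Q.size i + Q.size j,
      (s.key x = s.key y ↔ Q.joinKey i j x = Q.joinKey i j y))
    (hi : s.HoldsFactor S c σ g i) (hj : s.HoldsFactor S c τ g j) :
    (combine.exec S K s).HoldsFactor S c (.join b σ τ) g j where
  zero := by
    have hzero : mulDir b (0 : S.Val) 0 = 0 := by simp [mulDir]
    rw [zero_exec_combine h hb, if_pos rfl, ← hzero]
    exact hi.zero.join hsep.disjoint b hj.zero
  val r hr := by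
    rw [val_exec_combine h hb, if_pos ⟨rfl, hr⟩, Q.tupleSum_join g b hsep r
      (fun r' => s.key r' = s.key (Q.size i + r)) fun r' hr' => ?_]
    · exact (represents_keySum_exec_sumByKey h hi (by omega)).join hsep.disjoint b (hj.val r hr)
    · rw [hkey r' (by omega) _ (by omega), JoinQuery.joinKey_eq_iff_agree hr']

theorem _root_.MachineState.HoldsFactor.exec_combine_of_ne (h : s.IsAbsorbing Q i j) {b : Bool}
    (hb : s.arr Arr.plan (s.var Reg.step) 3 = if b then 1 else 0) {x : Fin m} (hxj : x ≠ j)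
    (hx : s.HoldsFactor S c τ g x) : (combine.exec S K s).HoldsFactor S c τ g x where
  zero := by
    rw [zero_exec_combine h hb, if_neg (Fin.val_ne_of_ne hxj)]
    exact hx.zero
  val r hr := by
    rw [val_exec_combine h hb, if_neg fun hr => Fin.val_ne_of_ne hxj hr.1]
    exact hx.val r hr

end Prog

end

/-! ### The elimination steps -/

namespace Prog

/-- Sets the registers for the absorption of the current step. -/
def startAbsorb : Prog := block [
  assign Reg.source (.get Arr.plan (.var Reg.step) (.const 1)),
  assign Reg.target (.get Arr.plan (.var Reg.step) (.const 2)),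
  assign Reg.split (.get Arr.sizes (.var Reg.source) (.const 0)),
  assign Reg.total (.add (.var Reg.split) (.get Arr.sizes (.var Reg.target) (.const 0)))]

/-- Sorts the rows of the source and of the target by their keys, numbers the keys and combines the
factors. -/
def absorbRows : Prog := block [sortCodes, numberKeys, combine]

/-- Performs the current step if it is an absorption. -/
def eliminationStep : Prog :=
  ite (.get Arr.plan (.var Reg.step) (.const 0))
    (block [startAbsorb, countPasses, absorbRows]) skip

/-- Performs all elimination steps. -/
def eliminate : Prog := block [
  assign Reg.target (.const 0),
  loop Reg.step (.var Reg.stepCount) eliminationStep]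

end Prog

section

variable {m d : ℕ} {Q : JoinQuery m d} {ρ : MulTree m} {R : Type*} {S : DBSketch Q ρ R}
  {K : SketchCosts} {i j : Fin m} {s s' : MachineState R} {c : Fin m → ℕ} {σ τ : MulTree m}
  {g : Fin m → ℕ → S.Val} {plan : List (PlanStep m d)} {b : Bool} {p : Prog} {k : ℕ}
  {live : Finset (Fin m)} {cols' : Fin m → Finset (Fin d)} {tree : Fin m → MulTree m}

theorem PlanRun.of_nil {cols : Fin m → Finset (Fin d)} (h : PlanRun cols [] live cols' tree) :
    live = Finset.univ ∧ tree = .leaf := by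
  generalize hplan : [] = plan at h
  cases h with
  | start => exact ⟨rfl, rfl⟩
  | sumOut | absorb => simp at hplan

theorem PlanRun.of_append_singleton {cols : Fin m → Finset (Fin d)} {a : PlanStep m d}
    (h : PlanRun cols (plan ++ [a]) live cols' tree) :
    (∃ i c cols'', a = .sumOut i c ∧ PlanRun cols plan live cols'' tree) ∨
    ∃ i j b live' tree', a = .absorb i j b ∧ PlanRun cols plan live' cols' tree' ∧
      i ∈ live' ∧ j ∈ live' ∧ i ≠ j ∧ cols' i ⊆ cols' j ∧ live = live'.erase i ∧
      tree = Function.update tree' j (.join b (tree' i) (tree' j)) := by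
  generalize hplan : plan ++ [a] = plan' at h
  cases h with
  | start => simp at hplan
  | sumOut h i c =>
    obtain ⟨rfl, heq⟩ := List.append_inj' hplan rfl
    exact .inl ⟨i, c, _, by simpa using heq, h⟩
  | absorb h i j b hi hj hij hsub =>
    obtain ⟨rfl, heq⟩ := List.append_inj' hplan rfl
    exact .inr ⟨i, j, b, _, _, by simpa using heq, h, hi, hj, hij, hsub, rfl, rfl⟩

variable (Q plan) in
/-- The registers and arrays with the input of the algorithm are intact. -/
structure MachineState.HoldsInput (s : MachineState R) : Prop where
  tableCount : s.var Reg.tableCount = m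
  columnCount : s.var Reg.columnCount = d
  stepCount : s.var Reg.stepCount = plan.length
  sizes : ∀ i : Fin m, s.arr Arr.sizes i 0 = Q.size i
  incidence : ∀ (i : Fin m) (c : Fin d),
    s.arr Arr.incidence i c = if c ∈ Q.cols i then 1 else 0
  owner : ∀ c : Fin d, s.arr Arr.owner c 0 = Q.owner c
  plan : ∀ (k : ℕ) (hk : k < plan.length) (l : ℕ), s.arr Arr.plan k l = JoinQuery.planCode plan[k] l

/-- Whether a program leaves the input alone. -/
def Prog.keepsInput (p : Prog) : Bool :=
  !(p.writesVar Reg.tableCount || p.writesVar Reg.columnCount || p.writesVar Reg.stepCount ||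
    p.writesArr Arr.sizes || p.writesArr Arr.incidence || p.writesArr Arr.owner ||
    p.writesArr Arr.plan)

namespace MachineState

theorem holdsInput_initState : (Q.initState plan R).HoldsInput Q plan where
  tableCount := rfl
  columnCount := rfl
  stepCount := rfl
  sizes i := dif_pos i.2
  incidence i c := by simp [JoinQuery.initState]
  owner c := dif_pos c.2
  plan _ hk _ := dif_pos hk

theorem HoldsInput.of_frame (h : s.HoldsInput Q plan) (hf : Prog.Frame p s s')
    (hp : p.keepsInput) : s'.HoldsInput Q plan := by
  simp only [Prog.keepsInput, Bool.not_eq_true', Bool.or_eq_false_iff] at hp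
  obtain ⟨⟨⟨⟨⟨⟨htable, hcolumn⟩, hstep⟩, hsizes⟩, hincidence⟩, howner⟩, hplan⟩ := hp
  constructor
  · rw [hf.var _ htable, h.tableCount]
  · rw [hf.var _ hcolumn, h.columnCount]
  · rw [hf.var _ hstep, h.stepCount]
  · rw [hf.arr _ hsizes]
    exact h.sizes
  · rw [hf.arr _ hincidence]
    exact h.incidence
  · rw [hf.arr _ howner]
    exact h.owner
  · rw [hf.arr _ hplan]
    exact h.plan

theorem HoldsFactor.of_frame (h : s.HoldsFactor S c τ g i) (hf : Prog.Frame p s s')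
    (hval : p.writesSketch Sk.vals = false) (hzero : p.writesSketch Sk.zeros = false) :
    s'.HoldsFactor S c τ g i where
  zero := by
    have heq : s'.zero = s.zero := congrArg (fun a i => a i 0) (hf.sk Sk.zeros hzero)
    exact heq ▸ h.zero
  val := by
    have heq : s'.val = s.val := hf.sk Sk.vals hval
    exact heq ▸ h.val

/-- The machine holds the factors of the tables in `live`, and the register `target` contains one of
these tables. -/
structure HoldsFactors (S : DBSketch Q ρ R) (c : Fin m → ℕ) (g : Fin m → ℕ → S.Val)
    (live : Finset (Fin m)) (tree : Fin m → MulTree m) (s : MachineState R) : Prop where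
  target : ∃ i ∈ live, s.var Reg.target = i
  holdsFactor : ∀ i ∈ live, s.HoldsFactor S c (tree i) g i

end MachineState

namespace Prog

open MachineState

theorem isAbsorbing_exec_startAbsorb (h : s.HoldsInput Q plan) (hk : k < plan.length)
    (hstep : s.var Reg.step = k) (hplan : plan[k] = .absorb i j b) :
    (startAbsorb.exec S K s).IsAbsorbing Q i j := by
  have hsource : s.arr Arr.plan k 1 = i := by rw [h.plan k hk, hplan, JoinQuery.planCode]
  have htarget : s.arr Arr.plan k 2 = j := by rw [h.plan k hk, hplan, JoinQuery.planCode]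
  constructor <;>
    simp [startAbsorb, NatExp.eval, hstep, hsource, htarget, h.columnCount, h.sizes, h.incidence]

theorem key_exec_sortCodes_numberKeys (h : s.IsAbsorbing Q i j)
    (hpasses : Q.size i + Q.size j ≤ 2 ^ s.var Reg.passes) (s' : MachineState R)
    (hs' : numberKeys.exec S K (sortCodes.exec S K s) = s') : ∀ x < Q.size i + Q.size j,
      ∀ y < Q.size i + Q.size j, (s'.key x = s'.key y ↔ Q.joinKey i j x = Q.joinKey i j y) :=
  fun _ hx _ hy => hs' ▸ key_exec_numberKeys_eq_iff (h.of_frame (exec_frame S K sortCodes s) rfl)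
    (exec_sortCodes_isSorted h hpasses) hx hy

theorem exec_absorbRows (h : s.IsAbsorbing Q i j)
    (hpasses : Q.size i + Q.size j ≤ 2 ^ s.var Reg.passes)
    (hb : s.arr Arr.plan (s.var Reg.step) 3 = if b then 1 else 0)
    (hsep : Q.Separates (tree i).leaves (tree j).leaves i j)
    (hfactors : ∀ x ∈ live, s.HoldsFactor S c (tree x) g x) (hi : i ∈ live) (hj : j ∈ live) :
    ∀ x ∈ live.erase i, (absorbRows.exec S K s).HoldsFactor S c
      (Function.update tree j (.join b (tree i) (tree j)) x) g x := by
  have frame : Frame (block [sortCodes, numberKeys]) s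
      (numberKeys.exec S K (sortCodes.exec S K s)) :=
    exec_frame S K (block [sortCodes, numberKeys]) s
  have hkey := key_exec_sortCodes_numberKeys (S := S) (K := K) h hpasses _ rfl
  rw [absorbRows, exec_block_cons, exec_block_cons, exec_block_cons, exec_block_nil]
  generalize numberKeys.exec S K (sortCodes.exec S K s) = s' at frame hkey
  have h' := h.of_frame frame rfl
  have hb' : s'.arr Arr.plan (s'.var Reg.step) 3 = if b then 1 else 0 := by
    rw [frame.arr Arr.plan rfl, frame.var Reg.step rfl, hb]
  intro x hx
  obtain rfl | hxj := eq_or_ne x j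
  · rw [Function.update_self]
    exact holdsFactor_exec_combine h' hsep hb' hkey ((hfactors i hi).of_frame frame rfl rfl)
      ((hfactors x hj).of_frame frame rfl rfl)
  · rw [Function.update_of_ne hxj]
    exact ((hfactors x (Finset.mem_of_mem_erase hx)).of_frame frame rfl rfl).exec_combine_of_ne h'
      hb' hxj

theorem holdsFactors_exec_absorb (hf : s.HoldsFactors S c g live tree) (h : s.HoldsInput Q plan)
    (hk : k < plan.length) (hstep : s.var Reg.step = k) (hplan : plan[k] = .absorb i j b)
    (hsep : Q.Separates (tree i).leaves (tree j).leaves i j) (hi : i ∈ live) (hj : j ∈ live)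
    (hij : i ≠ j) : (eliminationStep.exec S K s).HoldsFactors S c g (live.erase i)
      (Function.update tree j (.join b (tree i) (tree j))) := by
  have hstart := isAbsorbing_exec_startAbsorb (S := S) (K := K) h hk hstep hplan
  have hcode (l : ℕ) : s.arr Arr.plan (s.var Reg.step) l = JoinQuery.planCode plan[k] l :=
    hstep ▸ h.plan k hk l
  have frame : Frame (block [startAbsorb, countPasses]) s
      (countPasses.exec S K (startAbsorb.exec S K s)) :=
    exec_frame S K (block [startAbsorb, countPasses]) s
  have frame' := exec_frame S K countPasses (startAbsorb.exec S K s)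
  have hpasses := (exec_countPasses (S := S) (K := K) (s := startAbsorb.exec S K s) _ rfl).1
  rw [eliminationStep, exec_ite, if_pos (by simp [NatExp.eval, hcode, hplan, JoinQuery.planCode]),
    exec_block_cons, exec_block_cons, exec_block_cons, exec_block_nil]
  generalize countPasses.exec S K (startAbsorb.exec S K s) = s' at frame frame' hpasses
  have h' := hstart.of_frame frame' rfl
  rw [hstart.total] at hpasses
  refine ⟨⟨j, Finset.mem_erase.2 ⟨hij.symm, hj⟩, ?_⟩, exec_absorbRows h' hpasses ?_ hsep
    (fun x hx => (hf.holdsFactor x hx).of_frame frame rfl rfl) hi hj⟩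
  · exact (h'.of_frame (exec_frame S K absorbRows s') rfl).target
  · rw [frame.arr Arr.plan rfl, frame.var Reg.step rfl, hcode, hplan, JoinQuery.planCode]

theorem holdsFactors_exec_eliminationStep (h : s.HoldsInput Q plan) (hk : k < plan.length)
    (hstep : s.var Reg.step = k)
    (hf : ∀ live cols' tree, PlanRun Q.cols (plan.take k) live cols' tree →
      s.HoldsFactors S c g live tree)
    (hrun : PlanRun Q.cols (plan.take (k + 1)) live cols' tree) :
    (eliminationStep.exec S K s).HoldsFactors S c g live tree := by
  rw [List.take_succ_eq_append_getElem hk] at hrun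
  obtain ⟨i, a, cols'', hplan, hrun'⟩ |
    ⟨i, j, b, live', tree', hplan, hrun', hi, hj, hij, hsub, rfl, rfl⟩ := hrun.of_append_singleton
  · have hcode : s.arr Arr.plan (s.var Reg.step) 0 = 0 := by
      rw [hstep, h.plan k hk, hplan, JoinQuery.planCode]
    rw [eliminationStep, exec_ite, if_neg (by simp [NatExp.eval, hcode]), exec_skip]
    exact hf _ _ _ hrun'
  · exact holdsFactors_exec_absorb (hf _ _ _ hrun') h hk hstep hplan
      (hrun'.separates hi hj hij hsub) hi hj hij

theorem holdsFactors_exec_eliminate (hm : 0 < m) (h : s.HoldsInput Q plan)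
    (hf : ∀ i, s.HoldsFactor S c (.leaf i) g i)
    (hrun : PlanRun Q.cols plan live cols' tree) :
    (eliminate.exec S K s).HoldsFactors S c g live tree := by
  have frame := exec_frame S K (assign Reg.target (.const 0)) s
  have htarget : ((assign Reg.target (.const 0)).exec S K s).var Reg.target = 0 := by
    simp [NatExp.eval]
  rw [eliminate, exec_block_cons, exec_block_cons, exec_block_nil]
  generalize (assign Reg.target (.const 0)).exec S K s = s₁ at frame htarget
  have h₁ := h.of_frame frame rfl
  rw [← List.take_length (l := plan)] at hrun
  refine exec_loop_invariant (e := .var _) h₁.stepCount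
    (fun k s' => ∀ live cols' tree, PlanRun Q.cols (plan.take k) live cols' tree →
      s'.HoldsFactors S c g live tree) ?_
    (fun k hk s' frame' hs' live cols' tree hrun => ?_) _ _ _ hrun
  · intro live cols' tree hrun
    obtain ⟨rfl, rfl⟩ := hrun.of_nil
    exact ⟨⟨⟨0, hm⟩, Finset.mem_univ _, htarget⟩, fun i _ => (hf i).of_frame frame rfl rfl⟩
  · have frame'' := frame_loop_setVar Reg.step (.var Reg.stepCount) eliminationStep s' k
    refine holdsFactors_exec_eliminationStep (h₁.of_frame (frame'.trans frame'') rfl) hk (by simp)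
      (fun live cols' tree hrun => ?_) hrun
    obtain ⟨⟨x, hx, htarget⟩, hfactors⟩ := hs' _ _ _ hrun
    exact ⟨⟨x, hx, by simpa using htarget⟩, fun y hy => ⟨(hfactors y hy).zero, (hfactors y hy).val⟩⟩

end Prog

end

/-! ### The sketches of the Kronecker factors -/

namespace Prog

/-- Whether the current column is assigned to the current table. -/
def isOwner : NatExp := .eq (.get Arr.owner (.var Reg.column) (.const 0)) (.var Reg.table)

/-- Sets register `factorColumns` to the number of columns of the factor of the current table. -/
def countFactorColumns : Prog :=
  ite isOwner (assign Reg.factorColumns (.var Reg.columnCount))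
    (assign Reg.factorColumns (.const 1))

/-- Writes the factor for the current row of the current table to the buffer. -/
def fillBuffer : Prog := seq clear (ite isOwner
  (block [read 0 (.var Reg.table) (.var Reg.row) (.var Reg.column),
    push (.var Reg.row) (.var Reg.column) 0])
  (block [one 0, push (.var Reg.row) (.const 0) 0]))

/-- Writes the sketch of the matrix in the buffer to cell `u`. -/
def sketchFactor (u : SketchCell) : Prog := sketch u (.var Reg.table) (.var Reg.factorColumns)

/-- Evaluates the sketches of the factors for all rows of the current table. -/
def sketchRows : Prog :=
  loop Reg.row (.get Arr.sizes (.var Reg.table) (.const 0))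
    (block [fillBuffer, sketchFactor (.val (.var Reg.table) (.var Reg.row))])

/-- Evaluates the sketches of the zero matrix and of the factors for the current table. -/
def sketchTable : Prog := block [
  countFactorColumns, clear, sketchFactor (.zero (.var Reg.table)), sketchRows]

/-- Evaluates the sketches of the zero matrix and of the factors for all tables. -/
def sketchTables : Prog := loop Reg.table (.var Reg.tableCount) sketchTable

end Prog

section

variable {m d : ℕ} {Q : JoinQuery m d} {ρ : MulTree m} {R : Type*} {S : DBSketch Q ρ R}
  {K : SketchCosts} {i j : Fin m} {s s' : MachineState R} {c : Fin m → ℕ} {σ τ : MulTree m}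
  {g : Fin m → ℕ → S.Val} {plan : List (PlanStep m d)} {b : Bool} {p : Prog} {k : Fin d}
  {live : Finset (Fin m)} {cols' : Fin m → Finset (Fin d)} {tree : Fin m → MulTree m}

/-- The registers are set for the evaluation of the sketches for table `i` and column `k`. -/
structure MachineState.IsSketching (Q : JoinQuery m d) (plan : List (PlanStep m d)) (k : Fin d)
    (i : Fin m) (s : MachineState R) : Prop extends s.HoldsInput Q plan where
  column : s.var Reg.column = k
  table : s.var Reg.table = i

namespace MachineState.IsSketching

theorem of_frame (h : s.IsSketching Q plan k i) (hf : Prog.Frame p s s') (hp : p.keepsInput)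
    (hcolumn : p.writesVar Reg.column = false) (htable : p.writesVar Reg.table = false) :
    s'.IsSketching Q plan k i where
  toHoldsInput := h.toHoldsInput.of_frame hf hp
  column := (hf.var _ hcolumn).trans h.column
  table := (hf.var _ htable).trans h.table

theorem eval_isOwner (h : s.IsSketching Q plan k i) : Prog.isOwner.eval s ≠ 0 ↔ i = Q.owner k := by
  simp [Prog.isOwner, NatExp.eval, h.column, h.table, h.owner, Fin.val_inj, eq_comm]

end MachineState.IsSketching

namespace Prog

open MachineState

theorem factorColumns_exec_countFactorColumns (h : s.IsSketching Q plan k i) :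
    (countFactorColumns.exec S K s).var Reg.factorColumns = Q.colCount k i := by
  rw [countFactorColumns, exec_ite, apply_ite MachineState.var, JoinQuery.colCount]
  simp only [h.eval_isOwner]
  split_ifs <;> simp [NatExp.eval, h.columnCount]

theorem buf_exec_fillBuffer (h : s.IsSketching Q plan k i) :
    (fillBuffer.exec S K s).buf = Q.factorBuffer k i (s.var Reg.row) := by
  have hclear : IsSketching Q plan k i { s with buf := [] } :=
    ⟨⟨h.tableCount, h.columnCount, h.stepCount, h.sizes, h.incidence, h.owner, h.plan⟩, h.column,
      h.table⟩
  change (exec S K (ite isOwner _ _) { s with buf := [] }).buf = _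
  rw [exec_ite, JoinQuery.factorBuffer]
  simp only [hclear.eval_isOwner]
  split_ifs <;> simp [NatExp.eval, h.table, h.column]

theorem exec_sketchFactor (h : s.IsSketching Q plan k i)
    (hcols : s.var Reg.factorColumns = Q.colCount k i) (u : SketchCell) :
    (sketchFactor u).exec S K s = s.setCell u
      (some (S.part i (Q.colCount k i) (Q.bufferMatrix i (Q.colCount k i) s.buf))) :=
  exec_sketch S K u _ _ s h.table hcols

theorem val_exec_sketchRows (h : s.IsSketching Q plan k i)
    (hcols : s.var Reg.factorColumns = Q.colCount k i) (x r : ℕ) :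
    (sketchRows.exec S K s).val x r =
      if x = i ∧ r < Q.size i then some (S.part i (Q.colCount k i) (Q.factor k i r))
      else s.val x r := by
  refine exec_loop_invariant (n := Q.size i) (e := .get _ _ _)
    (by simp [NatExp.eval, h.table, h.sizes]) (fun t s' => ∀ r,
      s'.val x r = if x = i ∧ r < t then some (S.part i (Q.colCount k i) (Q.factor k i r))
        else s.val x r) (by simp) (fun t ht s' frame hs' r => ?_) r
  have frame' := frame.trans (frame_loop_setVar Reg.row _ _ _ t)
  have fill := exec_frame S K fillBuffer (s'.setVar Reg.row t)
  have h₁ := h.of_frame frame' rfl rfl rfl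
  have h₂ := h₁.of_frame fill rfl rfl rfl
  have hbuf := buf_exec_fillBuffer (S := S) (K := K) h₁
  have hrow := fill.var Reg.row rfl
  have hval : ((fillBuffer.exec S K (s'.setVar Reg.row t)).val) = s'.val := fill.sk Sk.vals rfl
  rw [var_setVar, if_pos rfl] at hrow hbuf
  rw [exec_block_cons, exec_block_cons, exec_block_nil, exec_sketchFactor h₂
    (by rw [fill.var _ rfl, frame'.var _ rfl, hcols]), hbuf, val_setCell_val, hval, hs']
  simp only [NatExp.eval, h₂.table, hrow]
  by_cases hx : x = i
  · obtain hlt | rfl | hlt := lt_trichotomy r t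
    · simp [hx, hlt, hlt.ne, hlt.trans (Nat.lt_succ_self t)]
    · simp [hx, JoinQuery.factor]
    · simp [hx, hlt.ne', hlt.not_gt, hlt.not_ge]
  · simp [hx]

theorem zero_val_exec_sketchTable (h : s.IsSketching Q plan k i) (x : ℕ) :
    (sketchTable.exec S K s).zero x =
        (if x = i then some (S.part i (Q.colCount k i) 0) else s.zero x) ∧
      ∀ r, (sketchTable.exec S K s).val x r =
        if x = i ∧ r < Q.size i then some (S.part i (Q.colCount k i) (Q.factor k i r))
        else s.val x r := by
  have frame := exec_frame S K (seq countFactorColumns clear) s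
  have hcols : ((seq countFactorColumns clear).exec S K s).var Reg.factorColumns = Q.colCount k i :=
    factorColumns_exec_countFactorColumns h
  have hbuf : ((seq countFactorColumns clear).exec S K s).buf = [] := rfl
  change (sketchRows.exec S K ((sketchFactor _).exec S K
    ((seq countFactorColumns clear).exec S K s))).zero x = _ ∧ ∀ r, (sketchRows.exec S K
      ((sketchFactor _).exec S K ((seq countFactorColumns clear).exec S K s))).val x r = _
  generalize (seq countFactorColumns clear).exec S K s = s₁ at frame hcols hbuf
  have h₁ := h.of_frame frame rfl rfl rfl
  have frame' := exec_frame S K (sketchFactor (.zero (.var Reg.table))) s₁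
  have h₂ := h₁.of_frame frame' rfl rfl rfl
  have hzero := congrArg (fun a => a x 0) ((exec_frame S K sketchRows
    ((sketchFactor (.zero (.var Reg.table))).exec S K s₁)).sk Sk.zeros rfl)
  have hval : s₁.val = s.val := frame.sk Sk.vals rfl
  have hval' : ((sketchFactor (.zero (.var Reg.table))).exec S K s₁).val = s₁.val :=
    frame'.sk Sk.vals rfl
  have hzero₁ : s₁.zero = s.zero := congrArg (fun a i => a i 0) (frame.sk Sk.zeros rfl)
  refine ⟨hzero.trans ?_, fun r => ?_⟩
  · change MachineState.zero _ x = _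
    rw [exec_sketchFactor h₁ hcols, hbuf, JoinQuery.bufferMatrix_nil, zero_setCell_zero, hzero₁]
    simp only [NatExp.eval, h₁.table]
  · rw [val_exec_sketchRows h₂ (by rw [frame'.var _ rfl, hcols]), hval', hval]

theorem holdsFactor_exec_sketchTables (h : s.HoldsInput Q plan) (hcolumn : s.var Reg.column = k)
    (i : Fin m) : (sketchTables.exec S K s).HoldsFactor S (Q.colCount k) (.leaf i)
      (S.factorVal k) i := by
  refine exec_loop_invariant (e := .var _) h.tableCount (fun t s' => ∀ i : Fin m, (i : ℕ) < t →
    s'.HoldsFactor S (Q.colCount k) (.leaf i) (S.factorVal k) i) (by simp)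
    (fun t ht s' frame hs' i hi => ?_) i i.2
  have frame' := frame.trans (frame_loop_setVar Reg.table _ _ _ t)
  have h' : (s'.setVar Reg.table t).IsSketching Q plan k ⟨t, ht⟩ :=
    ⟨h.of_frame frame' rfl, (frame'.var _ rfl).trans hcolumn, by simp⟩
  obtain ⟨hzero, hval⟩ := zero_val_exec_sketchTable (S := S) (K := K) h' i
  obtain hlt | hit := Nat.lt_succ_iff_lt_or_eq.1 hi
  · rw [if_neg hlt.ne] at hzero
    constructor
    · exact hzero ▸ (hs' i hlt).zero
    · intro r hr
      rw [hval, if_neg fun hir => hlt.ne hir.1]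
      exact (hs' i hlt).val r hr
  · obtain rfl : i = ⟨t, ht⟩ := Fin.ext hit
    rw [if_pos rfl] at hzero
    constructor
    · exact hzero ▸ S.represents_part_zero _
    · intro r hr
      rw [hval, if_pos ⟨rfl, hr⟩, Q.tupleSum_leaf _ _ hr]
      exact S.represents_part _ _

end Prog

end

/-! ### The sum over the columns -/

/-- The cell for the sketch of the join matrix. -/
def SketchCell.out : SketchCell := ⟨Sk.out, .const 0, .const 0⟩

namespace Prog

/-- Adds the sketch of the zero matrix to the output, which is empty before the first column. -/
def startColumn : Prog :=
  ite (.var Reg.column) (sketchAdd .out .out (.zero (.var Reg.target)))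
    (copy .out (.zero (.var Reg.target)))

/-- Adds the factor of the last remaining table, summed over the rows, to the output. -/
def addRows : Prog :=
  loop Reg.row (.get Arr.sizes (.var Reg.target) (.const 0))
    (sketchAdd .out .out (.val (.var Reg.target) (.var Reg.row)))

/-- Adds the contribution of the current column to the output. -/
def addColumn : Prog := block [sketchTables, eliminate, startColumn, addRows]

/-- Evaluates the sketch of the join matrix. -/
def sketchJoin : Prog := loop Reg.column (.var Reg.columnCount) addColumn

end Prog

section

variable {m d : ℕ} {Q : JoinQuery m d} {ρ : MulTree m} {R : Type*} {S : DBSketch Q ρ R}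
  {K : SketchCosts} {i : Fin m} {s : MachineState R} {plan : List (PlanStep m d)} {k : Fin d}

theorem DBSketch.sum_tupleSum_eq_columnSum (hρ : ρ.leaves = Finset.univ) (k : Fin d) (i : Fin m) :
    ∑ r ∈ Finset.range (Q.size i), Q.tupleSum (S.factorVal k) ρ i r = S.columnSum k := by
  have hsum := Q.sum_tupleSum (S.factorVal k) (hρ ▸ Finset.mem_univ i : i ∈ ρ.leaves) fun _ => True
  rw [Finset.filter_true, Finset.filter_true, hρ, Q.sum_tuples_univ] at hsum
  exact hsum

namespace MachineState

/-- The sketch in the output cell. -/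
def out (s : MachineState R) : Option R := s.sk Sk.out 0 0

@[simp] theorem value_out : SketchCell.out.value s = s.out := rfl

@[simp] theorem out_setCell_out (v : Option R) : (s.setCell .out v).out = v := by
  simp [out, SketchCell.out, NatExp.eval]

/-- The output is the sum of `x` and the sketch of the zero matrix. -/
def HoldsSum (S : DBSketch Q ρ R) (x : S.Val) (s : MachineState R) : Prop :=
  ∃ a, s.out = some a ∧ S.val a = S.val (S.F 0) + x

theorem HoldsSum.exec_sketchAdd {x y : S.Val} (h : s.HoldsSum S x) {u : SketchCell}
    (hu : S.Represents (Q.colCount k) ρ (u.value s) y) :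
    ((Prog.sketchAdd .out .out u).exec S K s).HoldsSum S (x + y) := by
  obtain ⟨a, ha, hax⟩ := h
  obtain ⟨b, hb, hby⟩ := hu.F_zero_add
  refine ⟨S.add a b, ?_, ?_⟩
  · rw [Prog.exec_sketchAdd, out_setCell_out, value_out, ha, hb, Option.map₂_some_some]
  · rw [S.val_add, hax, add_right_comm, hby, add_right_comm, add_assoc]

end MachineState

namespace Prog

open MachineState

theorem holdsSum_exec_startColumn (htarget : s.var Reg.target = i)
    (hzero : S.Represents (Q.colCount k) ρ (s.zero i) 0) {x : S.Val}
    (hfirst : s.var Reg.column = 0 → x = 0) (hnext : s.var Reg.column ≠ 0 → s.HoldsSum S x) :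
    (startColumn.exec S K s).HoldsSum S x := by
  have hvalue : (SketchCell.zero (.var Reg.target)).value s = s.zero i :=
    congrArg s.zero htarget
  rw [startColumn, exec_ite]
  split_ifs with hcolumn
  · exact add_zero x ▸ (hnext hcolumn).exec_sketchAdd (hvalue ▸ hzero)
  · refine ⟨S.F 0, ?_, ?_⟩
    · rw [exec_copy, out_setCell_out, hvalue, hzero.eq_F_zero]
    · rw [hfirst (not_not.1 hcolumn), add_zero]

theorem holdsSum_exec_addRows (h : s.HoldsInput Q plan) (htarget : s.var Reg.target = i)
    (hfactor : s.HoldsFactor S (Q.colCount k) ρ (S.factorVal k) i) {x : S.Val}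
    (hx : s.HoldsSum S x) : (addRows.exec S K s).HoldsSum S
      (x + ∑ r ∈ Finset.range (Q.size i), Q.tupleSum (S.factorVal k) ρ i r) := by
  refine exec_loop_invariant (e := .get _ _ _) (n := Q.size i)
    (by simp [NatExp.eval, htarget, h.sizes])
    (fun t s' => s'.HoldsSum S (x + ∑ r ∈ Finset.range t, Q.tupleSum (S.factorVal k) ρ i r))
    (by simpa using hx) fun t ht s' frame hs' => ?_
  rw [Finset.sum_range_succ, ← add_assoc]
  have hval : s'.val = s.val := frame.sk Sk.vals rfl
  refine HoldsSum.exec_sketchAdd (k := k) (s := s'.setVar Reg.row t) hs' ?_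
  simp only [value_val, NatExp.eval, val_setVar, var_setVar, if_true, hval,
    if_neg (show Reg.target ≠ Reg.row by decide), frame.var Reg.target rfl, htarget]
  exact hfactor.val t ht

theorem holdsSum_exec_addColumn (hplan : Q.IsMulOrder plan ρ) (h : s.HoldsInput Q plan)
    (hcolumn : s.var Reg.column = k) {x : S.Val} (hfirst : (k : ℕ) = 0 → x = 0)
    (hnext : (k : ℕ) ≠ 0 → s.HoldsSum S x) :
    (addColumn.exec S K s).HoldsSum S (x + S.columnSum k) := by
  obtain ⟨i, cols', tree, hrun, -, rfl⟩ := hplan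
  have hleaves : (tree i).leaves = Finset.univ := Finset.eq_univ_of_forall fun a => by
    obtain ⟨x, hx, ha⟩ := hrun.exists_mem_leaves a
    rwa [← Finset.mem_singleton.1 hx]
  rw [← DBSketch.sum_tupleSum_eq_columnSum hleaves k i]
  have frame : Frame (block [sketchTables, eliminate]) s
      (eliminate.exec S K (sketchTables.exec S K s)) :=
    exec_frame S K (block [sketchTables, eliminate]) s
  obtain ⟨⟨a, ha, htarget⟩, hfactors⟩ := holdsFactors_exec_eliminate (K := K) i.pos
    (h.of_frame (exec_frame S K sketchTables s) rfl) (holdsFactor_exec_sketchTables h hcolumn) hrun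
  obtain rfl := Finset.mem_singleton.1 ha
  rw [addColumn, exec_block_cons, exec_block_cons, exec_block_cons, exec_block_cons, exec_block_nil]
  generalize eliminate.exec S K (sketchTables.exec S K s) = s₁ at frame htarget hfactors
  have hcolumn₁ : s₁.var Reg.column = k := (frame.var _ rfl).trans hcolumn
  have hout : s₁.out = s.out := congrArg (fun a => a 0 0) (frame.sk Sk.out rfl)
  have frame' := exec_frame S K startColumn s₁
  refine holdsSum_exec_addRows ((h.of_frame frame rfl).of_frame frame' rfl)
    ((frame'.var _ rfl).trans htarget) ((hfactors a ha).of_frame frame' rfl rfl) ?_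
  refine holdsSum_exec_startColumn htarget (hfactors a ha).zero (hcolumn₁ ▸ hfirst) fun hk => ?_
  rw [HoldsSum, hout]
  exact hnext (hcolumn₁ ▸ hk)

theorem out_exec_sketchJoin (hd : 0 < d) (hplan : Q.IsMulOrder plan ρ) :
    (sketchJoin.exec S K (Q.initState plan R)).out = some (S.F Q.joinMatrix) := by
  have holdsSum := exec_loop_invariant (S := S) (K := K) (x := Reg.column) (p := addColumn)
    (e := .var _) (holdsInput_initState (Q := Q) (plan := plan) (R := R)).columnCount
    (fun t s => t ≠ 0 →
      s.HoldsSum S (∑ k ∈ Finset.univ.filter (fun k : Fin d => (k : ℕ) < t), S.columnSum k))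
    (fun h => absurd rfl h) fun t ht s frame hs _ => ?_
  · obtain ⟨a, ha, hsum⟩ := holdsSum hd.ne'
    simp only [Fin.is_lt, Finset.filter_true, S.F_joinMatrix_eq_sum] at hsum
    rw [sketchJoin, ha, S.val_injective hsum]
  · have hinsert : Finset.univ.filter (fun k : Fin d => (k : ℕ) < t + 1) =
        insert ⟨t, ht⟩ (Finset.univ.filter fun k : Fin d => (k : ℕ) < t) := by
      ext k
      simp [Fin.ext_iff, le_iff_eq_or_lt]
    rw [hinsert, Finset.sum_insert (by simp), add_comm]
    refine holdsSum_exec_addColumn hplan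
      (holdsInput_initState.of_frame (frame.trans (frame_loop_setVar _ _ _ _ t)) rfl)
      (k := ⟨t, ht⟩) (by simp) ?_ hs
    rintro (rfl : t = 0)
    simp

end Prog

end

/-! ### The running time -/

section

variable {m d : ℕ} {Q : JoinQuery m d} {ρ : MulTree m} {R : Type*} {S : DBSketch Q ρ R}
  {K : SketchCosts} {i j : Fin m} {s : MachineState R} {plan : List (PlanStep m d)} {k : ℕ}
  {a : Fin d} {live : Finset (Fin m)} {cols' : Fin m → Finset (Fin d)} {tree : Fin m → MulTree m}

namespace Prog

section timeBound

variable (b : NatExp → ℕ)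

theorem timeBound_compareKeys :
    compareKeys.timeBound K b = 31 + 28 * b (.var Reg.columnCount) := by
  simp only [compareKeys, decode, compareColumns, compareEntries, block, timeBound, NatExp.cost,
    Nat.reduceAdd, max_def, Nat.reduceLeDiff, if_true, if_false]
  ring

theorem timeBound_sortCodes : sortCodes.timeBound K b = 7 + 5 * b (.var Reg.total) +
    b (.var Reg.passes) * (19 + b (.var Reg.total) * (104 + 28 * b (.var Reg.columnCount))) := by
  simp only [sortCodes, listCodes, mergePass, resetBlocks, mergeStep, startBlocks, chooseBlock,
    compareCells, checkBlockEnds, takeCode, copyMerged, block, timeBound, timeBound_compareKeys,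
    NatExp.min, NatExp.cost, Nat.reduceAdd, max_def, Nat.reduceLeDiff, if_true, if_false]
  ring

theorem timeBound_numberKeys : numberKeys.timeBound K b =
    2 + b (.var Reg.total) * (58 + 28 * b (.var Reg.columnCount)) := by
  simp only [numberKeys, numberKey, compareCells, block, timeBound, timeBound_compareKeys,
    NatExp.cost, Nat.reduceAdd, max_def, Nat.reduceLeDiff, if_false]
  ring

theorem timeBound_combine : combine.timeBound K b =
    21 + K.mul + 8 * b (.var Reg.total) + b (.var Reg.split) * (12 + K.add) +
      b (.sub (.var Reg.total) (.var Reg.split)) * (16 + K.mul) := by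
  simp only [combine, sumByKey, clearKeySums, addKeySums, multiplyRows, multiplyInto,
    SketchCell.keySum, SketchCell.val, SketchCell.zero, SketchCell.cost, block, timeBound,
    NatExp.cost, Nat.reduceAdd, max_self]
  ring

theorem timeBound_countPasses : countPasses.timeBound K b = 7 + 16 * b (.var Reg.total) := by
  simp only [countPasses, block, timeBound, NatExp.cost, Nat.reduceAdd, max_def, Nat.reduceLeDiff,
    if_false]
  ring

end timeBound

end Prog

variable (Q K) in
/-- The order of the time for the absorption of one table. -/
def JoinQuery.absorbTime : ℕ :=
  (K.mul + K.add) * (d * Q.maxSize * (1 + Nat.log 2 Q.maxSize))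

theorem JoinQuery.size_le_maxSize (i : Fin m) : Q.size i ≤ Q.maxSize :=
  Finset.le_sup (Finset.mem_univ i)

namespace Prog

open MachineState

theorem time_absorbRows_le (h : s.IsAbsorbing Q i j) (hd : 0 < d) (hn : 0 < Q.maxSize)
    (hadd : 0 < K.add) (hpasses : s.var Reg.passes ≤ Nat.log 2 Q.maxSize + 2) :
    absorbRows.time S K s ≤ 2000 * Q.absorbTime K := by
  refine (time_le_timeBound_eval rfl rfl s).trans ?_
  simp only [absorbRows, block, timeBound, timeBound_sortCodes, timeBound_numberKeys,
    timeBound_combine, NatExp.eval, h.total, h.split, h.columnCount, Nat.add_sub_cancel_left]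
  have hi := Q.size_le_maxSize i
  have hj := Q.size_le_maxSize j
  have hnd : Q.maxSize ≤ d * Q.maxSize := Nat.le_mul_of_pos_left _ hd
  rw [JoinQuery.absorbTime]
  generalize Nat.log 2 Q.maxSize = L at *
  generalize Q.maxSize = n at *
  have hL : L ≤ n * L := Nat.le_mul_of_pos_left _ hn
  have hnL : n * L ≤ d * n * L := Nat.mul_le_mul_right _ hnd
  have hK : d * n * (1 + L) ≤ K.add * (d * n * (1 + L)) := Nat.le_mul_of_pos_left _ hadd
  have hKadd : K.add * n ≤ K.add * (d * n * (1 + L)) := by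
    gcongr
    linarith
  have hKmul : K.mul * n ≤ K.mul * (d * n * (1 + L)) := by
    gcongr
    linarith
  have hKmul' : K.mul ≤ K.mul * n := Nat.le_mul_of_pos_right _ hn
  calc _ ≤ 7 + 5 * (n + n) + (L + 2) * (19 + (n + n) * (104 + 28 * d)) +
        (2 + (n + n) * (58 + 28 * d) + (21 + K.mul + 8 * (n + n) + n * (12 + K.add) +
          n * (16 + K.mul) + 1)) := by
        gcongr
    _ ≤ _ := by linarith

end Prog

theorem JoinQuery.mul_maxSize_le_absorbTime (hadd : 0 < K.add) :
    d * Q.maxSize ≤ Q.absorbTime K := by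
  rw [absorbTime]
  calc d * Q.maxSize ≤ d * Q.maxSize * (1 + Nat.log 2 Q.maxSize) :=
        Nat.le_mul_of_pos_right _ (by omega)
    _ ≤ _ := Nat.le_mul_of_pos_left _ (by omega)

theorem JoinQuery.add_mul_maxSize_le_absorbTime (hd : 0 < d) :
    K.add * Q.maxSize ≤ Q.absorbTime K := by
  rw [absorbTime, mul_comm d, mul_assoc]
  exact Nat.mul_le_mul (Nat.le_add_left _ _)
    (Nat.le_mul_of_pos_right _ (Nat.mul_pos hd (by omega)))

theorem PlanStep.sum_map_isAbsorb_ite_le (A B : ℕ) (plan : List (PlanStep m d)) :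
    (plan.map fun a => 1 + if a.isAbsorb then A else B).sum ≤
      plan.length * (1 + B) + plan.countP isAbsorb * A := by
  induction plan with
  | nil => simp
  | cons a plan ih =>
    simp only [List.map_cons, List.sum_cons, List.length_cons, List.countP_cons]
    split_ifs <;> linarith

namespace Prog

open MachineState

theorem passes_exec_countPasses_le (h : s.IsAbsorbing Q i j) :
    (countPasses.exec S K s).var Reg.passes ≤ Nat.log 2 Q.maxSize + 2 := by
  have hpow := (exec_countPasses (S := S) (K := K) (s := s) _ rfl).2
  rw [h.total] at hpow
  have hi := Q.size_le_maxSize i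
  have hj := Q.size_le_maxSize j
  have hlog := Nat.lt_pow_succ_log_self one_lt_two Q.maxSize
  refine Nat.lt_succ_iff.1 ((Nat.pow_lt_pow_iff_right one_lt_two).1 (hpow.trans_lt ?_))
  rw [pow_succ, pow_succ]
  omega

theorem time_eliminationStep_le (h : s.HoldsInput Q plan) (hk : k < plan.length)
    (hstep : s.var Reg.step = k) (hd : 0 < d) (hn : 0 < Q.maxSize) (hadd : 0 < K.add) :
    eliminationStep.time S K s ≤ if plan[k].isAbsorb then 3000 * Q.absorbTime K else 5 := by
  have hcode := h.plan k hk 0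
  rw [eliminationStep, time_ite]
  cases hplan : plan[k] with
  | sumOut =>
    rw [hplan, JoinQuery.planCode] at hcode
    simp [NatExp.eval, NatExp.cost, hstep, hcode, PlanStep.isAbsorb, time, run]
  | absorb i j b =>
    have h₁ := isAbsorbing_exec_startAbsorb (S := S) (K := K) h hk hstep hplan
    rw [hplan, JoinQuery.planCode] at hcode
    have hrows := time_absorbRows_le (S := S) (h₁.of_frame (exec_frame S K countPasses _) rfl)
      hd hn hadd (passes_exec_countPasses_le h₁)
    have hcount := time_le_timeBound_eval (S := S) (K := K) (p := countPasses) rfl rfl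
      (startAbsorb.exec S K s)
    rw [timeBound_countPasses, NatExp.eval, h₁.total] at hcount
    have hstart : startAbsorb.time S K s = 19 := rfl
    have hi := Q.size_le_maxSize i
    have hj := Q.size_le_maxSize j
    have hnd : Q.maxSize ≤ d * Q.maxSize := Nat.le_mul_of_pos_left _ hd
    have habsorb := Q.mul_maxSize_le_absorbTime hadd
    simp only [NatExp.eval, NatExp.cost, hstep, hcode, PlanStep.isAbsorb, time_block_cons,
      time_block_nil, if_true, ne_eq, one_ne_zero, not_false_eq_true]
    omega

theorem time_eliminate_le (h : s.HoldsInput Q plan) (hrun : PlanRun Q.cols plan live cols' tree)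
    (hm : 0 < m) (hd : 0 < d) (hn : 0 < Q.maxSize) (hadd : 0 < K.add) :
    eliminate.time S K s ≤ 3017 * (m * Q.absorbTime K) := by
  have hstart : (assign Reg.target (.const 0)).time S K s = 2 := rfl
  have h₁ := h.of_frame (exec_frame S K (assign Reg.target (.const 0)) s) rfl
  have hloop := time_loop_le (S := S) (K := K) (x := Reg.step) (e := .var Reg.stepCount)
    (p := eliminationStep) (s := (assign Reg.target (.const 0)).exec S K s)
    (fun k => if hk : k < plan.length then
      if plan[k].isAbsorb then 3000 * Q.absorbTime K else 5 else 0) fun k hk s' frame hstep => by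
    have hlt : k < plan.length := hk.trans_eq h₁.stepCount
    rw [dif_pos hlt]
    exact time_eliminationStep_le (h₁.of_frame frame rfl) hlt hstep hd hn hadd
  rw [NatExp.eval, h₁.stepCount, Finset.sum_range] at hloop
  simp only [Fin.is_lt, dite_true] at hloop
  rw [Fin.sum_univ_fun_getElem plan
    fun a => 1 + if a.isAbsorb then 3000 * Q.absorbTime K else 5] at hloop
  have hsum := PlanStep.sum_map_isAbsorb_ite_le (3000 * Q.absorbTime K) 5 plan
  have hlength := (Nat.le_add_right _ _).trans hrun.length_add_sum_card_le
  have hcount : plan.countP PlanStep.isAbsorb ≤ m := by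
    have := hrun.countP_isAbsorb_add_card_live
    omega
  have hmd : m * d ≤ m * Q.absorbTime K := Nat.mul_le_mul_left _
    ((Nat.le_mul_of_pos_right _ hn).trans (Q.mul_maxSize_le_absorbTime hadd))
  have hmm : m ≤ m * d := Nat.le_mul_of_pos_right _ hd
  have habsorb := Nat.mul_le_mul_right (3000 * Q.absorbTime K) hcount
  rw [eliminate, time_block_cons, time_block_cons, time_block_nil, hstart]
  rw [NatExp.cost] at hloop
  linarith

theorem length_buf_exec_fillBuffer (s : MachineState R) :
    (fillBuffer.exec S K s).buf.length = 1 := by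
  change (exec S K (ite isOwner _ _) _).buf.length = 1
  rw [exec_ite]
  split_ifs <;> rfl

theorem time_sketchRows_le (h : s.IsSketching Q plan a i) :
    sketchRows.time S K s ≤ 4 + Q.maxSize * (24 + K.sketch) := by
  refine (time_loop_le (fun _ => 23 + K.sketch) fun r _ s' _ _ => ?_).trans ?_
  · have hfill : fillBuffer.time S K s' ≤ 15 := time_le_timeBound_eval rfl rfl s'
    have hsketch : (sketchFactor (.val (.var Reg.table) (.var Reg.row))).time S K
        (fillBuffer.exec S K s') ≤ 5 + (fillBuffer.exec S K s').buf.length * (1 + K.sketch) :=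
      time_sketch_le S K _ _ _ _
    rw [length_buf_exec_fillBuffer] at hsketch
    rw [time_block_cons, time_block_cons, time_block_nil]
    omega
  · rw [Finset.sum_const, Finset.card_range, smul_eq_mul]
    rw [NatExp.eval, NatExp.eval, NatExp.eval, h.table, h.sizes, ← add_assoc]
    exact Nat.add_le_add_left (Nat.mul_le_mul_right _ (Q.size_le_maxSize i)) 4

theorem time_sketchTable_le (h : s.IsSketching Q plan a i) :
    sketchTable.time S K s ≤ 19 + Q.maxSize * (24 + K.sketch) := by
  rw [sketchTable, time_block_cons, time_block_cons, time_block_cons, time_block_cons,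
    time_block_nil]
  have frame : Frame (block [countFactorColumns, clear, sketchFactor (.zero (.var Reg.table))]) s
      ((sketchFactor (.zero (.var Reg.table))).exec S K
        (clear.exec S K (countFactorColumns.exec S K s))) := exec_frame S K _ s
  have hcount : countFactorColumns.time S K s ≤ 8 := time_le_timeBound_eval rfl rfl s
  have hclear : clear.time S K (countFactorColumns.exec S K s) = 1 := rfl
  have hzero : (sketchFactor (.zero (.var Reg.table))).time S K
      (clear.exec S K (countFactorColumns.exec S K s)) ≤ 5 + 0 * (1 + K.sketch) :=
    time_sketch_le S K _ _ _ _
  have hrows := time_sketchRows_le (S := S) (K := K) (h.of_frame frame rfl rfl rfl)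
  linarith

theorem time_sketchTables_le (h : s.HoldsInput Q plan) (hcolumn : s.var Reg.column = a) :
    sketchTables.time S K s ≤ 2 + m * (20 + Q.maxSize * (24 + K.sketch)) := by
  refine (time_loop_le (fun _ => 19 + Q.maxSize * (24 + K.sketch))
    fun t ht s' frame htable => ?_).trans ?_
  · have hlt : t < m := ht.trans_eq h.tableCount
    exact time_sketchTable_le (a := a) (i := ⟨t, hlt⟩)
      ⟨h.of_frame frame rfl, (frame.var _ rfl).trans hcolumn, htable⟩
  · rw [Finset.sum_const, Finset.card_range, smul_eq_mul, NatExp.eval, h.tableCount, NatExp.cost]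
    linarith

theorem time_startColumn_le (s : MachineState R) : startColumn.time S K s ≤ 9 + K.add := by
  refine (time_le_timeBound_eval rfl rfl s).trans ?_
  simp only [startColumn, timeBound, SketchCell.out, SketchCell.zero, SketchCell.cost, NatExp.cost]
  omega

theorem time_addRows_le (h : s.HoldsInput Q plan) (htarget : s.var Reg.target = i) :
    addRows.time S K s ≤ 4 + Q.maxSize * (8 + K.add) := by
  refine (time_le_timeBound_eval rfl rfl s).trans ?_
  rw [addRows, timeBound, NatExp.eval, NatExp.eval, NatExp.eval, htarget, h.sizes]
  simp only [timeBound, SketchCell.out, SketchCell.val, SketchCell.cost, NatExp.cost, ← add_assoc]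
  exact Nat.add_le_add_left (Nat.mul_le_mul_right _ (Q.size_le_maxSize i)) 4

theorem time_addColumn_le (hplan : Q.IsMulOrder plan ρ) (h : s.HoldsInput Q plan)
    (hcolumn : s.var Reg.column = a) (hn : 0 < Q.maxSize) (hadd : 0 < K.add) :
    addColumn.time S K s ≤ 3100 * (m * Q.absorbTime K) + K.sketch * m * Q.maxSize := by
  obtain ⟨i, cols', tree, hrun, -, -⟩ := hplan
  have h₁ := h.of_frame (exec_frame S K sketchTables s) rfl
  obtain ⟨⟨x, -, htarget⟩, -⟩ := holdsFactors_exec_eliminate (K := K) i.pos h₁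
    (holdsFactor_exec_sketchTables (S := S) h hcolumn) hrun
  have frame : Frame (block [sketchTables, eliminate]) s
      (eliminate.exec S K (sketchTables.exec S K s)) :=
    exec_frame S K (block [sketchTables, eliminate]) s
  have hsketch := time_sketchTables_le (S := S) (K := K) h hcolumn
  have heliminate := time_eliminate_le (S := S) (K := K) h₁ hrun i.pos a.pos hn hadd
  rw [addColumn, time_block_cons, time_block_cons, time_block_cons, time_block_cons, time_block_nil]
  generalize eliminate.exec S K (sketchTables.exec S K s) = s₁ at frame htarget
  have hstart := time_startColumn_le (S := S) (K := K) s₁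
  have frame' := exec_frame S K startColumn s₁
  have hrows := time_addRows_le (S := S) (K := K) ((h.of_frame frame rfl).of_frame frame' rfl)
    ((frame'.var _ rfl).trans htarget)
  have hW : d * Q.maxSize ≤ Q.absorbTime K := Q.mul_maxSize_le_absorbTime hadd
  have hKW : K.add * Q.maxSize ≤ Q.absorbTime K := Q.add_mul_maxSize_le_absorbTime a.pos
  have hnd : Q.maxSize ≤ d * Q.maxSize := Nat.le_mul_of_pos_left _ a.pos
  have hKn : K.add ≤ K.add * Q.maxSize := Nat.le_mul_of_pos_right _ hn
  have hmW : Q.absorbTime K ≤ m * Q.absorbTime K := Nat.le_mul_of_pos_left _ i.pos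
  have hmn : m * Q.maxSize ≤ m * Q.absorbTime K := Nat.mul_le_mul_left _ (hnd.trans hW)
  have hm : m ≤ m * Q.maxSize := Nat.le_mul_of_pos_right _ hn
  linarith [i.pos]

theorem time_sketchJoin_le (hd : 0 < d) (hn : 0 < Q.maxSize) (hplan : Q.IsMulOrder plan ρ)
    (hadd : 0 < K.add) : sketchJoin.time S K (Q.initState plan R) ≤
      4000 * (m * (K.mul + K.add) * Q.faqTime) + K.sketch * m * Q.maxSize * d := by
  have hm : 0 < m := hplan.choose.pos
  have hinput := holdsInput_initState (Q := Q) (plan := plan) (R := R)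
  refine (time_loop_le (e := .var Reg.columnCount)
    (fun _ => 3100 * (m * Q.absorbTime K) + K.sketch * m * Q.maxSize)
    fun k (hk : k < d) s' frame hcolumn => time_addColumn_le (a := ⟨k, hk⟩) hplan
      (hinput.of_frame frame rfl) hcolumn hn hadd).trans ?_
  rw [Finset.sum_const, Finset.card_range, smul_eq_mul, NatExp.eval, hinput.columnCount,
    NatExp.cost]
  have hfaq : d * (m * Q.absorbTime K) ≤ m * (K.mul + K.add) * Q.faqTime := by
    rw [JoinQuery.absorbTime, JoinQuery.faqTime]
    refine (Nat.le_mul_of_pos_left _ hm).trans_eq ?_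
    ring
  have hW : d * Q.maxSize ≤ Q.absorbTime K := Q.mul_maxSize_le_absorbTime hadd
  have hW0 : 0 < m * Q.absorbTime K :=
    Nat.mul_pos hm ((Nat.mul_pos hd hn).trans_le hW)
  have hd' : d ≤ d * (m * Q.absorbTime K) := Nat.le_mul_of_pos_right _ hW0
  linarith

end Prog

end

theorem mainTheorem3 :
    ∃ (P : Prog) (C : ℕ),
      ∀ (m d : ℕ) (Q : JoinQuery m d), Q.Acyclic → 0 < d → 0 < Q.maxSize →
      ∀ (plan : List (PlanStep m d)) (ρ : MulTree m), Q.IsMulOrder plan ρ →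
      ∀ (R : Type*) (S : DBSketch Q ρ R) (K : SketchCosts), 0 < K.add → 0 < K.mul →
        (P.run S K (Q.initState plan R)).1.sk 0 0 0 = some (S.F Q.joinMatrix) ∧
        (P.run S K (Q.initState plan R)).2 ≤
          C * (m * (K.mul + K.add) * Q.faqTime + K.sketch * m * Q.maxSize * d) := by
  refine ⟨Prog.sketchJoin, 4000, fun m d Q _ hd hn plan ρ hplan R S K hadd _ =>
    ⟨Prog.out_exec_sketchJoin hd hplan, (Prog.time_sketchJoin_le hd hn hplan hadd).trans ?_⟩⟩
  omega
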